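/- **Setting.** Let $\phi:J_1\to J_2$ be an increasing homeomorphism between open intervals containing $0$, $\phi(0)=0$, $J_2=(\varrho_-,\varrho_+)$, $h=\phi^{-1}$; let $g:\mathbb R\to\mathbb R$ be continuous with $g(0)=0$ and $g(x)x>0$ for $x\neq0$. Let $0=t_0<s_0<t_1<\dots<t_m<s_m=L$ ($m\ge 0$), $\mu_i>0$, and let $a=\mu_i$ on $[t_i,s_i]$ $(0\le i\le m)$ and $a=0$ on $(s_i,t_{i+1})$ $(0\le i<m)$; put $\tau_i=s_i-t_i$, $\varsigma_i=t_{i+1}-s_i$. Let $H(y)=\int_0^yh$, $G(x)=\int_0^xg$, $F_i=\mu_iG$, $\mathcal H_i(x,y)=H(y)+F_i(x)$ on $\mathbb R\times J_2$, and $H^*=\min\{\lim_{y\to\varrho_-}H(y),\lim_{y\to\varrho_+}H(y)\}$. Denote by $H_\pm^{-1}$, $G_\pm^{-1}$ the inverses of $H$, $G$ restricted to the non-negative ($+$) or non-positive ($-$) half of their domains. For each $i$ let $0<c_{1,i}<c_{2,i}<H^*$ be such that for every $c\in[c_{1,i},c_{2,i}]$ there are $x_{-,i}(c)<0<x_{+,i}(c)$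 with $F_i(x_{\pm,i}(c))=c$, $F_i<c$ on $(x_{-,i}(c),x_{+,i}(c))$ and $F_i'(x_{-,i}(c))<0<F_i'(x_{+,i}(c))$. Let $\mathcal A_i=\{c_{1,i}\le\mathcal H_i\le c_{2,i}\}$, let $\mathcal A_{i,j}$ be its intersection with the closed quadrant $j\in\{I,II,III,IV\}$, and put $$\mathcal T_{i,I}(c)=\int_0^{x_{+,i}(c)}\frac{dx}{h(H_+^{-1}(c-F_i(x)))},\qquad \mathcal T_{i,II}(c)=\int_{x_{-,i}(c)}^0\frac{dx}{h(H_+^{-1}(c-F_i(x)))},$$ $$\mathcal T_{i,III}(c)=\int_{x_{-,i}(c)}^0\frac{dx}{-h(H_-^{-1}(c-F_i(x)))},\qquad \mathcal T_{i,IV}(c)=\int_0^{x_{+,i}(c)}\frac{dx}{-h(H_-^{-1}(c-F_i(x)))},$$ and $\mathcal T_i=\mathcal T_{i,I}+\mathcal T_{i,II}+\mathcal T_{i,III}+\mathcal T_{i,IV}$. Quadrants are ordered cyclically clockwise, so that $\kappa\mapsto\kappa+1$ is $I\mapsto IV\mapsto III\mapsto II\mapsto I$ and $\kappa-1$ is its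 inverse. For $0\le i<m$ let $y_{+,i}=\min\{H_+^{-1}(c_{1,i}),H_+^{-1}(c_{1,i+1})\}$, $y_{-,i}=\max\{H_-^{-1}(c_{1,i}),H_-^{-1}(c_{1,i+1})\}$ and $$\mathcal S_{i,II\to I}=\frac{G_+^{-1}\!\big(\mu_{i+1}^{-1}[c_{2,i+1}-H(y_{+,i})]\big)-G_-^{-1}\!\big(\mu_i^{-1}[c_{2,i}-H(y_{+,i})]\big)}{h(y_{+,i})},$$ $$\mathcal S_{i,IV\to III}=\frac{G_+^{-1}\!\big(\mu_i^{-1}[c_{2,i}-H(y_{-,i})]\big)-G_-^{-1}\!\big(\mu_{i+1}^{-1}[c_{2,i+1}-H(y_{-,i})]\big)}{-h(y_{-,i})}.$$ **Theorem 6.1.** Let $\kappa^0\in\{I,III\}$ and $q^L\in\{II,IV\}$; let $r_0\subset\mathcal A_{0,\kappa^0}$ and $r_L\subset\mathcal A_{m,q^L}$ be arcs (homeomorphic images of $[0,1]$), each joining the inner with the outer boundary of its annulus. Let $0\le\alpha_i<\beta_i$ be integers and $\{d_i,e_i\}=\{c_{1,i},c_{2,i}\}$ such that, for all $i\in\{0,\dots,m\}$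 and $\kappa\in\{I,III\}$, $$\mathcal T_{i,\kappa+1}(d_i)+\mathcal T_{i,\kappa+2}(d_i)+\alpha_i\mathcal T_i(d_i)>\tau_i,\qquad \mathcal T_{i,\kappa}(e_i)+\mathcal T_{i,\kappa+1}(e_i)+\beta_i\mathcal T_i(e_i)<\tau_i,$$ and suppose that $\mathcal S_{i,II\to I}\le\varsigma_i$ and $\mathcal S_{i,IV\to III}\le\varsigma_i$ for all $i\in\{0,\dots,m-1\}$. Then the problem $$x'=h(y),\quad y'=-a(t)g(x)\ \text{ on }[0,L],\qquad (x(0),y(0))\in r_0,\quad (x(L),y(L))\in r_L$$ (the case $\lambda=0$; solutions in the Carathéodory sense, with values in $\mathbb R\times J_2$) has at least $$2^m\prod_{i=0}^m(\beta_i-\alpha_i)$$ distinct nodal solutions (that is, solutions whose $x$-component changes sign), each of which has the nodal properties below for some $(\kappa,q,j)$. More precisely, let $\kappa_0,q_0,\dots,\kappa_m,q_m$ be any itinerary with $\kappa_i\in\{I,III\}$, $q_i\in\{II,IV\}$, $\kappa_0=\kappa^0$, $q_m=q^L$ and $\kappa_{i+1}=q_i+1$ for $i<m$ (that is, $II\to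 I$ or $IV\to III$), and let $j_i\in\{1,\dots,\beta_i-\alpha_i\}$ be any integers. Then there is a nodal solution with $(x,y)(t_i)\in\mathcal A_{i,\kappa_i}$ and $(x,y)(s_i)\in\mathcal A_{i,q_i}$ for all $i$ such that: * if $q_i=\kappa_i-1$, then $x$ has exactly $2(\alpha_i+j_i)-1$ zeros in $(t_i,s_i)$ and $y$ has exactly $2(\alpha_i+j_i)$ zeros in $[t_i,s_i]$; * if $q_i=\kappa_i+1$, then $x$ has exactly $2(\alpha_i+j_i)$ zeros in $(t_i,s_i)$ and $y$ has exactly $2(\alpha_i+j_i)+1$ zeros in $[t_i,s_i]$; * for $i<m$, $x$ has exactly one zero in $[s_i,t_{i+1}]$, it lies in $(s_i,t_{i+1})$, and $y$ has no zero in $[s_i,t_{i+1}]$. -/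

import Mathlib

open Set MeasureTheory

/-- The four closed quadrants of the plane. -/
inductive Quadrant where
  | I : Quadrant
  | II : Quadrant
  | III : Quadrant
  | IV : Quadrant

namespace Quadrant

/-- `κ + 1` in the clockwise cyclic order `I → IV → III → II → I`,
the order in which the orbits visit the quadrants. -/
def next : Quadrant → Quadrant
  | I => IV
  | IV => III
  | III => II
  | II => I

/-- `κ - 1` in the same cyclic order. -/
def prev : Quadrant → Quadrant
  | I => II
  | II => III
  | III => IV
  | IV => I

/-- The closed quadrant as a set of points `(x, y)`. -/
def carrier : Quadrant → Set (ℝ × ℝ)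
  | I => {p | 0 ≤ p.1 ∧ 0 ≤ p.2}
  | II => {p | p.1 ≤ 0 ∧ 0 ≤ p.2}
  | III => {p | p.1 ≤ 0 ∧ p.2 ≤ 0}
  | IV => {p | 0 ≤ p.1 ∧ p.2 ≤ 0}

end Quadrant

/-- The data of the equation `-(φ(u'))' = λ u + a(t) g(u)` on `[0, L]` with a stepwise weight `a`,
with its standing assumptions. `φ` is an increasing homeomorphism of an open
interval `J₁ = φ.source` containing `0` onto the open interval `J₂ = φ.target`. -/
structure StepProblem (m : ℕ) where
  φ : OpenPartialHomeomorph ℝ ℝ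
  source_ordConnected : φ.source.OrdConnected
  zero_mem_source : (0 : ℝ) ∈ φ.source
  φ_zero : φ 0 = 0
  φ_strictMono : StrictMonoOn φ φ.source
  g : ℝ → ℝ
  g_continuous : Continuous g
  g_zero : g 0 = 0
  g_sign : ∀ x, x ≠ 0 → 0 < g x * x
  /-- left ends of the intervals where the weight is positive -/
  t : Fin (m + 1) → ℝ
  /-- right ends of the intervals where the weight is positive -/
  s : Fin (m + 1) → ℝ
  t_zero : t 0 = 0
  t_lt_s : ∀ i, t i < s i
  s_lt_t : ∀ i : Fin m, s i.castSucc < t i.succ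
  /-- the values of the weight -/
  μ : Fin (m + 1) → ℝ
  μ_pos : ∀ i, 0 < μ i
  a : ℝ → ℝ
  a_eq_μ : ∀ i, ∀ τ ∈ Icc (t i) (s i), a τ = μ i
  a_eq_zero : ∀ i : Fin m, ∀ τ ∈ Ioo (s i.castSucc) (t i.succ), a τ = 0

namespace StepProblem

variable {m : ℕ} (P : StepProblem m)

/-- The length `L = s_m` of the whole interval. -/
def L : ℝ := P.s (Fin.last m)

/-- `J₂ = (ϱ₋, ϱ₊)`, the domain of `h`. -/
def J : Set ℝ := P.φ.target

/-- `h = φ⁻¹ : J₂ → J₁`. -/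
noncomputable def h (y : ℝ) : ℝ := P.φ.symm y

/-- `H(y) = ∫₀^y h`, for `y ∈ J₂`. -/
noncomputable def H (y : ℝ) : ℝ := ∫ v in (0 : ℝ)..y, P.h v

/-- `G(x) = ∫₀^x g`. -/
noncomputable def G (x : ℝ) : ℝ := ∫ v in (0 : ℝ)..x, P.g v

/-- `H^* = min {H(ϱ₋), H(ϱ₊)}`. As `H` is monotone on each side of `0`, its limits
at `ϱ₊` and `ϱ₋` (possibly `+∞`) are suprema. -/
noncomputable def Hstar : EReal :=
  min (⨆ y ∈ P.J ∩ Iic 0, (P.H y : EReal)) (⨆ y ∈ P.J ∩ Ici 0, (P.H y : EReal))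

/-- The inverse `H₊⁻¹` of `H` restricted to `[0, ϱ₊)`. -/
noncomputable def HposInv (c : ℝ) : ℝ := Function.invFunOn P.H (P.J ∩ Ici 0) c

/-- The inverse `H₋⁻¹` of `H` restricted to `(ϱ₋, 0]`. -/
noncomputable def HnegInv (c : ℝ) : ℝ := Function.invFunOn P.H (P.J ∩ Iic 0) c

/-- The inverse `G₊⁻¹` of `G` restricted to `[0, ∞)`. -/
noncomputable def GposInv (c : ℝ) : ℝ := Function.invFunOn P.G (Ici 0) c

/-- The inverse `G₋⁻¹` of `G` restricted to `(-∞, 0]`. -/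
noncomputable def GnegInv (c : ℝ) : ℝ := Function.invFunOn P.G (Iic 0) c

/-- `F_{i,0} = μ_i G`, the potential of the nonlinear system `x' = h(y)`, `y' = -μ_i g(x)`
(the case `λ = 0`). -/
noncomputable def F (i : Fin (m + 1)) (x : ℝ) : ℝ := P.μ i * P.G x

/-- The Hamiltonian `ℋ_{i,0}(x, y) = H(y) + F_{i,0}(x)`. -/
noncomputable def energy (i : Fin (m + 1)) (p : ℝ × ℝ) : ℝ := P.H p.2 + P.F i p.1

/-- Existence of the crossing abscissas `x₋(c) < 0 < x₊(c)`, which makes the level line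
`ℋ_{i,0} = c` a closed orbit around the origin. -/
def HasCrossings (i : Fin (m + 1)) (c : ℝ) : Prop :=
  ∃ xm xp : ℝ, xm < 0 ∧ 0 < xp ∧ P.F i xm = c ∧ P.F i xp = c ∧
    (∀ x ∈ Ioo xm xp, P.F i x < c) ∧ P.μ i * P.g xm < 0 ∧ 0 < P.μ i * P.g xp

/-- The levels `c₁ < c₂` define an annulus of closed orbits of the `i`-th nonlinear system
inside `ℝ × J₂`. -/
def AnnulusLevels (i : Fin (m + 1)) (c₁ c₂ : ℝ) : Prop :=
  0 < c₁ ∧ c₁ < c₂ ∧ (c₂ : EReal) < P.Hstar ∧ ∀ c ∈ Icc c₁ c₂, P.HasCrossings i c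

/-- `x₊(c)`: the positive abscissa with `F_{i,0}(x₊(c)) = c`. -/
noncomputable def xpos (i : Fin (m + 1)) (c : ℝ) : ℝ := P.GposInv (c / P.μ i)

/-- `x₋(c)`: the negative abscissa with `F_{i,0}(x₋(c)) = c`. -/
noncomputable def xneg (i : Fin (m + 1)) (c : ℝ) : ℝ := P.GnegInv (c / P.μ i)

/-- The time `𝒯_{i,j}(c)` that the orbit `ℋ_{i,0} = c` needs to cross the quadrant `j`. -/
noncomputable def crossTime (i : Fin (m + 1)) (c : ℝ) : Quadrant → ℝ
  | .I => ∫ x in (0 : ℝ)..P.xpos i c, 1 / P.h (P.HposInv (c - P.F i x))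
  | .II => ∫ x in P.xneg i c..(0 : ℝ), 1 / P.h (P.HposInv (c - P.F i x))
  | .III => ∫ x in P.xneg i c..(0 : ℝ), 1 / -P.h (P.HnegInv (c - P.F i x))
  | .IV => ∫ x in (0 : ℝ)..P.xpos i c, 1 / -P.h (P.HnegInv (c - P.F i x))

/-- The period `𝒯_i(c)` of the orbit `ℋ_{i,0} = c`. -/
noncomputable def period (i : Fin (m + 1)) (c : ℝ) : ℝ :=
  P.crossTime i c .I + P.crossTime i c .IV + P.crossTime i c .III + P.crossTime i c .II

/-- The twist condition at the quadrant `κ`, with levels `d`, `e` and integers `α`, `β`;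
the time length is `τ_i = s_i - t_i`. -/
def Twist (i : Fin (m + 1)) (κ : Quadrant) (d e : ℝ) (α β : ℕ) : Prop :=
  P.s i - P.t i <
      P.crossTime i d κ.next + P.crossTime i d κ.next.next + α * P.period i d ∧
    P.crossTime i e κ + P.crossTime i e κ.next + β * P.period i e < P.s i - P.t i

/-- `A_{i,q}`: the part of the annulus `c_{1,i} ≤ ℋ_{i,0} ≤ c_{2,i}` in the closed quadrant `q`. -/
def block (c₁ c₂ : Fin (m + 1) → ℝ) (i : Fin (m + 1)) (q : Quadrant) : Set (ℝ × ℝ) :=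
  {p | p.2 ∈ P.J ∧ c₁ i ≤ P.energy i p ∧ P.energy i p ≤ c₂ i ∧ p ∈ q.carrier}

/-- `r` is an arc (a homeomorphic image of `[0, 1]`) contained in `A_{i,q}` and joining the inner
boundary of the annulus with the outer one. -/
def IsBoundaryArc (c₁ c₂ : Fin (m + 1) → ℝ) (i : Fin (m + 1)) (q : Quadrant)
    (r : Set (ℝ × ℝ)) : Prop :=
  r ⊆ P.block c₁ c₂ i q ∧
    ∃ γ : C(unitInterval, ℝ × ℝ), Function.Injective γ ∧ range γ = r ∧
      P.energy i (γ 0) = c₁ i ∧ P.energy i (γ 1) = c₂ i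

/-- `y_{+,i} = min {y₊(c_{1,i}), y₊(c_{1,i+1})}`. -/
noncomputable def yplus (c₁ : Fin (m + 1) → ℝ) (i : Fin m) : ℝ :=
  min (P.HposInv (c₁ i.castSucc)) (P.HposInv (c₁ i.succ))

/-- `y_{-,i} = max {y₋(c_{1,i}), y₋(c_{1,i+1})}`. -/
noncomputable def yminus (c₁ : Fin (m + 1) → ℝ) (i : Fin m) : ℝ :=
  max (P.HnegInv (c₁ i.castSucc)) (P.HnegInv (c₁ i.succ))

/-- The transition time `𝒮_{i,II→I} = (x_{r,i+1} - x_{ℓ,i}) / h(y_{+,i})`, along the line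
`y = y_{+,i}`, from the outer boundary of `A_{i,II}` to the one of `A_{i+1,I}`, for `λ = 0`. -/
noncomputable def transUpper (c₁ c₂ : Fin (m + 1) → ℝ) (i : Fin m) : ℝ :=
  (P.GposInv ((P.μ i.succ)⁻¹ * (c₂ i.succ - P.H (P.yplus c₁ i))) -
    P.GnegInv ((P.μ i.castSucc)⁻¹ * (c₂ i.castSucc - P.H (P.yplus c₁ i)))) /
      P.h (P.yplus c₁ i)

/-- The transition time `𝒮_{i,IV→III} = (x_{r,i} - x_{ℓ,i+1}) / (-h(y_{-,i}))`, along the line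
`y = y_{-,i}`, from the outer boundary of `A_{i,IV}` to the one of `A_{i+1,III}`, for `λ = 0`. -/
noncomputable def transLower (c₁ c₂ : Fin (m + 1) → ℝ) (i : Fin m) : ℝ :=
  (P.GposInv ((P.μ i.castSucc)⁻¹ * (c₂ i.castSucc - P.H (P.yminus c₁ i))) -
    P.GnegInv ((P.μ i.succ)⁻¹ * (c₂ i.succ - P.H (P.yminus c₁ i)))) /
      -P.h (P.yminus c₁ i)

/-- `(x, y)` is a Carathéodory solution on `[0, L]` of `x' = h(y)`, `y' = -λ x - a(t) g(x)`
with `(x(0), y(0)) ∈ r₀` and `(x(L), y(L)) ∈ r_L`. -/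
structure IsSolution (lam : ℝ) (r₀ rL : Set (ℝ × ℝ)) (x y : ℝ → ℝ) : Prop where
  acx : AbsolutelyContinuousOnInterval x 0 P.L
  acy : AbsolutelyContinuousOnInterval y 0 P.L
  mem_dom : ∀ τ ∈ Icc 0 P.L, y τ ∈ P.J
  eqs : ∀ᵐ τ, τ ∈ Icc 0 P.L →
    HasDerivAt x (P.h (y τ)) τ ∧ HasDerivAt y (-lam * x τ - P.a τ * P.g (x τ)) τ
  init : (x 0, y 0) ∈ r₀
  term : (x P.L, y P.L) ∈ rL

/-- A nodal (sign-changing) solution. -/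
def IsNodalSolution (lam : ℝ) (r₀ rL : Set (ℝ × ℝ)) (x y : ℝ → ℝ) : Prop :=
  P.IsSolution lam r₀ rL x y ∧
    (∃ τ ∈ Icc 0 P.L, 0 < x τ) ∧ ∃ τ ∈ Icc 0 P.L, x τ < 0

/-- An admissible itinerary `κ₀ → q₀ → κ₁ → q₁ → ⋯ → κ_m → q_m` of the diagram for `λ = 0`:
at the time `t_i` the solution is in the block `κ_i ∈ {I, III}`, at `s_i` it is in the block
`q_i ∈ {II, IV}`; the nonlinear system allows all transitions `κ_i → q_i`, the degenerate one
only `II → I` and `IV → III`. -/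
def AdmissibleItinerary (κ q : Fin (m + 1) → Quadrant) : Prop :=
  (∀ i, κ i = .I ∨ κ i = .III) ∧ (∀ i, q i = .II ∨ q i = .IV) ∧
    ∀ i : Fin m, (q i.castSucc = .II ∧ κ i.succ = .I) ∨
      (q i.castSucc = .IV ∧ κ i.succ = .III)

/-- `(x, y)` follows the itinerary `(κ, q)` and has the nodal counter given by `α` and `j`. -/
structure Follows (c₁ c₂ : Fin (m + 1) → ℝ) (α : Fin (m + 1) → ℕ)
    (κ q : Fin (m + 1) → Quadrant) (j : Fin (m + 1) → ℕ) (x y : ℝ → ℝ) : Prop where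
  at_t : ∀ i, (x (P.t i), y (P.t i)) ∈ P.block c₁ c₂ i (κ i)
  at_s : ∀ i, (x (P.s i), y (P.s i)) ∈ P.block c₁ c₂ i (q i)
  count_prev : ∀ i, q i = (κ i).prev →
    {τ ∈ Ioo (P.t i) (P.s i) | x τ = 0}.encard = (2 * (α i + j i) - 1 : ℕ) ∧
    {τ ∈ Icc (P.t i) (P.s i) | y τ = 0}.encard = (2 * (α i + j i) : ℕ)
  count_next : ∀ i, q i = (κ i).next →
    {τ ∈ Ioo (P.t i) (P.s i) | x τ = 0}.encard = (2 * (α i + j i) : ℕ) ∧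
    {τ ∈ Icc (P.t i) (P.s i) | y τ = 0}.encard = (2 * (α i + j i) + 1 : ℕ)
  count_degenerate : ∀ i : Fin m,
    {τ ∈ Ioo (P.s i.castSucc) (P.t i.succ) | x τ = 0}.encard = 1 ∧
    {τ ∈ Icc (P.s i.castSucc) (P.t i.succ) | x τ = 0}.encard = 1 ∧
    ∀ τ ∈ Icc (P.s i.castSucc) (P.t i.succ), y τ ≠ 0

end StepProblem

/-! On an interval where `a = μ_i` the system is autonomous and conserves the energy
`H y + μ_i G x`; by the hypothesis on the levels, the annulus `𝒜_i` is filled by closed orbits around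
the origin. Nothing outside the annuli matters, so `h` and `g` are first replaced by forces on the
whole line (`StepProblem.exists_isGlobal`) which agree with them there and are constant far out; in
the class `Force` potentials are coercive, and reflections, turns and exchanges of the coordinates
stay inside the class.

Uniqueness of solutions is not available, since `g` is only continuous, and no flow is used.
Instead, solutions are written down explicitly. An eighth of an orbit, on which `x` is a monotone
function of the time and the velocity stays away from `0`, is obtained by inverting an integral
(`PlanarSystem.arc`). Exchanging the coordinates gives the next eighth, and turning by right angles
gives an orbit that winds around the origin as often as desired (`PlanarSystem.orbit`), depending
continuously on the energy and the time. Its quarter turns take exactly the times `𝒯`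
(`PlanarSystem.integral_eq_quarterTime`, `StepProblem.IsGlobal.crossTime_eq`).

The point with the phase `φ` on the level `c` has, after the time `τ_i`, the phase `φ + τ_i`, and it
is in the `n`-th following quadrant if and only if `φ + τ_i` lies between the times of `n` and `n + 1`
quarter turns. The two twist conditions say that, along a path joining the two boundaries of the
annulus inside one quadrant, this quantity passes all the quadrants with the indices `2 r + 1`, where
`r = 2 (α + j) - 1` or `r = 2 (α + j)`. Hence a subpath is mapped to a path that crosses the desired
quadrant from the `x`-axis to the `y`-axis, and the zeros are counted by the quarter turns
(`PlanarSystem.exists_stretched_subpath`). On the intervals where `a = 0` the motion is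
horizontal. The bounds on `𝒮` make a path of this kind drift across the `y`-axis, so that a subpath of
its image joins the two boundaries of the next annulus inside the next quadrant
(`Force.exists_drift_subpath`).

Both stretching properties are applied alternately to the arc `r₀` of initial values. What remains at
the time `L` is a path crossing the last quadrant from the `x`-axis to the `y`-axis, and it has to
meet the arc `r_L`, which crosses the same quadrant from the inner to the outer boundary; this is the
planar Poincaré–Miranda theorem (`exists_common_zero`). Finally, a solution determines its itinerary
and its counter (`StepProblem.Follows.unique`), and there are `2 ^ m` itineraries between the
prescribed ends, one for each choice of the quadrants at the times `s_i`, `i < m`. -/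

/-! ### Restoring forces and their potentials -/

/-- A restoring force on the line: a continuous function with the sign of its argument whose
potential is unbounded on both sides of `0`. Both right-hand sides of the planar systems
`x' = h y`, `y' = -f x` below are of this kind. -/
structure Force where
  toFun : ℝ → ℝ
  continuous : Continuous toFun
  pos : ∀ x, 0 < x → 0 < toFun x
  neg : ∀ x, x < 0 → toFun x < 0
  unbounded_right : ∀ c : ℝ, ∃ x, 0 ≤ x ∧ c ≤ ∫ v in (0 : ℝ)..x, toFun v
  unbounded_left : ∀ c : ℝ, ∃ x, x ≤ 0 ∧ c ≤ ∫ v in (0 : ℝ)..x, toFun v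

namespace Force

instance : CoeFun Force (fun _ => ℝ → ℝ) := ⟨Force.toFun⟩

variable (f : Force)

/-- The potential of a restoring force. -/
noncomputable def pot (x : ℝ) : ℝ := ∫ v in (0 : ℝ)..x, f v

lemma apply_zero : f 0 = 0 := by
  apply le_antisymm
  · by_contra! h
    obtain ⟨ε, hε, h'⟩ := Metric.eventually_nhds_iff.1
      (f.continuous.continuousAt.eventually (lt_mem_nhds h))
    have h1 : 0 < f (-(ε / 2)) :=
      h' (by rw [Real.dist_eq, sub_zero, abs_neg, abs_of_pos (by positivity)]; linarith)
    exact absurd (f.neg (-(ε / 2)) (by linarith)) h1.not_gt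
  · by_contra! h
    obtain ⟨ε, hε, h'⟩ := Metric.eventually_nhds_iff.1
      (f.continuous.continuousAt.eventually (gt_mem_nhds h))
    have h1 : f (ε / 2) < 0 :=
      h' (by rw [Real.dist_eq, sub_zero, abs_of_pos (by positivity)]; linarith)
    exact absurd (f.pos (ε / 2) (by linarith)) h1.not_gt

lemma hasDerivAt_pot (x : ℝ) : HasDerivAt f.pot (f x) x :=
  f.continuous.integral_hasStrictDerivAt 0 x |>.hasDerivAt

lemma continuous_pot : Continuous f.pot :=
  continuous_iff_continuousAt.2 fun x => (f.hasDerivAt_pot x).continuousAt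

@[simp] lemma pot_zero : f.pot 0 = 0 := by simp [pot]

lemma strictMonoOn_pot : StrictMonoOn f.pot (Ici 0) := by
  apply strictMonoOn_of_deriv_pos (convex_Ici 0) f.continuous_pot.continuousOn
  intro x hx
  rw [interior_Ici] at hx
  rw [(f.hasDerivAt_pot x).deriv]
  exact f.pos x hx

lemma strictAntiOn_pot : StrictAntiOn f.pot (Iic 0) := by
  apply strictAntiOn_of_deriv_neg (convex_Iic 0) f.continuous_pot.continuousOn
  intro x hx
  rw [interior_Iic] at hx
  rw [(f.hasDerivAt_pot x).deriv]
  exact f.neg x hx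

lemma pot_pos {x : ℝ} (hx : x ≠ 0) : 0 < f.pot x := by
  rcases hx.lt_or_gt with h | h
  · simpa using f.strictAntiOn_pot h.le self_mem_Iic h
  · simpa using f.strictMonoOn_pot self_mem_Ici h.le h

lemma pot_nonneg (x : ℝ) : 0 ≤ f.pot x := by
  rcases eq_or_ne x 0 with rfl | h
  · simp
  · exact (f.pot_pos h).le

/-- The reflected force `x ↦ -f (-x)`. -/
def reflect : Force where
  toFun x := -f (-x)
  continuous := (f.continuous.comp continuous_neg).neg
  pos x hx := neg_pos.2 (f.neg _ (neg_lt_zero.2 hx))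
  neg x hx := neg_lt_zero.2 (f.pos _ (neg_pos.2 hx))
  unbounded_right c := by
    obtain ⟨x, hx, h⟩ := f.unbounded_left c
    refine ⟨-x, by linarith, ?_⟩
    rw [intervalIntegral.integral_neg, intervalIntegral.integral_comp_neg, neg_neg, neg_zero,
      ← intervalIntegral.integral_symm]
    exact h
  unbounded_left c := by
    obtain ⟨x, hx, h⟩ := f.unbounded_right c
    refine ⟨-x, by linarith, ?_⟩
    rw [intervalIntegral.integral_neg, intervalIntegral.integral_comp_neg, neg_neg, neg_zero,
      ← intervalIntegral.integral_symm]
    exact h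

lemma reflect_apply (x : ℝ) : f.reflect x = -f (-x) := rfl

@[simp] lemma reflect_reflect : f.reflect.reflect = f := by
  cases f
  simp [reflect]

lemma pot_reflect (x : ℝ) : f.reflect.pot x = f.pot (-x) := by
  simp only [pot, reflect_apply]
  rw [intervalIntegral.integral_neg, intervalIntegral.integral_comp_neg, neg_zero,
    ← intervalIntegral.integral_symm]

/-- The potential on `[0, ∞)`, continued by the identity to an increasing bijection of the line. -/
noncomputable def potExt (x : ℝ) : ℝ := if 0 ≤ x then f.pot x else x

lemma strictMono_potExt : StrictMono f.potExt := by
  intro x y hxy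
  unfold potExt
  split_ifs with hx hy hy
  · exact f.strictMonoOn_pot hx hy hxy
  · exact absurd (hx.trans hxy.le) hy
  · exact (not_le.1 hx).trans_le (f.pot_nonneg y)
  · exact hxy

lemma surjective_potExt : Function.Surjective f.potExt := by
  intro c
  rcases lt_or_ge c 0 with hc | hc
  · exact ⟨c, by simp [potExt, hc]⟩
  · obtain ⟨R, hR, h⟩ := f.unbounded_right c
    obtain ⟨x, hx, rfl⟩ := intermediate_value_Icc hR f.continuous_pot.continuousOn
      (show c ∈ Icc (f.pot 0) (f.pot R) from ⟨by simpa using hc, h⟩)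
    exact ⟨x, by simp [potExt, hx.1]⟩

/-- The inverse of the potential restricted to `[0, ∞)`. For negative levels it is the identity,
which makes it continuous on the whole line. -/
noncomputable def inv (c : ℝ) : ℝ :=
  (f.strictMono_potExt.orderIsoOfSurjective _ f.surjective_potExt).symm c

lemma potExt_inv (c : ℝ) : f.potExt (f.inv c) = c :=
  (f.strictMono_potExt.orderIsoOfSurjective _ f.surjective_potExt).apply_symm_apply c

lemma continuous_inv : Continuous f.inv :=
  (f.strictMono_potExt.orderIsoOfSurjective _ f.surjective_potExt).symm.continuous

lemma strictMono_inv : StrictMono f.inv :=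
  (f.strictMono_potExt.orderIsoOfSurjective _ f.surjective_potExt).symm.strictMono

lemma inv_pot {x : ℝ} (hx : 0 ≤ x) : f.inv (f.pot x) = x := by
  apply f.strictMono_potExt.injective
  rw [potExt_inv, potExt, if_pos hx]

@[simp] lemma inv_zero : f.inv 0 = 0 := by simpa using f.inv_pot le_rfl

lemma inv_nonneg {c : ℝ} (hc : 0 ≤ c) : 0 ≤ f.inv c := by
  simpa using f.strictMono_inv.monotone hc

lemma inv_pos {c : ℝ} (hc : 0 < c) : 0 < f.inv c := by
  simpa using f.strictMono_inv hc

lemma pot_inv {c : ℝ} (hc : 0 ≤ c) : f.pot (f.inv c) = c := by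
  have := f.potExt_inv c
  rwa [potExt, if_pos (f.inv_nonneg hc)] at this

lemma inv_eq_iff {c x : ℝ} (hc : 0 ≤ c) (hx : 0 ≤ x) : f.inv c = x ↔ f.pot x = c :=
  ⟨fun h => by rw [← h, f.pot_inv hc], fun h => by rw [← h, f.inv_pot hx]⟩

lemma hasDerivAt_inv {c : ℝ} (hc : 0 < c) : HasDerivAt f.inv (f (f.inv c))⁻¹ c := by
  apply HasDerivAt.of_local_left_inverse f.continuous_inv.continuousAt (f.hasDerivAt_pot _)
    (f.pos _ (f.inv_pos hc)).ne'
  filter_upwards [lt_mem_nhds hc] with y hy using f.pot_inv hy.le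

end Force

/-! ### One eighth of a closed orbit -/

/-- The planar Hamiltonian system `x' = h y`, `y' = -f x`. -/
structure PlanarSystem where
  h : Force
  f : Force

namespace PlanarSystem

variable (S : PlanarSystem)

/-- The system read backwards in time after exchanging the two coordinates. -/
def swap : PlanarSystem := ⟨S.f, S.h⟩

@[simp] lemma swap_h : S.swap.h = S.f := rfl
@[simp] lemma swap_f : S.swap.f = S.h := rfl

/-- The Hamiltonian. -/
noncomputable def energy (p : ℝ × ℝ) : ℝ := S.h.pot p.2 + S.f.pot p.1

/-- The velocity `x'` along the orbit of energy `c`, as a function of `x`, on the upper arc where the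
potential energy of `x` is at most `c / 2`; it is frozen outside this arc, so that it is positive
everywhere. -/
noncomputable def speed (c x : ℝ) : ℝ := S.h (S.h.inv (max (c - S.f.pot x) (c / 2)))

lemma speed_pos {c : ℝ} (hc : 0 < c) (x : ℝ) : 0 < S.speed c x :=
  S.h.pos _ (S.h.inv_pos (lt_max_of_lt_right (by positivity)))

lemma continuous_speed {X : Type*} [TopologicalSpace X] {c x : X → ℝ} (hc : Continuous c)
    (hx : Continuous x) : Continuous fun t => S.speed (c t) (x t) :=
  S.h.continuous.comp (S.h.continuous_inv.comp
    ((hc.sub (S.f.continuous_pot.comp hx)).max (hc.div_const 2)))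

/-- The time from the `y`-axis to the abscissa `x` along the upper arc of energy `c`. -/
noncomputable def arcTime (c x : ℝ) : ℝ := ∫ v in (0 : ℝ)..x, (S.speed c v)⁻¹

@[simp] lemma arcTime_zero (c : ℝ) : S.arcTime c 0 = 0 := by simp [arcTime]

lemma continuous_arcTime {X : Type*} [TopologicalSpace X] [FirstCountableTopology X] {c x : X → ℝ}
    (hc : Continuous c) (hx : Continuous x) (h0 : ∀ t, 0 < c t) :
    Continuous fun t => S.arcTime (c t) (x t) := by
  apply intervalIntegral.continuous_parametric_intervalIntegral_of_continuous _ hx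
  apply Continuous.inv₀
  · exact S.continuous_speed (hc.comp continuous_fst) continuous_snd
  · rintro ⟨t, v⟩
    exact (S.speed_pos (h0 t) v).ne'

lemma hasDerivAt_arcTime {c : ℝ} (hc : 0 < c) (x : ℝ) :
    HasDerivAt (S.arcTime c) (S.speed c x)⁻¹ x :=
  (((S.continuous_speed continuous_const continuous_id).inv₀
    fun v => (S.speed_pos hc v).ne').integral_hasStrictDerivAt 0 x).hasDerivAt

lemma strictMono_arcTime {c : ℝ} (hc : 0 < c) : StrictMono (S.arcTime c) := by
  apply strictMono_of_deriv_pos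
  intro x
  rw [(S.hasDerivAt_arcTime hc x).deriv]
  exact inv_pos.2 (S.speed_pos hc x)

lemma exists_speed_le {c : ℝ} (hc : 0 < c) : ∃ M, 0 < M ∧ ∀ x, S.speed c x ≤ M := by
  obtain ⟨M, hM⟩ := (isCompact_Icc (a := c / 2) (b := c)).exists_bound_of_continuousOn
    (S.h.continuous.comp S.h.continuous_inv).continuousOn
  have key : ∀ x, S.speed c x ≤ M := fun x => by
    refine (le_abs_self _).trans (hM _ ⟨le_max_right _ _, max_le ?_ (by linarith)⟩)
    linarith [S.f.pot_nonneg x]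
  exact ⟨M, (S.speed_pos hc 0).trans_le (key 0), key⟩

lemma surjective_arcTime {c : ℝ} (hc : 0 < c) : Function.Surjective (S.arcTime c) := by
  obtain ⟨M, hM, hle⟩ := S.exists_speed_le hc
  have hcont : Continuous fun v => (S.speed c v)⁻¹ :=
    (S.continuous_speed continuous_const continuous_id).inv₀ fun v => (S.speed_pos hc v).ne'
  have hbd : ∀ a b : ℝ, a ≤ b → M⁻¹ * (b - a) ≤ ∫ v in a..b, (S.speed c v)⁻¹ := fun a b hab => by
    have := intervalIntegral.integral_mono_on (μ := volume) hab (f := fun _ => M⁻¹)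
      (g := fun v => (S.speed c v)⁻¹) intervalIntegrable_const (hcont.intervalIntegrable _ _)
      fun x _ => inv_anti₀ (S.speed_pos hc x) (hle x)
    simpa [mul_comm] using this
  have hMi : 0 < M⁻¹ := inv_pos.2 hM
  apply (S.continuous_arcTime continuous_const continuous_id fun _ => hc).surjective
  · apply Filter.tendsto_atTop_mono' _ _ (Filter.tendsto_id.const_mul_atTop hMi)
    filter_upwards [Filter.eventually_ge_atTop 0] with x hx
    simpa [arcTime] using hbd 0 x hx
  · apply Filter.tendsto_atBot_mono' _ _ (Filter.tendsto_id.const_mul_atBot hMi)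
    filter_upwards [Filter.eventually_le_atBot 0] with x hx
    have := hbd x 0 hx
    simp only [arcTime, id]
    rw [intervalIntegral.integral_symm]
    linarith

open Classical in
/-- The abscissa reached at the time `σ` by the upper arc of energy `c` starting on the `y`-axis:
the inverse of `arcTime`. The value for `c ≤ 0` is irrelevant. -/
noncomputable def arcX (c σ : ℝ) : ℝ :=
  if hc : 0 < c then
    ((S.strictMono_arcTime hc).orderIsoOfSurjective _ (S.surjective_arcTime hc)).symm σ
  else 0

lemma arcTime_arcX {c : ℝ} (hc : 0 < c) (σ : ℝ) : S.arcTime c (S.arcX c σ) = σ := by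
  rw [arcX, dif_pos hc]
  exact ((S.strictMono_arcTime hc).orderIsoOfSurjective _
    (S.surjective_arcTime hc)).apply_symm_apply σ

lemma arcX_arcTime {c : ℝ} (hc : 0 < c) (x : ℝ) : S.arcX c (S.arcTime c x) = x :=
  (S.strictMono_arcTime hc).injective (S.arcTime_arcX hc _)

lemma arcX_zero {c : ℝ} (hc : 0 < c) : S.arcX c 0 = 0 := by
  simpa using S.arcX_arcTime hc 0

lemma strictMono_arcX {c : ℝ} (hc : 0 < c) : StrictMono (S.arcX c) := by
  intro a b hab
  rwa [← (S.strictMono_arcTime hc).lt_iff_lt, S.arcTime_arcX hc, S.arcTime_arcX hc]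

lemma continuous_arcX {X : Type*} [TopologicalSpace X] [FirstCountableTopology X] {c σ : X → ℝ}
    (hc : Continuous c) (hσ : Continuous σ) (h0 : ∀ t, 0 < c t) :
    Continuous fun t => S.arcX (c t) (σ t) := by
  rw [continuous_iff_continuousAt]
  intro t₀
  rw [ContinuousAt, tendsto_order]
  constructor
  · intro a ha
    rw [← (S.strictMono_arcTime (h0 t₀)).lt_iff_lt, S.arcTime_arcX (h0 t₀)] at ha
    filter_upwards [(S.continuous_arcTime hc (continuous_const (y := a)) h0).continuousAt.eventually_lt
      hσ.continuousAt ha] with t ht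
    rwa [← (S.strictMono_arcTime (h0 t)).lt_iff_lt, S.arcTime_arcX (h0 t)]
  · intro a ha
    rw [gt_iff_lt, ← (S.strictMono_arcTime (h0 t₀)).lt_iff_lt, S.arcTime_arcX (h0 t₀)] at ha
    filter_upwards [hσ.continuousAt.eventually_lt
      (S.continuous_arcTime hc (continuous_const (y := a)) h0).continuousAt ha] with t ht
    rwa [← (S.strictMono_arcTime (h0 t)).lt_iff_lt, S.arcTime_arcX (h0 t)]

lemma hasDerivAt_arcX {c : ℝ} (hc : 0 < c) (σ : ℝ) :
    HasDerivAt (S.arcX c) (S.speed c (S.arcX c σ)) σ := by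
  have h := HasDerivAt.of_local_left_inverse
    (S.continuous_arcX continuous_const continuous_id fun _ : ℝ => hc).continuousAt
    (S.hasDerivAt_arcTime hc (S.arcX c σ)) (inv_pos.2 (S.speed_pos hc _)).ne'
    (Filter.Eventually.of_forall (S.arcTime_arcX hc))
  simpa using h

/-- The point reached at the time `σ` by the upper arc of energy `c` starting on the `y`-axis. -/
noncomputable def arc (c σ : ℝ) : ℝ × ℝ :=
  (S.arcX c σ, S.h.inv (max (c - S.f.pot (S.arcX c σ)) (c / 2)))

lemma continuous_arc {X : Type*} [TopologicalSpace X] [FirstCountableTopology X] {c σ : X → ℝ}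
    (hc : Continuous c) (hσ : Continuous σ) (h0 : ∀ t, 0 < c t) :
    Continuous fun t => S.arc (c t) (σ t) := by
  have h := S.continuous_arcX hc hσ h0
  exact h.prodMk (S.h.continuous_inv.comp
    ((hc.sub (S.f.continuous_pot.comp h)).max (hc.div_const 2)))

/-- The time needed for one eighth of the orbit of energy `c`: from the positive `y`-axis to the
point where both energies are `c / 2`. -/
noncomputable def eighth (c : ℝ) : ℝ := S.arcTime c (S.f.inv (c / 2))

lemma eighth_pos {c : ℝ} (hc : 0 < c) : 0 < S.eighth c := by
  simpa [eighth] using S.strictMono_arcTime hc (S.f.inv_pos (half_pos hc))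

lemma continuous_eighth {X : Type*} [TopologicalSpace X] [FirstCountableTopology X] {c : X → ℝ}
    (hc : Continuous c) (h0 : ∀ t, 0 < c t) : Continuous fun t => S.eighth (c t) :=
  S.continuous_arcTime hc (S.f.continuous_inv.comp (hc.div_const 2)) h0

lemma arcX_eighth {c : ℝ} (hc : 0 < c) : S.arcX c (S.eighth c) = S.f.inv (c / 2) :=
  S.arcX_arcTime hc _

lemma arcX_nonneg {c σ : ℝ} (hc : 0 < c) (hσ : 0 ≤ σ) : 0 ≤ S.arcX c σ := by
  simpa [S.arcX_zero hc] using (S.strictMono_arcX hc).monotone hσ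

lemma pot_arcX_le {c σ : ℝ} (hc : 0 < c) (hσ : 0 ≤ σ) (hσ' : σ ≤ S.eighth c) :
    S.f.pot (S.arcX c σ) ≤ c / 2 := by
  rw [← S.f.pot_inv (half_pos hc).le, ← S.arcX_eighth hc]
  exact S.f.strictMonoOn_pot.monotoneOn (S.arcX_nonneg hc hσ)
    (S.arcX_nonneg hc (hσ.trans hσ')) ((S.strictMono_arcX hc).monotone hσ')

lemma pot_arcX_lt {c σ : ℝ} (hc : 0 < c) (hσ : 0 ≤ σ) (hσ' : σ < S.eighth c) :
    S.f.pot (S.arcX c σ) < c / 2 := by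
  rw [← S.f.pot_inv (half_pos hc).le, ← S.arcX_eighth hc]
  exact S.f.strictMonoOn_pot (S.arcX_nonneg hc hσ)
    (S.arcX_nonneg hc (hσ.trans hσ'.le)) (S.strictMono_arcX hc hσ')

lemma arc_snd_pos {c : ℝ} (hc : 0 < c) (σ : ℝ) : 0 < (S.arc c σ).2 :=
  S.h.inv_pos (lt_max_of_lt_right (by positivity))

lemma arc_snd {c σ : ℝ} (hc : 0 < c) (hσ : 0 ≤ σ) (hσ' : σ ≤ S.eighth c) :
    (S.arc c σ).2 = S.h.inv (c - S.f.pot (S.arc c σ).1) := by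
  have := S.pot_arcX_le hc hσ hσ'
  simp only [arc]
  rw [max_eq_left (by linarith)]

lemma energy_arc {c σ : ℝ} (hc : 0 < c) (hσ : 0 ≤ σ) (hσ' : σ ≤ S.eighth c) :
    S.energy (S.arc c σ) = c := by
  have := S.pot_arcX_le hc hσ hσ'
  rw [energy, S.arc_snd hc hσ hσ', S.h.pot_inv]
  · ring
  · simp only [arc]; linarith

lemma arc_zero {c : ℝ} (hc : 0 < c) : S.arc c 0 = (0, S.h.inv c) := by
  have h := S.arc_snd hc le_rfl (S.eighth_pos hc).le
  have h1 : (S.arc c 0).1 = 0 := S.arcX_zero hc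
  ext
  · exact h1
  · rw [h, h1]; simp

lemma arc_eighth {c : ℝ} (hc : 0 < c) :
    S.arc c (S.eighth c) = (S.f.inv (c / 2), S.h.inv (c / 2)) := by
  simp only [arc, S.arcX_eighth hc, S.f.pot_inv (half_pos hc).le]
  congr 2
  rw [max_eq_right (by linarith)]

lemma hasDerivAt_arc {c σ : ℝ} (hc : 0 < c) (hσ : 0 < σ) (hσ' : σ < S.eighth c) :
    HasDerivAt (fun τ => (S.arc c τ).1) (S.h (S.arc c σ).2) σ ∧
      HasDerivAt (fun τ => (S.arc c τ).2) (-S.f (S.arc c σ).1) σ := by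
  have h1 := S.hasDerivAt_arcX hc σ
  refine ⟨h1, ?_⟩
  have hlt := S.pot_arcX_lt hc hσ.le hσ'
  have h2 : HasDerivAt (fun τ => c - S.f.pot (S.arcX c τ))
      (-(S.f (S.arcX c σ) * S.speed c (S.arcX c σ))) σ :=
    ((S.f.hasDerivAt_pot _).comp σ h1).const_sub c
  have h3 : HasDerivAt (fun τ => S.h.inv (c - S.f.pot (S.arcX c τ)))
      ((S.h (S.h.inv (c - S.f.pot (S.arcX c σ))))⁻¹ *
        -(S.f (S.arcX c σ) * S.speed c (S.arcX c σ))) σ :=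
    (S.h.hasDerivAt_inv (by linarith)).comp σ h2
  have hs : S.speed c (S.arcX c σ) = S.h (S.h.inv (c - S.f.pot (S.arcX c σ))) := by
    rw [speed, max_eq_left (by linarith)]
  have hpos := S.speed_pos hc (S.arcX c σ)
  have hval : (S.h (S.h.inv (c - S.f.pot (S.arcX c σ))))⁻¹ *
        -(S.f (S.arcX c σ) * S.speed c (S.arcX c σ)) = -S.f (S.arcX c σ) := by
    rw [← hs]; field_simp
  rw [hval] at h3
  refine h3.congr_of_eventuallyEq ?_
  filter_upwards [Ioo_mem_nhds hσ hσ'] with τ hτ using S.arc_snd hc hτ.1.le hτ.2.le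

/-! ### One quarter of a closed orbit -/

/-- The time needed for one quarter of the orbit of energy `c`. -/
noncomputable def quarterTime (c : ℝ) : ℝ := S.eighth c + S.swap.eighth c

lemma quarterTime_swap (c : ℝ) : S.swap.quarterTime c = S.quarterTime c := add_comm _ _

lemma quarterTime_pos {c : ℝ} (hc : 0 < c) : 0 < S.quarterTime c :=
  add_pos (S.eighth_pos hc) (S.swap.eighth_pos hc)

lemma continuous_quarterTime {X : Type*} [TopologicalSpace X] [FirstCountableTopology X]
    {c : X → ℝ} (hc : Continuous c) (h0 : ∀ t, 0 < c t) :
    Continuous fun t => S.quarterTime (c t) :=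
  (S.continuous_eighth hc h0).add (S.swap.continuous_eighth hc h0)

/-- The orbit of energy `c` in the first quadrant, starting on the positive `y`-axis. Its second
half is the first half of the orbit of the swapped system, run backwards. -/
noncomputable def quarter (c σ : ℝ) : ℝ × ℝ :=
  if σ ≤ S.eighth c then S.arc c σ else (S.swap.arc c (S.quarterTime c - σ)).swap

lemma quarter_of_le {c σ : ℝ} (h : σ ≤ S.eighth c) : S.quarter c σ = S.arc c σ := if_pos h

lemma quarter_of_ge {c σ : ℝ} (hc : 0 < c) (h : S.eighth c ≤ σ) :
    S.quarter c σ = (S.swap.arc c (S.quarterTime c - σ)).swap := by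
  rcases h.eq_or_lt with rfl | h
  · rw [quarter, if_pos le_rfl, S.arc_eighth hc]
    have : S.quarterTime c - S.eighth c = S.swap.eighth c := by simp [quarterTime]
    rw [this, S.swap.arc_eighth hc]
    rfl
  · rw [quarter, if_neg h.not_ge]

lemma continuous_quarter {X : Type*} [TopologicalSpace X] [FirstCountableTopology X] {c σ : X → ℝ}
    (hc : Continuous c) (hσ : Continuous σ) (h0 : ∀ t, 0 < c t) :
    Continuous fun t => S.quarter (c t) (σ t) := by
  apply Continuous.if_le (S.continuous_arc hc hσ h0) _ hσ (S.continuous_eighth hc h0)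
  · intro t ht
    rw [← S.quarter_of_ge (h0 t) ht.ge, S.quarter_of_le ht.le]
  · exact continuous_swap.comp
      (S.swap.continuous_arc hc ((S.continuous_quarterTime hc h0).sub hσ) h0)

lemma quarter_zero {c : ℝ} (hc : 0 < c) : S.quarter c 0 = (0, S.h.inv c) := by
  rw [S.quarter_of_le (S.eighth_pos hc).le, S.arc_zero hc]

lemma quarter_quarterTime {c : ℝ} (hc : 0 < c) :
    S.quarter c (S.quarterTime c) = (S.f.inv c, 0) := by
  rw [S.quarter_of_ge hc, sub_self, S.swap.arc_zero hc]
  · rfl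
  · simpa [quarterTime] using (S.swap.eighth_pos hc).le

lemma energy_swap (p : ℝ × ℝ) : S.energy p.swap = S.swap.energy p := add_comm _ _

lemma energy_quarter {c σ : ℝ} (hc : 0 < c) (h0 : 0 ≤ σ) (h1 : σ ≤ S.quarterTime c) :
    S.energy (S.quarter c σ) = c := by
  rcases le_total σ (S.eighth c) with h | h
  · rw [S.quarter_of_le h, S.energy_arc hc h0 h]
  · rw [S.quarter_of_ge hc h, energy_swap, S.swap.energy_arc hc (by linarith)]
    simp only [quarterTime]; linarith

lemma arc_fst_pos {c σ : ℝ} (hc : 0 < c) (hσ : 0 < σ) : 0 < (S.arc c σ).1 := by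
  have := S.strictMono_arcX hc hσ
  rwa [S.arcX_zero hc] at this

lemma quarter_fst_pos {c σ : ℝ} (hc : 0 < c) (h0 : 0 < σ) : 0 < (S.quarter c σ).1 := by
  rcases le_total σ (S.eighth c) with h | h
  · rw [S.quarter_of_le h]
    exact S.arc_fst_pos hc h0
  · rw [S.quarter_of_ge hc h]
    exact S.swap.arc_snd_pos hc _

lemma quarter_snd_pos {c σ : ℝ} (hc : 0 < c) (h1 : σ < S.quarterTime c) :
    0 < (S.quarter c σ).2 := by
  rcases le_total σ (S.eighth c) with h | h
  · rw [S.quarter_of_le h]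
    exact S.arc_snd_pos hc _
  · rw [S.quarter_of_ge hc h]
    exact S.swap.arc_fst_pos hc (by linarith)

lemma hasDerivAt_quarter {c σ : ℝ} (hc : 0 < c) (h0 : 0 < σ) (h1 : σ < S.quarterTime c)
    (hne : σ ≠ S.eighth c) :
    HasDerivAt (fun τ => (S.quarter c τ).1) (S.h (S.quarter c σ).2) σ ∧
      HasDerivAt (fun τ => (S.quarter c τ).2) (-S.f (S.quarter c σ).1) σ := by
  rcases hne.lt_or_gt with h | h
  · have hev : ∀ᶠ τ in nhds σ, S.quarter c τ = S.arc c τ := by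
      filter_upwards [gt_mem_nhds h] with τ hτ using S.quarter_of_le hτ.le
    obtain ⟨d1, d2⟩ := S.hasDerivAt_arc hc h0 h
    rw [hev.self_of_nhds]
    exact ⟨d1.congr_of_eventuallyEq (hev.mono fun τ hτ => congrArg Prod.fst hτ),
      d2.congr_of_eventuallyEq (hev.mono fun τ hτ => congrArg Prod.snd hτ)⟩
  · have hev : ∀ᶠ τ in nhds σ,
        S.quarter c τ = (S.swap.arc c (S.quarterTime c - τ)).swap := by
      filter_upwards [lt_mem_nhds h] with τ hτ using S.quarter_of_ge hc hτ.le
    have hlt : S.quarterTime c - σ < S.swap.eighth c := by simp only [quarterTime]; linarith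
    obtain ⟨d1, d2⟩ := S.swap.hasDerivAt_arc hc (sub_pos.2 h1) hlt
    rw [hev.self_of_nhds]
    have hid : HasDerivAt (fun τ => S.quarterTime c - τ) (-1) σ := (hasDerivAt_id σ).const_sub _
    refine ⟨HasDerivAt.congr_of_eventuallyEq ?_ (hev.mono fun τ hτ => congrArg Prod.fst hτ),
      HasDerivAt.congr_of_eventuallyEq ?_ (hev.mono fun τ hτ => congrArg Prod.snd hτ)⟩
    · simpa [Function.comp_def] using d2.comp σ hid
    · simpa [Function.comp_def] using d1.comp σ hid

/-- The time along `quarter` at which a point of the closed first quadrant is reached. -/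
noncomputable def phase (p : ℝ × ℝ) : ℝ :=
  if S.f.pot p.1 ≤ S.h.pot p.2 then S.arcTime (S.energy p) p.1
  else S.quarterTime (S.energy p) - S.swap.arcTime (S.energy p) p.2

lemma continuous_energy : Continuous S.energy :=
  (S.h.continuous_pot.comp continuous_snd).add (S.f.continuous_pot.comp continuous_fst)

lemma arc_arcTime {p : ℝ × ℝ} (h1 : 0 ≤ p.1) (h2 : 0 ≤ p.2) (hp : 0 < S.energy p)
    (h : S.f.pot p.1 ≤ S.h.pot p.2) :
    0 ≤ S.arcTime (S.energy p) p.1 ∧ S.arcTime (S.energy p) p.1 ≤ S.eighth (S.energy p) ∧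
      S.arc (S.energy p) (S.arcTime (S.energy p) p.1) = p := by
  have hE : S.energy p = S.h.pot p.2 + S.f.pot p.1 := rfl
  refine ⟨?_, ?_, ?_⟩
  · simpa using (S.strictMono_arcTime hp).monotone h1
  · apply (S.strictMono_arcTime hp).monotone
    rw [← S.f.inv_pot h1]
    exact S.f.strictMono_inv.monotone (by linarith)
  · rw [arc, S.arcX_arcTime hp, max_eq_left (by linarith), hE, add_sub_cancel_right,
      S.h.inv_pot h2]

lemma quarter_phase {p : ℝ × ℝ} (h1 : 0 ≤ p.1) (h2 : 0 ≤ p.2) (hp : 0 < S.energy p) :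
    0 ≤ S.phase p ∧ S.phase p ≤ S.quarterTime (S.energy p) ∧
      S.quarter (S.energy p) (S.phase p) = p := by
  have e1 := S.eighth_pos hp
  have e2 := S.swap.eighth_pos hp
  have hq : S.quarterTime (S.energy p) = S.eighth (S.energy p) + S.swap.eighth (S.energy p) := rfl
  by_cases h : S.f.pot p.1 ≤ S.h.pot p.2
  · obtain ⟨a1, a2, a3⟩ := S.arc_arcTime h1 h2 hp h
    rw [phase, if_pos h, S.quarter_of_le a2]
    exact ⟨a1, by linarith, a3⟩
  · have hs : S.swap.energy p.swap = S.energy p := add_comm _ _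
    have := S.swap.arc_arcTime (p := p.swap) h2 h1 (hs ▸ hp) (not_le.1 h).le
    rw [hs] at this
    obtain ⟨a1, a2, a3⟩ := this
    simp only [Prod.fst_swap] at a1 a2 a3
    rw [phase, if_neg h, S.quarter_of_ge hp (by linarith), sub_sub_cancel, a3, Prod.swap_swap]
    exact ⟨by linarith, by linarith, rfl⟩

lemma continuous_phase {X : Type*} [TopologicalSpace X] [FirstCountableTopology X] {p : X → ℝ × ℝ}
    (hp : Continuous p) (h1 : ∀ t, 0 ≤ (p t).1) (h2 : ∀ t, 0 ≤ (p t).2)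
    (h0 : ∀ t, 0 < S.energy (p t)) : Continuous fun t => S.phase (p t) := by
  have hE := S.continuous_energy.comp hp
  have hx := continuous_fst.comp hp
  have hy := continuous_snd.comp hp
  apply Continuous.if_le (S.continuous_arcTime hE hx h0)
    ((S.continuous_quarterTime hE h0).sub (S.swap.continuous_arcTime hE hy h0))
    (S.f.continuous_pot.comp hx) (S.h.continuous_pot.comp hy)
  intro t ht
  have hE' : S.energy (p t) = S.h.pot (p t).2 + S.f.pot (p t).1 := rfl
  have t1 : S.f.inv (S.energy (p t) / 2) = (p t).1 :=
    (S.f.inv_eq_iff (half_pos (h0 t)).le (h1 t)).2 (by simp only [Function.comp_apply] at ht; linarith)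
  have t2 : S.h.inv (S.energy (p t) / 2) = (p t).2 :=
    (S.h.inv_eq_iff (half_pos (h0 t)).le (h2 t)).2 (by simp only [Function.comp_apply] at ht; linarith)
  simp only [Pi.sub_apply, Function.comp_apply, quarterTime, eighth, swap_f, t1, t2]
  ring

/-- The quarter time is given by the classical time integral in the variable `x`. Its integrand is
singular at the right end, where the orbit turns back. -/
lemma integral_eq_quarterTime {c : ℝ} (hc : 0 < c) :
    ∫ x in (0 : ℝ)..S.f.inv c, (S.h (S.h.inv (c - S.f.pot x)))⁻¹ = S.quarterTime c := by
  have h2 := half_pos hc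
  have hX0 : 0 ≤ S.f.inv (c / 2) := S.f.inv_nonneg h2.le
  have hXc : S.f.inv (c / 2) ≤ S.f.inv c := S.f.strictMono_inv.monotone (by linarith)
  have hcont : Continuous fun v => (S.speed c v)⁻¹ :=
    (S.continuous_speed continuous_const continuous_id).inv₀ fun v => (S.speed_pos hc v).ne'
  -- On the first half the integrand is the one that defines `arcTime`.
  have hcongr : ∀ x ∈ uIcc 0 (S.f.inv (c / 2)),
      (S.speed c x)⁻¹ = (S.h (S.h.inv (c - S.f.pot x)))⁻¹ := by
    intro x hx
    rw [uIcc_of_le hX0] at hx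
    have : S.f.pot x ≤ c / 2 := by
      rw [← S.f.pot_inv h2.le]
      exact S.f.strictMonoOn_pot.monotoneOn hx.1 hX0 hx.2
    rw [speed, max_eq_left (by linarith)]
  have i1 : IntervalIntegrable (fun x => (S.h (S.h.inv (c - S.f.pot x)))⁻¹) volume 0
      (S.f.inv (c / 2)) :=
    (hcont.intervalIntegrable _ _).congr fun x hx => hcongr x (uIoc_subset_uIcc hx)
  have v1 : ∫ x in (0 : ℝ)..S.f.inv (c / 2), (S.h (S.h.inv (c - S.f.pot x)))⁻¹ = S.eighth c :=
    (intervalIntegral.integral_congr hcongr).symm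
  -- On the second half `-swap.arcTime` of the ordinate is a primitive.
  have hP : ∀ x ∈ Ioo (S.f.inv (c / 2)) (S.f.inv c),
      HasDerivAt (fun x => -S.swap.arcTime c (S.h.inv (c - S.f.pot x)))
        (S.h (S.h.inv (c - S.f.pot x)))⁻¹ x := by
    intro x hx
    have hx0 : 0 < x := hX0.trans_lt hx.1
    have l1 : c / 2 < S.f.pot x := by
      rw [← S.f.pot_inv h2.le]
      exact S.f.strictMonoOn_pot hX0 hx0.le hx.1
    have l2 : S.f.pot x < c := by
      rw [← S.f.pot_inv hc.le]
      exact S.f.strictMonoOn_pot hx0.le (S.f.inv_nonneg hc.le) hx.2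
    have d1 : HasDerivAt (fun x => c - S.f.pot x) (-S.f x) x := (S.f.hasDerivAt_pot x).const_sub c
    have d2 : HasDerivAt (fun x => S.h.inv (c - S.f.pot x))
        ((S.h (S.h.inv (c - S.f.pot x)))⁻¹ * -S.f x) x :=
      (S.h.hasDerivAt_inv (sub_pos.2 l2)).comp x d1
    have d3 := ((S.swap.hasDerivAt_arcTime hc (S.h.inv (c - S.f.pot x))).comp x d2).neg
    have hs : S.swap.speed c (S.h.inv (c - S.f.pot x)) = S.f x := by
      rw [speed, swap_f, swap_h, S.h.pot_inv (by linarith), sub_sub_cancel,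
        max_eq_left l1.le, S.f.inv_pot hx0.le]
    rw [hs] at d3
    convert! d3 using 1
    have := S.f.pos x hx0
    field_simp
  have hPc : Continuous fun x => -S.swap.arcTime c (S.h.inv (c - S.f.pot x)) :=
    (S.swap.continuous_arcTime continuous_const (S.h.continuous_inv.comp
      (continuous_const.sub S.f.continuous_pot)) fun _ => hc).neg
  have hpos : ∀ x ∈ Ioo (S.f.inv (c / 2)) (S.f.inv c),
      0 ≤ (S.h (S.h.inv (c - S.f.pot x)))⁻¹ := by
    intro x hx
    have hx0 : 0 < x := hX0.trans_lt hx.1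
    have l2 : S.f.pot x < c := by
      rw [← S.f.pot_inv hc.le]
      exact S.f.strictMonoOn_pot hx0.le (S.f.inv_nonneg hc.le) hx.2
    exact inv_nonneg.2 (S.h.pos _ (S.h.inv_pos (sub_pos.2 l2))).le
  have i2 : IntervalIntegrable (fun x => (S.h (S.h.inv (c - S.f.pot x)))⁻¹) volume
      (S.f.inv (c / 2)) (S.f.inv c) := by
    apply intervalIntegral.intervalIntegrable_deriv_of_nonneg hPc.continuousOn
    · rwa [min_eq_left hXc, max_eq_right hXc]
    · rwa [min_eq_left hXc, max_eq_right hXc]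
  have v2 := intervalIntegral.integral_eq_sub_of_hasDerivAt_of_le hXc hPc.continuousOn hP i2
  rw [← intervalIntegral.integral_add_adjacent_intervals i1 i2, v1, v2, S.f.pot_inv hc.le,
    S.f.pot_inv h2.le, sub_self, S.h.inv_zero, arcTime_zero, quarterTime,
    show c - c / 2 = c / 2 by ring, eighth, eighth, swap_f]
  ring

/-! ### Turning around the origin -/

/-- The system in the coordinates turned by a right angle, in which the fourth quadrant plays the
part of the first. -/
def rot : PlanarSystem := ⟨S.f, S.h.reflect⟩

/-- The clockwise quarter turn, which takes solutions of `S.rot` to solutions of `S`. -/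
def turn (p : ℝ × ℝ) : ℝ × ℝ := (p.2, -p.1)

@[simp] lemma turn_fst (p : ℝ × ℝ) : (turn p).1 = p.2 := rfl
@[simp] lemma turn_snd (p : ℝ × ℝ) : (turn p).2 = -p.1 := rfl

lemma continuous_turn : Continuous turn := continuous_snd.prodMk continuous_fst.neg

lemma energy_turn (p : ℝ × ℝ) : S.energy (turn p) = S.rot.energy p := by
  simp [energy, rot, Force.pot_reflect, add_comm]

lemma rot_four : S.rot.rot.rot.rot = S := by simp [rot]

lemma iterate_rot_add_four (n : ℕ) : rot^[n + 4] S = rot^[n] S := by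
  rw [Function.iterate_add_apply]
  exact congrArg _ S.rot_four

lemma turn_turn (p : ℝ × ℝ) : turn (turn p) = -p := rfl

lemma iterate_turn_add_four (n : ℕ) (p : ℝ × ℝ) : turn^[n + 4] p = turn^[n] p := by
  rw [Function.iterate_add_apply]
  congr 1
  simp [turn]

/-- The time needed by the orbit of energy `c` for `n` quarter turns, starting on the positive
`y`-axis. -/
noncomputable def turnTime (c : ℝ) (n : ℕ) : ℝ :=
  ∑ k ∈ Finset.range n, (rot^[k] S).quarterTime c

@[simp] lemma turnTime_zero (c : ℝ) : S.turnTime c 0 = 0 := by simp [turnTime]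

lemma turnTime_succ (c : ℝ) (n : ℕ) :
    S.turnTime c (n + 1) = S.turnTime c n + (rot^[n] S).quarterTime c :=
  Finset.sum_range_succ _ _

lemma turnTime_succ' (c : ℝ) (n : ℕ) :
    S.turnTime c (n + 1) = S.quarterTime c + S.rot.turnTime c n := by
  rw [turnTime, Finset.sum_range_succ', add_comm]
  rfl

lemma turnTime_one (c : ℝ) : S.turnTime c 1 = S.quarterTime c := by simp [turnTime]

lemma strictMono_turnTime {c : ℝ} (hc : 0 < c) : StrictMono (S.turnTime c) :=
  strictMono_nat_of_lt_succ fun n => by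
    rw [turnTime_succ]
    exact lt_add_of_pos_right _ (quarterTime_pos _ hc)

lemma turnTime_add_four_mul (c : ℝ) (n k : ℕ) :
    S.turnTime c (n + 4 * k) = S.turnTime c n + k * S.turnTime c 4 := by
  have h4 : ∀ n, S.turnTime c (n + 4) = S.turnTime c n + S.turnTime c 4 := by
    intro n
    induction n with
    | zero => simp
    | succ n ih =>
      rw [show n + 1 + 4 = (n + 4) + 1 by ring, turnTime_succ, ih, iterate_rot_add_four,
        S.turnTime_succ c n]
      ring
  induction k with
  | zero => simp
  | succ k ih =>
    rw [show n + 4 * (k + 1) = n + 4 * k + 4 by ring, h4, ih]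
    push_cast
    ring

lemma continuous_turnTime {X : Type*} [TopologicalSpace X] [FirstCountableTopology X]
    {c : X → ℝ} (hc : Continuous c) (h0 : ∀ t, 0 < c t) (n : ℕ) :
    Continuous fun t => S.turnTime (c t) n :=
  continuous_finsetSum _ fun k _ => (rot^[k] S).continuous_quarterTime hc h0

/-- The orbit of energy `c` starting at the time `0` on the positive `y`-axis; it is a solution as
long as at most `n + 1` quarter turns are completed. -/
noncomputable def orbit : ℕ → PlanarSystem → ℝ → ℝ → ℝ × ℝ
  | 0, S, c, σ => S.quarter c σ
  | n + 1, S, c, σ =>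
    if σ ≤ S.quarterTime c then S.quarter c σ else turn (orbit n S.rot c (σ - S.quarterTime c))

lemma orbit_of_le (n : ℕ) {c σ : ℝ} (h : σ ≤ S.quarterTime c) :
    orbit n S c σ = S.quarter c σ := by
  cases n with
  | zero => rfl
  | succ n => exact if_pos h

lemma orbit_of_ge (n : ℕ) {c σ : ℝ} (hc : 0 < c) (h : S.quarterTime c ≤ σ) :
    orbit (n + 1) S c σ = turn (orbit n S.rot c (σ - S.quarterTime c)) := by
  rcases h.eq_or_lt with rfl | h
  · rw [orbit_of_le _ _ le_rfl, sub_self, orbit_of_le _ _ (S.rot.quarterTime_pos hc).le,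
      S.rot.quarter_zero hc, S.quarter_quarterTime hc]
    simp [turn, rot]
  · rw [orbit, if_neg h.not_ge]

lemma continuous_orbit (n : ℕ) {X : Type*} [TopologicalSpace X] [FirstCountableTopology X]
    {c σ : X → ℝ} (hc : Continuous c) (hσ : Continuous σ) (h0 : ∀ t, 0 < c t) :
    Continuous fun t => orbit n S (c t) (σ t) := by
  induction n generalizing S σ with
  | zero => exact S.continuous_quarter hc hσ h0
  | succ n ih =>
    have hT := S.continuous_quarterTime hc h0
    apply Continuous.if_le (S.continuous_quarter hc hσ h0)
      (continuous_turn.comp (ih S.rot (hσ.sub hT))) hσ hT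
    intro t ht
    have := S.orbit_of_ge n (h0 t) ht.ge
    rw [S.orbit_of_le _ ht.le] at this
    exact this

/-- During the `k`-th quarter turn the orbit is the `k`-th image of an orbit in the first
quadrant. -/
lemma orbit_eq_turn {n k : ℕ} (hk : k ≤ n) {c σ : ℝ} (hc : 0 < c) (h0 : S.turnTime c k ≤ σ)
    (h1 : σ ≤ S.turnTime c (k + 1)) :
    orbit n S c σ = turn^[k] ((rot^[k] S).quarter c (σ - S.turnTime c k)) := by
  induction k generalizing S n σ with
  | zero => simpa using S.orbit_of_le n (by simpa [turnTime] using h1)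
  | succ k ih =>
    obtain ⟨n, rfl⟩ : ∃ n', n = n' + 1 := ⟨n - 1, by omega⟩
    rw [turnTime_succ'] at h0 h1
    have hnn : 0 ≤ S.rot.turnTime c k := by
      simpa using (S.rot.strictMono_turnTime hc).monotone (Nat.zero_le k)
    rw [S.orbit_of_ge n hc (by linarith), ih S.rot (by omega) (by linarith) (by linarith),
      Function.iterate_succ_apply', Function.iterate_succ_apply, turnTime_succ', sub_sub]

lemma energy_orbit (n : ℕ) {c σ : ℝ} (hc : 0 < c) (h0 : 0 ≤ σ) (h1 : σ ≤ S.turnTime c (n + 1)) :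
    S.energy (orbit n S c σ) = c := by
  induction n generalizing S σ with
  | zero => exact S.energy_quarter hc h0 (by simpa [turnTime_one] using h1)
  | succ n ih =>
    rcases le_total σ (S.quarterTime c) with h | h
    · rw [S.orbit_of_le _ h]
      exact S.energy_quarter hc h0 h
    · rw [turnTime_succ'] at h1
      rw [S.orbit_of_ge n hc h, energy_turn, ih S.rot (by linarith) (by linarith)]

lemma hasDerivAt_orbit (n : ℕ) {c : ℝ} (hc : 0 < c) : ∃ E : Set ℝ, E.Finite ∧
    ∀ σ ∈ Ioo 0 (S.turnTime c (n + 1)), σ ∉ E →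
      HasDerivAt (fun τ => (orbit n S c τ).1) (S.h (orbit n S c σ).2) σ ∧
        HasDerivAt (fun τ => (orbit n S c τ).2) (-S.f (orbit n S c σ).1) σ := by
  induction n generalizing S with
  | zero =>
    refine ⟨{S.eighth c}, finite_singleton _, fun σ hσ hE => ?_⟩
    rw [turnTime_one] at hσ
    exact S.hasDerivAt_quarter hc hσ.1 hσ.2 hE
  | succ n ih =>
    obtain ⟨E, hE, hd⟩ := ih S.rot
    refine ⟨{S.eighth c, S.quarterTime c} ∪ (fun σ => S.quarterTime c + σ) '' E,
      (toFinite _).union (hE.image _), fun σ hσ hne => ?_⟩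
    simp only [mem_union, mem_insert_iff, mem_singleton_iff, not_or] at hne
    obtain ⟨⟨hn1, hn2⟩, hn3⟩ := hne
    rcases Ne.lt_or_gt hn2 with h | h
    · have hev : ∀ᶠ τ in nhds σ, orbit (n + 1) S c τ = S.quarter c τ := by
        filter_upwards [gt_mem_nhds h] with τ hτ using S.orbit_of_le _ hτ.le
      obtain ⟨d1, d2⟩ := S.hasDerivAt_quarter hc hσ.1 h hn1
      rw [hev.self_of_nhds]
      exact ⟨d1.congr_of_eventuallyEq (hev.mono fun τ hτ => congrArg Prod.fst hτ),
        d2.congr_of_eventuallyEq (hev.mono fun τ hτ => congrArg Prod.snd hτ)⟩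
    · have hev : ∀ᶠ τ in nhds σ,
          orbit (n + 1) S c τ = turn (orbit n S.rot c (τ - S.quarterTime c)) := by
        filter_upwards [lt_mem_nhds h] with τ hτ using S.orbit_of_ge n hc hτ.le
      have hσ2 := hσ.2
      rw [turnTime_succ'] at hσ2
      obtain ⟨d1, d2⟩ := hd (σ - S.quarterTime c) ⟨by linarith, by linarith⟩
        fun hmem => hn3 ⟨_, hmem, by ring⟩
      rw [hev.self_of_nhds]
      have hid : HasDerivAt (fun τ => τ - S.quarterTime c) 1 σ := (hasDerivAt_id σ).sub_const _
      refine ⟨HasDerivAt.congr_of_eventuallyEq ?_ (hev.mono fun τ hτ => congrArg Prod.fst hτ),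
        HasDerivAt.congr_of_eventuallyEq ?_ (hev.mono fun τ hτ => congrArg Prod.snd hτ)⟩
      · simpa [Function.comp_def, rot, Force.reflect_apply] using d2.comp σ hid
      · simpa [Function.comp_def, rot, Force.reflect_apply] using (d1.comp σ hid).fun_neg

lemma quarter_fst_eq_zero {c σ : ℝ} (hc : 0 < c) (h0 : 0 ≤ σ) :
    (S.quarter c σ).1 = 0 ↔ σ = 0 := by
  constructor
  · intro h
    by_contra hne
    exact (S.quarter_fst_pos hc (lt_of_le_of_ne h0 (Ne.symm hne))).ne' h
  · rintro rfl
    rw [S.quarter_zero hc]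

lemma quarter_snd_eq_zero {c σ : ℝ} (hc : 0 < c) (h1 : σ ≤ S.quarterTime c) :
    (S.quarter c σ).2 = 0 ↔ σ = S.quarterTime c := by
  constructor
  · intro h
    by_contra hne
    exact (S.quarter_snd_pos hc (lt_of_le_of_ne h1 hne)).ne' h
  · rintro rfl
    rw [S.quarter_quarterTime hc]

/-- The abscissa vanishes after an even number of quarter turns, the ordinate after an odd
number. -/
lemma orbit_eq_zero (n : ℕ) {c σ : ℝ} (hc : 0 < c) (h0 : 0 ≤ σ)
    (h1 : σ ≤ S.turnTime c (n + 1)) :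
    ((orbit n S c σ).1 = 0 ↔ ∃ k, Even k ∧ k ≤ n + 1 ∧ S.turnTime c k = σ) ∧
      ((orbit n S c σ).2 = 0 ↔ ∃ k, Odd k ∧ k ≤ n + 1 ∧ S.turnTime c k = σ) := by
  induction n generalizing S σ with
  | zero =>
    rw [turnTime_one] at h1
    have hT := S.quarterTime_pos hc
    refine ⟨(S.quarter_fst_eq_zero hc h0).trans ⟨?_, ?_⟩,
      (S.quarter_snd_eq_zero hc h1).trans ⟨?_, ?_⟩⟩
    · rintro rfl
      exact ⟨0, Even.zero, by omega, by simp⟩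
    · rintro ⟨k, hk, hk1, rfl⟩
      obtain rfl : k = 0 := by
        obtain ⟨r, rfl⟩ := hk
        omega
      simp
    · rintro rfl
      exact ⟨1, odd_one, le_rfl, S.turnTime_one c⟩
    · rintro ⟨k, hk, hk1, rfl⟩
      obtain rfl : k = 1 := by
        obtain ⟨r, rfl⟩ := hk
        omega
      exact S.turnTime_one c
  | succ n ih =>
    have hmono := S.strictMono_turnTime hc
    rcases lt_or_ge σ (S.quarterTime c) with h | h
    · rw [S.orbit_of_le _ h.le]
      have hlt : ∀ k, S.turnTime c k = σ → k = 0 := by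
        intro k hk
        rw [← hk, ← turnTime_one, hmono.lt_iff_lt] at h
        omega
      refine ⟨(S.quarter_fst_eq_zero hc h0).trans ⟨?_, ?_⟩,
        (S.quarter_snd_eq_zero hc h.le).trans ⟨fun h' => absurd h' h.ne, ?_⟩⟩
      · rintro rfl
        exact ⟨0, Even.zero, by omega, by simp⟩
      · rintro ⟨k, -, -, hkσ⟩
        rw [← hkσ, hlt k hkσ, turnTime_zero]
      · rintro ⟨k, hk, -, hkσ⟩
        rw [hlt k hkσ] at hk
        exact absurd hk (by decide)
    · rw [turnTime_succ'] at h1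
      obtain ⟨i1, i2⟩ := ih S.rot (σ := σ - S.quarterTime c) (by linarith) (by linarith)
      have hpos : ∀ k, S.turnTime c k = σ → ∃ l, k = l + 1 := by
        intro k hk
        rcases k with _ | l
        · rw [turnTime_zero] at hk
          linarith [S.quarterTime_pos hc]
        · exact ⟨l, rfl⟩
      rw [S.orbit_of_ge n hc h, turn_fst, turn_snd, neg_eq_zero, i1, i2]
      constructor
      · constructor
        · rintro ⟨k, hk, hkn, hkσ⟩
          exact ⟨k + 1, hk.add_one, by omega, by rw [turnTime_succ', hkσ]; ring⟩
        · rintro ⟨k, hk, hkn, hkσ⟩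
          obtain ⟨l, rfl⟩ := hpos k hkσ
          rw [turnTime_succ'] at hkσ
          exact ⟨l, by simpa [Nat.even_add_one] using hk, by omega, by linarith⟩
      · constructor
        · rintro ⟨k, hk, hkn, hkσ⟩
          exact ⟨k + 1, hk.add_one, by omega, by rw [turnTime_succ', hkσ]; ring⟩
        · rintro ⟨k, hk, hkn, hkσ⟩
          obtain ⟨l, rfl⟩ := hpos k hkσ
          rw [turnTime_succ'] at hkσ
          exact ⟨l, by simpa [Nat.odd_add_one] using hk, by omega, by linarith⟩

lemma orbit_turnTime {n k : ℕ} (hk : k ≤ n) {c : ℝ} (hc : 0 < c) :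
    orbit n S c (S.turnTime c k) = turn^[k] (0, (rot^[k] S).h.inv c) := by
  rw [S.orbit_eq_turn hk hc le_rfl (S.strictMono_turnTime hc (Nat.lt_succ_self k)).le, sub_self,
    quarter_zero _ hc]

end PlanarSystem

/-! ### Subpaths cut out by sign changes -/

lemma exists_last_zero {u : ℝ → ℝ} (hu : Continuous u) {a b : ℝ} (hab : a ≤ b) (ha : u a ≤ 0)
    (hb : 0 ≤ u b) : ∃ s ∈ Icc a b, u s = 0 ∧ ∀ t ∈ Icc s b, 0 ≤ u t := by
  have hne : (Icc a b ∩ u ⁻¹' {0}).Nonempty := by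
    obtain ⟨s, hs, h⟩ := intermediate_value_Icc hab hu.continuousOn ⟨ha, hb⟩
    exact ⟨s, hs, h⟩
  obtain ⟨s, ⟨hs, hs0⟩, hmax⟩ := (isCompact_Icc.inter_right
    (isClosed_singleton.preimage hu)).exists_isGreatest hne
  refine ⟨s, hs, hs0, fun t ht => ?_⟩
  by_contra! h
  obtain ⟨t', ht', h'⟩ := intermediate_value_Icc ht.2 hu.continuousOn ⟨h.le, hb⟩
  have h1 : t' ≤ s := hmax ⟨⟨hs.1.trans (ht.1.trans ht'.1), ht'.2⟩, h'⟩
  obtain rfl : t = s := le_antisymm (ht'.1.trans h1) ht.1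
  exact h.ne hs0

lemma exists_first_zero {u : ℝ → ℝ} (hu : Continuous u) {a b : ℝ} (hab : a ≤ b) (ha : u a ≤ 0)
    (hb : 0 ≤ u b) : ∃ s ∈ Icc a b, u s = 0 ∧ ∀ t ∈ Icc a s, u t ≤ 0 := by
  obtain ⟨s, hs, h0, h⟩ := exists_last_zero (u := fun t => -u (-t)) (a := -b) (b := -a)
    (hu.comp continuous_neg).neg (by linarith) (by simpa using hb) (by simpa using ha)
  refine ⟨-s, ⟨by linarith [hs.2], by linarith [hs.1]⟩, by simpa using h0, fun t ht => ?_⟩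
  have := h (-t) ⟨by linarith [ht.2], by linarith [ht.1]⟩
  simpa using this

/-- If `g ≤ f`, then a path along which `f` is nonpositive at the start and `g` is nonnegative at the
end has a subpath that crosses the strip `g ≤ 0 ≤ f`. -/
lemma exists_crossing_subpath {f g : ℝ → ℝ} (hf : Continuous f) (hg : Continuous g) {a b : ℝ}
    (hab : a ≤ b) (hgf : ∀ t ∈ Icc a b, g t ≤ f t) (ha : f a ≤ 0) (hb : 0 ≤ g b) :
    ∃ a' b', a ≤ a' ∧ a' ≤ b' ∧ b' ≤ b ∧ f a' = 0 ∧ g b' = 0 ∧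
      ∀ t ∈ Icc a' b', 0 ≤ f t ∧ g t ≤ 0 := by
  obtain ⟨b', hb', hgb, hg'⟩ := exists_first_zero hg hab
    ((hgf a (left_mem_Icc.2 hab)).trans ha) hb
  obtain ⟨a', ha', hfa, hf'⟩ := exists_last_zero hf hb'.1 ha (hgb ▸ hgf b' hb')
  exact ⟨a', b', ha'.1, ha'.2, hb'.2, hfa, hgb,
    fun t ht => ⟨hf' t ht, hg' t ⟨ha'.1.trans ht.1, ht.2⟩⟩⟩

/-! ### Two paths that cross a rectangle in different directions meet -/

lemma cos_neg_of_abs {x : ℝ} (h1 : Real.pi / 2 < |x|) (h2 : |x| ≤ Real.pi) : Real.cos x < 0 := by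
  rw [← Real.cos_abs]
  exact Real.cos_neg_of_pi_div_two_lt_of_lt h1 (by linarith [Real.pi_pos])

lemma exists_abs_sub_le_of_cos_nonneg {x : ℝ} (h : 0 ≤ Real.cos x) :
    ∃ k : ℤ, |x - k * (2 * Real.pi)| ≤ Real.pi / 2 := by
  refine ⟨round (x / (2 * Real.pi)), ?_⟩
  by_contra! h1
  have hp := Real.pi_pos
  have h2 := abs_sub_round (x / (2 * Real.pi))
  have h3 : |x - round (x / (2 * Real.pi)) * (2 * Real.pi)| ≤ Real.pi := by
    have : x - round (x / (2 * Real.pi)) * (2 * Real.pi) =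
        (x / (2 * Real.pi) - round (x / (2 * Real.pi))) * (2 * Real.pi) := by field_simp
    rw [this, abs_mul, abs_of_pos (show 0 < 2 * Real.pi by positivity)]
    nlinarith
  have := cos_neg_of_abs h1 h3
  rw [Real.cos_sub_int_mul_two_pi] at this
  linarith

/-- A continuous angle that stays in a closed half plane cannot leave the corresponding interval. -/
lemma abs_sub_le_of_cos_nonneg {φ : ℝ → ℝ} (hφ : Continuous φ) {p q z : ℝ}
    (h : ∀ x ∈ uIcc p q, 0 ≤ Real.cos (φ x - z)) (hp : |φ p - z| ≤ Real.pi) :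
    |φ q - z| ≤ Real.pi / 2 := by
  by_contra! hq
  have hp' : |φ p - z| ≤ Real.pi / 2 := by
    by_contra! h1
    exact (cos_neg_of_abs h1 hp).not_ge (h p left_mem_uIcc)
  have hpi := Real.pi_pos
  have hcont : Continuous fun x => |φ x - z| := (hφ.sub continuous_const).abs
  obtain ⟨x, hx, hxw⟩ := intermediate_value_uIcc hcont.continuousOn
    (show min |φ q - z| Real.pi ∈ uIcc |φ p - z| |φ q - z| from by
      rw [uIcc_of_le (by linarith)]
      exact ⟨le_min (by linarith) (by linarith), min_le_left _ _⟩)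
  refine (cos_neg_of_abs (x := φ x - z) ?_ ?_).not_ge (h x hx)
  · rw [show |φ x - z| = min |φ q - z| Real.pi from hxw]
    exact lt_min hq (by linarith)
  · exact hxw.le.trans (min_le_right _ _)

/-- The Poincaré–Miranda theorem in the plane. If there were no common zero, then `u + i v` would
have a continuous logarithm on the rectangle, and its imaginary part would grow by `2 π` along the
boundary. -/
theorem exists_common_zero {u v : ℝ × ℝ → ℝ} (hu : Continuous u) (hv : Continuous v)
    {a b c d : ℝ} (hab : a ≤ b) (hcd : c ≤ d)
    (ha : ∀ t ∈ Icc c d, u (a, t) ≤ 0) (hb : ∀ t ∈ Icc c d, 0 ≤ u (b, t))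
    (hc : ∀ s ∈ Icc a b, v (s, c) ≤ 0) (hd : ∀ s ∈ Icc a b, 0 ≤ v (s, d)) :
    ∃ s ∈ Icc a b, ∃ t ∈ Icc c d, u (s, t) = 0 ∧ v (s, t) = 0 := by
  by_contra! hno
  have hproj : Continuous fun p : ℝ × ℝ =>
      (((projIcc a b hab p.1 : ℝ), (projIcc c d hcd p.2 : ℝ)) : ℝ × ℝ) :=
    (continuous_subtype_val.comp (continuous_projIcc.comp continuous_fst)).prodMk
      (continuous_subtype_val.comp (continuous_projIcc.comp continuous_snd))
  set D : ℝ × ℝ → ℂ := fun p =>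
    ⟨u (projIcc a b hab p.1, projIcc c d hcd p.2), v (projIcc a b hab p.1, projIcc c d hcd p.2)⟩
    with hD
  have hDc : Continuous D := by
    have : D = fun p => ((u (projIcc a b hab p.1, projIcc c d hcd p.2) : ℝ) : ℂ) +
        ((v (projIcc a b hab p.1, projIcc c d hcd p.2) : ℝ) : ℂ) * Complex.I := by
      funext p
      exact (Complex.re_add_im (D p)).symm
    rw [this]
    exact (Complex.continuous_ofReal.comp (hu.comp hproj)).add
      ((Complex.continuous_ofReal.comp (hv.comp hproj)).mul continuous_const)
  have hD0 : (0 : ℂ) ∉ D '' univ := by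
    rintro ⟨p, -, hp⟩
    exact hno _ (projIcc a b hab p.1).2 _ (projIcc c d hcd p.2).2
      (congrArg Complex.re hp) (congrArg Complex.im hp)
  have : ContractibleSpace (univ : Set (ℝ × ℝ)) := convex_univ.contractibleSpace univ_nonempty
  have hsc : IsSimplyConnected (univ : Set (ℝ × ℝ)) := SimplyConnectedSpace.ofContractible _
  obtain ⟨L, hL, hexp⟩ :=
    Complex.exists_continuousOn_eqOn_exp_comp hsc isOpen_univ hDc.continuousOn hD0
  have hLc : Continuous fun p => (L p).im := Complex.continuous_im.comp (continuousOn_univ.1 hL)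
  have hDp : ∀ s ∈ Icc a b, ∀ t ∈ Icc c d, D (s, t) = ⟨u (s, t), v (s, t)⟩ := by
    intro s hs t ht
    simp only [hD, projIcc_of_mem hab hs, projIcc_of_mem hcd ht]
  have hre : ∀ s ∈ Icc a b, ∀ t ∈ Icc c d,
      u (s, t) = Real.exp (L (s, t)).re * Real.cos (L (s, t)).im := by
    intro s hs t ht
    have h := congrArg Complex.re (hexp (mem_univ (s, t)))
    rw [hDp s hs t ht, Function.comp_apply, Complex.exp_re] at h
    exact h.symm
  have him : ∀ s ∈ Icc a b, ∀ t ∈ Icc c d,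
      v (s, t) = Real.exp (L (s, t)).re * Real.sin (L (s, t)).im := by
    intro s hs t ht
    have h := congrArg Complex.im (hexp (mem_univ (s, t)))
    rw [hDp s hs t ht, Function.comp_apply, Complex.exp_im] at h
    exact h.symm
  have hp := Real.pi_pos
  have pos_of : ∀ {r x : ℝ}, 0 ≤ Real.exp r * x → 0 ≤ x := fun h =>
    nonneg_of_mul_nonneg_right h (Real.exp_pos _)
  have neg_of : ∀ {r x : ℝ}, Real.exp r * x ≤ 0 → x ≤ 0 := fun h => by
    by_contra! h'
    exact (mul_pos (Real.exp_pos _) h').not_ge h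
  have ha' := left_mem_Icc.2 hab
  have hb' := right_mem_Icc.2 hab
  have hc' := left_mem_Icc.2 hcd
  have hd' := right_mem_Icc.2 hcd
  have hsin : ∀ s ∈ Icc a b, Real.sin (L (s, c)).im ≤ 0 := fun s hs =>
    neg_of (him s hs c hc' ▸ hc s hs)
  obtain ⟨k, hk⟩ := exists_abs_sub_le_of_cos_nonneg (x := (L (a, c)).im + Real.pi / 2) (by
    rw [Real.cos_add_pi_div_two]
    linarith [hsin a ha'])
  set z : ℝ := k * (2 * Real.pi) - Real.pi / 2 with hz
  have hA : |(L (a, c)).im - z| ≤ Real.pi / 2 := by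
    rw [hz, ← sub_add, sub_add_eq_add_sub]
    exact hk
  have trig : ∀ x : ℝ, Real.cos (x - z) = -Real.sin x ∧
      Real.cos (x - (z + Real.pi / 2)) = Real.cos x ∧
      Real.cos (x - (z + Real.pi)) = Real.sin x ∧
      Real.cos (x - (z + 3 * Real.pi / 2)) = -Real.cos x := by
    intro x
    refine ⟨?_, ?_, ?_, ?_⟩
    · rw [show x - z = x + Real.pi / 2 - k * (2 * Real.pi) by rw [hz]; ring,
        Real.cos_sub_int_mul_two_pi, Real.cos_add_pi_div_two]
    · rw [show x - (z + Real.pi / 2) = x - k * (2 * Real.pi) by rw [hz]; ring,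
        Real.cos_sub_int_mul_two_pi]
    · rw [show x - (z + Real.pi) = x - Real.pi / 2 - k * (2 * Real.pi) by rw [hz]; ring,
        Real.cos_sub_int_mul_two_pi, Real.cos_sub_pi_div_two]
    · rw [show x - (z + 3 * Real.pi / 2) = x - Real.pi - k * (2 * Real.pi) by rw [hz]; ring,
        Real.cos_sub_int_mul_two_pi, Real.cos_sub_pi]
  have hs1 : ∀ y : ℝ, Continuous fun s => (L (s, y)).im := fun y =>
    hLc.comp (continuous_id.prodMk continuous_const)
  have hs2 : ∀ y : ℝ, Continuous fun t => (L (y, t)).im := fun y =>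
    hLc.comp (continuous_const.prodMk continuous_id)
  -- Follow the angle along the four sides, counterclockwise.
  have hB := abs_sub_le_of_cos_nonneg (hs1 c) (p := a) (q := b) (z := z) (fun s hs => by
    rw [uIcc_of_le hab] at hs
    rw [(trig _).1]
    linarith [hsin s hs]) (by linarith)
  have hC := abs_sub_le_of_cos_nonneg (hs2 b) (p := c) (q := d) (z := z + Real.pi / 2)
    (fun t ht => by
      rw [uIcc_of_le hcd] at ht
      rw [(trig _).2.1]
      exact pos_of (hre b hb' t ht ▸ hb t ht))
    (by rw [abs_le] at hB ⊢; constructor <;> linarith)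
  have hDd := abs_sub_le_of_cos_nonneg (hs1 d) (p := b) (q := a) (z := z + Real.pi)
    (fun s hs => by
      rw [uIcc_of_ge hab] at hs
      rw [(trig _).2.2.1]
      exact pos_of (him s hs d hd' ▸ hd s hs))
    (by rw [abs_le] at hC ⊢; constructor <;> linarith)
  have hA' := abs_sub_le_of_cos_nonneg (hs2 a) (p := d) (q := c) (z := z + 3 * Real.pi / 2)
    (fun t ht => by
      rw [uIcc_of_ge hcd] at ht
      rw [(trig _).2.2.2]
      linarith [neg_of (hre a ha' t ht ▸ ha t ht)])
    (by rw [abs_le] at hDd ⊢; constructor <;> linarith)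
  rw [abs_le] at hA hA'
  linarith [hA.2, hA'.1]

/-! ### Stretching of a path by the flow of a planar system -/

namespace PlanarSystem

variable (S : PlanarSystem)

/-- `z` is a solution of the system on `[0, τ]` from `p` to `q` that stays on the level of `p`,
crosses the `y`-axis `r` times and ends in the quadrant with the index `2 * r + 1`, counted clockwise
from the first one, which has the index `0`. The differential equation is only required outside a finite set, which
suffices because `z` is continuous. -/
structure Trajectory (τ : ℝ) (r : ℕ) (p q : ℝ × ℝ) (z : ℝ → ℝ × ℝ) : Prop where
  continuous : Continuous z
  start : z 0 = p
  finish : z τ = q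
  energy_eq : ∀ σ ∈ Icc 0 τ, S.energy (z σ) = S.energy p
  hasDerivAt : ∃ E : Set ℝ, E.Finite ∧ ∀ σ ∈ Ioo 0 τ, σ ∉ E →
    HasDerivAt (fun σ => (z σ).1) (S.h (z σ).2) σ ∧ HasDerivAt (fun σ => (z σ).2) (-S.f (z σ).1) σ
  zeros_fst : {σ ∈ Ioo 0 τ | (z σ).1 = 0}.encard = r
  zeros_snd : {σ ∈ Icc 0 τ | (z σ).2 = 0}.encard = (r + 1 : ℕ)
  exists_pos : ∃ σ ∈ Icc 0 τ, 0 < (z σ).1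
  exists_neg : ∃ σ ∈ Icc 0 τ, (z σ).1 < 0
  quadrant : ∃ w : ℝ × ℝ, 0 ≤ w.1 ∧ 0 ≤ w.2 ∧ q = turn^[2 * r + 1] w

lemma quarter_nonneg {c σ : ℝ} (hc : 0 < c) (h0 : 0 ≤ σ) (h1 : σ ≤ S.quarterTime c) :
    0 ≤ (S.quarter c σ).1 ∧ 0 ≤ (S.quarter c σ).2 := by
  constructor
  · rcases h0.eq_or_lt with rfl | h
    · rw [S.quarter_zero hc]
    · exact (S.quarter_fst_pos hc h).le
  · rcases h1.eq_or_lt with rfl | h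
    · rw [S.quarter_quarterTime hc]
    · exact (S.quarter_snd_pos hc h).le

/-- The orbit through a point of the first quadrant, if its phase at the time `τ` lies in the
quarter turn with the index `2 * r + 1`. -/
lemma trajectory_orbit {τ : ℝ} {r : ℕ} (hr : 1 ≤ r) {p : ℝ × ℝ} (h1 : 0 ≤ p.1)
    (h2 : 0 ≤ p.2) (hp : 0 < S.energy p)
    (hl : S.turnTime (S.energy p) (2 * r + 1) ≤ S.phase p + τ)
    (hu : S.phase p + τ ≤ S.turnTime (S.energy p) (2 * r + 2)) :
    S.Trajectory τ r p (orbit (2 * r + 1) S (S.energy p) (S.phase p + τ))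
      (fun σ => orbit (2 * r + 1) S (S.energy p) (S.phase p + σ)) := by
  obtain ⟨q0, q1, q2⟩ := S.quarter_phase h1 h2 hp
  set c := S.energy p with hc
  have hmono := S.strictMono_turnTime hp
  rw [← turnTime_one] at q1
  have hB0 := S.turnTime_zero c
  have z_eq : ∀ σ ∈ Icc 0 τ, _ := fun σ (hσ : σ ∈ Icc 0 τ) =>
    S.orbit_eq_zero (2 * r + 1) hp (σ := S.phase p + σ) (by linarith [hσ.1]) (by linarith [hσ.2])
  have hturn : ∀ k, 1 ≤ k → k ≤ 2 * r + 1 →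
      ∃ σ ∈ Icc 0 τ, orbit (2 * r + 1) S c (S.phase p + σ) = turn^[k] (0, (rot^[k] S).h.inv c) := by
    intro k hk hk'
    have m1 := hmono.monotone hk
    have m2 := hmono.monotone hk'
    refine ⟨S.turnTime c k - S.phase p, ⟨by linarith, by linarith⟩, ?_⟩
    rw [add_sub_cancel, S.orbit_turnTime hk' hp]
  constructor
  · exact S.continuous_orbit _ continuous_const (continuous_const.add continuous_id) fun _ => hp
  · rw [add_zero, S.orbit_of_le _ (by rwa [← turnTime_one]), q2]
  · rfl
  · exact fun σ hσ => S.energy_orbit _ hp (by linarith [hσ.1]) (by linarith [hσ.2])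
  · obtain ⟨E, hE, hd⟩ := S.hasDerivAt_orbit (2 * r + 1) hp
    refine ⟨(fun σ => σ - S.phase p) '' E, hE.image _, fun σ hσ hne => ?_⟩
    obtain ⟨d1, d2⟩ := hd (S.phase p + σ)
      ⟨by linarith [hσ.1], by linarith [hσ.2]⟩ fun hmem => hne ⟨_, hmem, by ring⟩
    exact ⟨d1.comp_const_add (S.phase p) σ, d2.comp_const_add (S.phase p) σ⟩
  · have : {σ ∈ Ioo 0 τ | (orbit (2 * r + 1) S c (S.phase p + σ)).1 = 0} =
        (fun l => S.turnTime c (2 * l) - S.phase p) '' (Finset.Icc 1 r : Finset ℕ) := by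
      ext σ
      simp only [mem_ofPred_eq, mem_image, Finset.coe_Icc]
      constructor
      · rintro ⟨hσ, h⟩
        obtain ⟨k, ⟨l, rfl⟩, hk1, hk2⟩ := (z_eq σ ⟨hσ.1.le, hσ.2.le⟩).1.1 h
        refine ⟨l, ⟨?_, ?_⟩, ?_⟩
        · by_contra! hl0
          obtain rfl : l = 0 := by omega
          rw [turnTime_zero] at hk2
          linarith [hσ.1]
        · by_contra! hl0
          have := hmono.monotone (show 2 * r + 2 ≤ l + l by omega)
          linarith [hσ.2]
        · rw [two_mul, hk2]; ring
      · rintro ⟨l, ⟨hl1, hl2⟩, rfl⟩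
        have m1 := hmono (show 1 < 2 * l by omega)
        have m2 := hmono (show 2 * l < 2 * r + 1 by omega)
        refine ⟨⟨by linarith, by linarith⟩, (z_eq _ ⟨by linarith, by linarith⟩).1.2
          ⟨2 * l, even_two_mul l, by omega, by ring⟩⟩
    rw [this, InjOn.encard_image, encard_coe_eq_coe_finsetCard]
    · simp
    · intro l _ l' _ h
      have := hmono.injective (show S.turnTime c (2 * l) = S.turnTime c (2 * l') by
        simpa using h)
      omega
  · have : {σ ∈ Icc 0 τ | (orbit (2 * r + 1) S c (S.phase p + σ)).2 = 0} =
        (fun l => S.turnTime c (2 * l + 1) - S.phase p) '' (Finset.range (r + 1) : Finset ℕ) := by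
      ext σ
      simp only [mem_ofPred_eq, mem_image, Finset.coe_range, mem_Iio]
      constructor
      · rintro ⟨hσ, h⟩
        obtain ⟨k, ⟨l, rfl⟩, hk1, hk2⟩ := (z_eq σ hσ).2.1 h
        refine ⟨l, by omega, ?_⟩
        rw [hk2]; ring
      · rintro ⟨l, hl1, rfl⟩
        have m1 := hmono.monotone (show 1 ≤ 2 * l + 1 by omega)
        have m2 := hmono.monotone (show 2 * l + 1 ≤ 2 * r + 1 by omega)
        refine ⟨⟨by linarith, by linarith⟩, (z_eq _ ⟨by linarith, by linarith⟩).2.2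
          ⟨2 * l + 1, odd_two_mul_add_one l, by omega, by ring⟩⟩
    rw [this, InjOn.encard_image, encard_coe_eq_coe_finsetCard]
    · simp
    · intro l _ l' _ h
      have := hmono.injective (show S.turnTime c (2 * l + 1) = S.turnTime c (2 * l' + 1) by
        simpa using h)
      omega
  -- After one quarter turn the orbit is on the positive `x`-axis, after three on the negative one.
  · obtain ⟨σ, hσ, h⟩ := hturn 1 le_rfl (by omega)
    refine ⟨σ, hσ, ?_⟩
    rw [h]
    exact Force.inv_pos _ hp
  · obtain ⟨σ, hσ, h⟩ := hturn 3 (by omega) (by omega)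
    refine ⟨σ, hσ, ?_⟩
    rw [h]
    exact neg_lt_zero.2 (Force.inv_pos _ hp)
  · obtain ⟨w1, w2⟩ := (rot^[2 * r + 1] S).quarter_nonneg hp (sub_nonneg.2 hl)
      (sub_le_iff_le_add'.2 (hu.trans_eq (S.turnTime_succ c (2 * r + 1))))
    exact ⟨_, w1, w2, S.orbit_eq_turn le_rfl hp hl hu⟩

/-- A path in the first quadrant whose start makes less than `2 * r + 1` and whose end makes more
than `2 * r + 2` quarter turns has a subpath whose image crosses the quadrant with the index
`2 * r + 1` from the `x`-axis to the `y`-axis. -/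
theorem exists_stretched_subpath {τ : ℝ} {r : ℕ} (hr : 1 ≤ r) {δ : ℝ → ℝ × ℝ}
    (hδ : Continuous δ) (h1 : ∀ s, 0 ≤ (δ s).1) (h2 : ∀ s, 0 ≤ (δ s).2)
    (h0 : ∀ s, 0 < S.energy (δ s)) {a b : ℝ} (hab : a ≤ b)
    (ha : S.turnTime (S.energy (δ a)) 1 + τ ≤ S.turnTime (S.energy (δ a)) (2 * r + 1))
    (hb : S.turnTime (S.energy (δ b)) (2 * r + 2) ≤ τ) :
    ∃ a' b' : ℝ, ∃ η : ℝ → ℝ × ℝ, a ≤ a' ∧ a' ≤ b' ∧ b' ≤ b ∧ Continuous η ∧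
      (η a').2 = 0 ∧ (η b').1 = 0 ∧ ∀ s ∈ Icc a' b', ∃ z, S.Trajectory τ r (δ s) (η s) z := by
  have hE := S.continuous_energy.comp hδ
  have hph := S.continuous_phase hδ h1 h2 h0
  have q := fun s => S.quarter_phase (h1 s) (h2 s) (h0 s)
  obtain ⟨a', b', l1, l2, l3, hfa, hgb, hfg⟩ := exists_crossing_subpath
    (f := fun s => S.phase (δ s) + τ - S.turnTime (S.energy (δ s)) (2 * r + 1))
    (g := fun s => S.phase (δ s) + τ - S.turnTime (S.energy (δ s)) (2 * r + 2))
    ((hph.add continuous_const).sub (S.continuous_turnTime hE h0 _))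
    ((hph.add continuous_const).sub (S.continuous_turnTime hE h0 _)) hab
    (fun s _ => sub_le_sub_left ((S.strictMono_turnTime (h0 s)).monotone (by omega)) _)
    (by
      have := (q a).2.1
      rw [turnTime_one] at ha
      linarith)
    (by linarith [(q b).1])
  refine ⟨a', b', fun s => orbit (2 * r + 1) S (S.energy (δ s)) (S.phase (δ s) + τ), l1, l2, l3,
    S.continuous_orbit _ hE (hph.add continuous_const) h0, ?_, ?_, fun s hs =>
      ⟨_, S.trajectory_orbit hr (h1 s) (h2 s) (h0 s) (by linarith [(hfg s hs).1])
        (by linarith [(hfg s hs).2])⟩⟩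
  · have hm := S.strictMono_turnTime (h0 a')
    have hz := S.turnTime_zero (S.energy (δ a'))
    have m1 := hm (show 0 < 2 * r + 1 by omega)
    have m2 := hm (show 2 * r + 1 < 2 * r + 2 by omega)
    exact (S.orbit_eq_zero _ (h0 a') (by linarith) (by linarith)).2.2
      ⟨2 * r + 1, odd_two_mul_add_one r, by omega, by linarith⟩
  · have hm := S.strictMono_turnTime (h0 b')
    have hz := S.turnTime_zero (S.energy (δ b'))
    have m1 := hm (show 0 < 2 * r + 2 by omega)
    exact (S.orbit_eq_zero _ (h0 b') (by linarith) (by linarith)).1.2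
      ⟨2 * r + 2, ⟨r + 1, by ring⟩, by omega, by linarith⟩

end PlanarSystem

/-! ### Replacing the given nonlinearities by global restoring forces -/

namespace Force

variable (f : Force)

lemma pot_le_of_nonneg {x y : ℝ} (hx : 0 ≤ x) (hxy : x ≤ y) : f.pot x ≤ f.pot y :=
  f.strictMonoOn_pot.monotoneOn hx (hx.trans hxy) hxy

/-- A positive multiple of a restoring force. -/
def smul (μ : ℝ) (hμ : 0 < μ) : Force where
  toFun x := μ * f x
  continuous := continuous_const.mul f.continuous
  pos x hx := mul_pos hμ (f.pos x hx)
  neg x hx := mul_neg_of_pos_of_neg hμ (f.neg x hx)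
  unbounded_right c := by
    obtain ⟨x, hx, h⟩ := f.unbounded_right (c / μ)
    refine ⟨x, hx, ?_⟩
    rw [intervalIntegral.integral_const_mul, ← div_le_iff₀' hμ]
    exact h
  unbounded_left c := by
    obtain ⟨x, hx, h⟩ := f.unbounded_left (c / μ)
    refine ⟨x, hx, ?_⟩
    rw [intervalIntegral.integral_const_mul, ← div_le_iff₀' hμ]
    exact h

lemma pot_smul {μ : ℝ} (hμ : 0 < μ) (x : ℝ) : (f.smul μ hμ).pot x = μ * f.pot x :=
  intervalIntegral.integral_const_mul _ _

lemma inv_smul {μ : ℝ} (hμ : 0 < μ) {c : ℝ} (hc : 0 ≤ c) :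
    (f.smul μ hμ).inv c = f.inv (c / μ) := by
  rw [inv_eq_iff _ hc (f.inv_nonneg (by positivity)), pot_smul, f.pot_inv (by positivity)]
  field_simp

/-- `f` is a global substitute, up to the level `C` of the potential, for the function `u` given
on `J`: the two sublevel sets coincide, and so do the functions and their potentials there. -/
structure Extends (u : ℝ → ℝ) (J : Set ℝ) (C : ℝ) : Prop where
  of_pot_le : ∀ y, f.pot y ≤ C → y ∈ J ∧ f y = u y ∧ f.pot y = ∫ v in (0 : ℝ)..y, u v
  of_integral_le : ∀ y ∈ J, ∫ v in (0 : ℝ)..y, u v ≤ C → f.pot y ≤ C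

variable {f} {u : ℝ → ℝ} {J : Set ℝ} {C : ℝ}

lemma Extends.invFunOn_right (hf : f.Extends u J C) {c : ℝ} (h0 : 0 ≤ c) (hc : c ≤ C) :
    Function.invFunOn (fun y => ∫ v in (0 : ℝ)..y, u v) (J ∩ Ici 0) c = f.inv c := by
  have hp := f.pot_inv h0
  obtain ⟨hJ, -, hI⟩ := hf.of_pot_le (f.inv c) (by rw [hp]; exact hc)
  have hex : ∃ y ∈ J ∩ Ici 0, (fun y => ∫ v in (0 : ℝ)..y, u v) y = c :=
    ⟨f.inv c, ⟨hJ, f.inv_nonneg h0⟩, by simp only [← hI, hp]⟩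
  have hm := Function.invFunOn_mem hex
  have he : (∫ v in (0 : ℝ).._, u v) = c := Function.invFunOn_eq hex
  symm
  rw [f.inv_eq_iff h0 hm.2]
  have hle := hf.of_integral_le _ hm.1 (he.trans_le hc)
  rw [(hf.of_pot_le _ hle).2.2, he]

lemma Extends.invFunOn_left (hf : f.Extends u J C) {c : ℝ} (h0 : 0 ≤ c) (hc : c ≤ C) :
    Function.invFunOn (fun y => ∫ v in (0 : ℝ)..y, u v) (J ∩ Iic 0) c = -f.reflect.inv c := by
  have hp := f.reflect.pot_inv h0
  rw [pot_reflect] at hp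
  obtain ⟨hJ, -, hI⟩ := hf.of_pot_le (-f.reflect.inv c) (by rw [hp]; exact hc)
  have hex : ∃ y ∈ J ∩ Iic 0, (fun y => ∫ v in (0 : ℝ)..y, u v) y = c :=
    ⟨-f.reflect.inv c, ⟨hJ, neg_nonpos.2 (f.reflect.inv_nonneg h0)⟩, by simp only [← hI, hp]⟩
  have hm := Function.invFunOn_mem hex
  have he : (∫ v in (0 : ℝ).._, u v) = c := Function.invFunOn_eq hex
  symm
  rw [neg_eq_iff_eq_neg, f.reflect.inv_eq_iff h0 (neg_nonneg.2 hm.2), pot_reflect, neg_neg]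
  have hle := hf.of_integral_le _ hm.1 (he.trans_le hc)
  rw [(hf.of_pot_le _ hle).2.2, he]

lemma Extends.integral_nonneg (hf : f.Extends u J C) (hC : 0 ≤ C) {y : ℝ} (hy : y ∈ J) :
    0 ≤ ∫ v in (0 : ℝ)..y, u v := by
  rcases le_total (∫ v in (0 : ℝ)..y, u v) C with h | h
  · rw [← (hf.of_pot_le y (hf.of_integral_le y hy h)).2.2]
    exact f.pot_nonneg y
  · exact hC.trans h

/-- A function with the sign of its argument on an interval can be replaced by a global restoring
force, constant outside a compact interval. -/
lemma exists_extends (hJ : J.OrdConnected) (h0J : (0 : ℝ) ∈ J) (hu : ContinuousOn u J)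
    (hpos : ∀ y ∈ J, 0 < y → 0 < u y) (hneg : ∀ y ∈ J, y < 0 → u y < 0) (hC : 0 < C)
    (hr : ∃ B ∈ J, 0 ≤ B ∧ C ≤ ∫ v in (0 : ℝ)..B, u v)
    (hl : ∃ A ∈ J, A ≤ 0 ∧ C ≤ ∫ v in (0 : ℝ)..A, u v) :
    ∃ f : Force, f.Extends u J C ∧ (MonotoneOn u J → Monotone f) := by
  obtain ⟨B, hBJ, hB, hCB⟩ := hr
  obtain ⟨A, hAJ, hA, hCA⟩ := hl
  replace hB : 0 < B := hB.lt_of_ne fun h => by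
    rw [← h, intervalIntegral.integral_same] at hCB
    exact hC.not_ge hCB
  replace hA : A < 0 := hA.lt_of_ne fun h => by
    rw [h, intervalIntegral.integral_same] at hCA
    exact hC.not_ge hCA
  have hAB : A ≤ B := by linarith
  have hsub : Icc A B ⊆ J := hJ.out hAJ hBJ
  set w : ℝ → ℝ := fun x => u (projIcc A B hAB x) with hw
  have hwc : Continuous w :=
    (hu.comp_continuous (continuous_subtype_val.comp continuous_projIcc)
      fun x => hsub (projIcc A B hAB x).2)
  have hwr : ∀ x, B ≤ x → w x = u B := fun x hx => by simp [hw, projIcc_of_right_le hAB hx]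
  have hwl : ∀ x, x ≤ A → w x = u A := fun x hx => by simp [hw, projIcc_of_le_left hAB hx]
  have hwm : ∀ x ∈ Icc A B, w x = u x := fun x hx => by simp [hw, projIcc_of_mem hAB hx]
  have hwpos : ∀ x, 0 < x → 0 < w x := by
    intro x hx
    rcases le_total x B with h | h
    · rw [hwm x ⟨by linarith, h⟩]
      exact hpos x (hsub ⟨by linarith, h⟩) hx
    · rw [hwr x h]
      exact hpos B hBJ hB
  have hwneg : ∀ x, x < 0 → w x < 0 := by
    intro x hx
    rcases le_total A x with h | h
    · rw [hwm x ⟨h, by linarith⟩]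
      exact hneg x (hsub ⟨h, by linarith⟩) hx
    · rw [hwl x h]
      exact hneg A hAJ hA
  have hii : ∀ a b, IntervalIntegrable w volume a b := fun a b => hwc.intervalIntegrable a b
  have hub := hpos B hBJ hB
  have hua := hneg A hAJ hA
  let f : Force :=
    { toFun := w
      continuous := hwc
      pos := hwpos
      neg := hwneg
      unbounded_right := fun c => by
        refine ⟨B + |c| / u B, by positivity, ?_⟩
        have hx : B ≤ B + |c| / u B := by linarith [div_nonneg (abs_nonneg c) hub.le]
        rw [← intervalIntegral.integral_add_adjacent_intervals (hii 0 B) (hii B _)]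
        have e1 : ∫ v in B..B + |c| / u B, w v = |c| := by
          rw [intervalIntegral.integral_congr (g := fun _ => u B)
            (fun v hv => hwr v (by rw [uIcc_of_le hx] at hv; exact hv.1))]
          simp only [intervalIntegral.integral_const, add_sub_cancel_left, smul_eq_mul]
          field_simp
        have e2 : 0 ≤ ∫ v in (0 : ℝ)..B, w v :=
          intervalIntegral.integral_nonneg hB.le fun v hv => by
            rcases hv.1.eq_or_lt with rfl | h
            · exact ge_of_tendsto (hwc.continuousWithinAt (s := Ioi 0))
                (Filter.eventually_of_mem self_mem_nhdsWithin fun x hx => (hwpos x hx).le)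
            · exact (hwpos v h).le
        linarith [le_abs_self c]
      unbounded_left := fun c => by
        have hx : A + |c| / u A ≤ A := by
          linarith [div_nonpos_of_nonneg_of_nonpos (abs_nonneg c) hua.le]
        refine ⟨A + |c| / u A, by linarith, ?_⟩
        rw [← intervalIntegral.integral_add_adjacent_intervals (hii 0 A) (hii A _)]
        have e1 : ∫ v in A..A + |c| / u A, w v = |c| := by
          rw [intervalIntegral.integral_congr (g := fun _ => u A)
            (fun v hv => hwl v (by rw [uIcc_of_ge hx] at hv; exact hv.2))]
          simp only [intervalIntegral.integral_const, add_sub_cancel_left, smul_eq_mul]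
          exact div_mul_cancel₀ _ hua.ne
        have e2 : 0 ≤ ∫ v in (0 : ℝ)..A, w v := by
          rw [intervalIntegral.integral_symm, ← intervalIntegral.integral_neg]
          refine intervalIntegral.integral_nonneg hA.le fun v hv => ?_
          rcases hv.2.eq_or_lt with rfl | h
          · exact neg_nonneg.2 (le_of_tendsto (hwc.continuousWithinAt (s := Iio 0))
              (Filter.eventually_of_mem self_mem_nhdsWithin fun x hx => (hwneg x hx).le))
          · exact neg_nonneg.2 (hwneg v h).le
        linarith [le_abs_self c] }
  have hpot : ∀ y ∈ Icc A B, f.pot y = ∫ v in (0 : ℝ)..y, u v := by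
    intro y hy
    refine intervalIntegral.integral_congr fun v hv => hwm v ?_
    exact (uIcc_subset_Icc ⟨hA.le, hB.le⟩ hy) hv
  have hint : ∀ a b, a ∈ J → b ∈ J → IntervalIntegrable u volume a b := fun a b ha hb =>
    (hu.mono (hJ.uIcc_subset ha hb)).intervalIntegrable
  refine ⟨f, ⟨fun y hy => ?_, fun y hyJ hy => ?_⟩, fun hm x y hxy => ?_⟩
  · have hyAB : y ∈ Icc A B := by
      constructor
      · by_contra! h
        have := f.strictAntiOn_pot (h.trans hA).le hA.le h
        rw [hpot A (left_mem_Icc.2 hAB)] at this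
        linarith
      · by_contra! h
        have := f.strictMonoOn_pot hB.le (hB.trans h).le h
        rw [hpot B (right_mem_Icc.2 hAB)] at this
        linarith
    exact ⟨hsub hyAB, hwm y hyAB, hpot y hyAB⟩
  · have hyAB : y ∈ Icc A B := by
      constructor
      · by_contra! h
        have h1 := intervalIntegral.integral_add_adjacent_intervals (hint 0 A h0J hAJ)
          (hint A y hAJ hyJ)
        have h2 : 0 < ∫ v in y..A, -u v := by
          refine intervalIntegral.intervalIntegral_pos_of_pos_on (hint y A hyJ hAJ).neg ?_ h
          intro v hv
          exact neg_pos.2 (hneg v (hJ.out hyJ hAJ ⟨hv.1.le, hv.2.le⟩) (hv.2.trans hA))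
        rw [intervalIntegral.integral_neg, ← intervalIntegral.integral_symm] at h2
        linarith
      · by_contra! h
        have h1 := intervalIntegral.integral_add_adjacent_intervals (hint 0 B h0J hBJ)
          (hint B y hBJ hyJ)
        have h2 : 0 < ∫ v in B..y, u v := by
          refine intervalIntegral.intervalIntegral_pos_of_pos_on (hint B y hBJ hyJ) ?_ h
          intro v hv
          exact hpos v (hJ.out hBJ hyJ ⟨hv.1.le, hv.2.le⟩) (hB.trans hv.1)
        linarith
    rw [hpot y hyAB]
    exact hy
  · exact hm (hsub (projIcc A B hAB x).2) (hsub (projIcc A B hAB y).2)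
      (monotone_projIcc hAB hxy)

end Force

namespace StepProblem

variable {m : ℕ} (P : StepProblem m)

lemma zero_mem_J : (0 : ℝ) ∈ P.J := by
  have := P.φ.map_source P.zero_mem_source
  rwa [P.φ_zero] at this

lemma ordConnected_J : P.J.OrdConnected := by
  have h : P.J = P.φ '' P.φ.source := P.φ.image_source_eq_target.symm
  rw [h]
  exact (P.source_ordConnected.isPreconnected.image _ P.φ.continuousOn).ordConnected

lemma continuousOn_h : ContinuousOn P.h P.J := P.φ.continuousOn_symm

lemma strictMonoOn_h : StrictMonoOn P.h P.J := by
  intro x hx y hy hxy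
  by_contra! h
  have := P.φ_strictMono.monotoneOn (P.φ.map_target hy) (P.φ.map_target hx) h
  rw [P.φ.right_inv hx, P.φ.right_inv hy] at this
  exact hxy.not_ge this

lemma h_zero : P.h 0 = 0 := by
  have := P.φ.left_inv P.zero_mem_source
  rwa [P.φ_zero] at this

/-- `h` and `g` are global substitutes for the two nonlinearities, good enough for all the annuli
with the outer levels `c₂ i`. -/
structure IsGlobal (c₂ : Fin (m + 1) → ℝ) (h g : Force) : Prop where
  pos : ∀ i, 0 < c₂ i
  monotone : Monotone h
  extends_h : ∀ i, h.Extends P.h P.J (c₂ i)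
  extends_g : ∀ i, g.Extends P.g univ (c₂ i / P.μ i)

lemma _root_.Force.Extends.mono {f : Force} {u : ℝ → ℝ} {J : Set ℝ} {C C' : ℝ}
    (hf : f.Extends u J C) (h : C' ≤ C) : f.Extends u J C' where
  of_pot_le y hy := hf.of_pot_le y (hy.trans h)
  of_integral_le y hyJ hy := by
    rwa [(hf.of_pot_le y (hf.of_integral_le y hyJ (hy.trans h))).2.2]

lemma exists_isGlobal {c₁ c₂ : Fin (m + 1) → ℝ} (hc : ∀ i, P.AnnulusLevels i (c₁ i) (c₂ i)) :
    ∃ h g : Force, P.IsGlobal c₂ h g := by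
  have hpos : ∀ i, 0 < c₂ i := fun i => (hc i).1.trans (hc i).2.1
  obtain ⟨i, hi⟩ := Finite.exists_max c₂
  obtain ⟨k, hk⟩ := Finite.exists_max fun i => c₂ i / P.μ i
  have hstar := lt_min_iff.1 (hc i).2.2.1
  obtain ⟨h, hh, hmono⟩ := Force.exists_extends P.ordConnected_J P.zero_mem_J P.continuousOn_h
    (fun y hy h0 => by simpa [P.h_zero] using P.strictMonoOn_h P.zero_mem_J hy h0)
    (fun y hy h0 => by simpa [P.h_zero] using P.strictMonoOn_h hy P.zero_mem_J h0)
    (hpos i) (by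
      obtain ⟨B, hB⟩ := lt_iSup_iff.1 hstar.2
      obtain ⟨hBJ, hB⟩ := lt_iSup_iff.1 hB
      exact ⟨B, hBJ.1, hBJ.2, (EReal.coe_lt_coe_iff.1 hB).le⟩) (by
      obtain ⟨B, hB⟩ := lt_iSup_iff.1 hstar.1
      obtain ⟨hBJ, hB⟩ := lt_iSup_iff.1 hB
      exact ⟨B, hBJ.1, hBJ.2, (EReal.coe_lt_coe_iff.1 hB).le⟩)
  have hg_eq : ∀ x, P.F k x = c₂ k → c₂ k / P.μ k ≤ ∫ v in (0 : ℝ)..x, P.g v := by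
    intro x hx
    rw [div_le_iff₀' (P.μ_pos k), ← hx]
    rfl
  obtain ⟨xm, xp, hxm, hxp, hFm, hFp, -⟩ := (hc k).2.2.2 (c₂ k) ⟨(hc k).2.1.le, le_rfl⟩
  obtain ⟨g, hg, -⟩ := Force.exists_extends (J := univ) (C := c₂ k / P.μ k) ordConnected_univ
    (mem_univ _) P.g_continuous.continuousOn
    (fun y _ h0 => pos_of_mul_pos_left (P.g_sign y h0.ne') h0.le)
    (fun y _ h0 => by
      have := P.g_sign y h0.ne
      by_contra! h
      exact this.not_ge (mul_nonpos_of_nonneg_of_nonpos h h0.le))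
    (div_pos (hpos k) (P.μ_pos k)) ⟨xp, mem_univ _, hxp.le, hg_eq xp hFp⟩
    ⟨xm, mem_univ _, hxm.le, hg_eq xm hFm⟩
  exact ⟨h, g, hpos, hmono P.strictMonoOn_h.monotoneOn, fun j => hh.mono (hi j), fun j => hg.mono (hk j)⟩

/-- The planar system that governs the `i`-th interval on which the weight is positive. -/
def system (h g : Force) (i : Fin (m + 1)) : PlanarSystem := ⟨h, g.smul (P.μ i) (P.μ_pos i)⟩

lemma energy_system (h g : Force) (i : Fin (m + 1)) (p : ℝ × ℝ) :
    (P.system h g i).energy p = h.pot p.2 + P.μ i * g.pot p.1 := by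
  rw [PlanarSystem.energy, system, Force.pot_smul]

namespace IsGlobal

variable {P} {c₂ : Fin (m + 1) → ℝ} {h g : Force}

lemma of_energy_system_le (hg : P.IsGlobal c₂ h g) {i : Fin (m + 1)} {p : ℝ × ℝ}
    (hp : (P.system h g i).energy p ≤ c₂ i) :
    p.2 ∈ P.J ∧ h p.2 = P.h p.2 ∧ g p.1 = P.g p.1 ∧ P.energy i p = (P.system h g i).energy p := by
  rw [energy_system] at hp
  have h1 := h.pot_nonneg p.2
  have h2 := mul_nonneg (P.μ_pos i).le (g.pot_nonneg p.1)
  obtain ⟨a1, a2, a3⟩ := (hg.extends_h i).of_pot_le p.2 (by linarith)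
  obtain ⟨-, b2, b3⟩ := (hg.extends_g i).of_pot_le p.1 (by
    rw [le_div_iff₀' (P.μ_pos i)]; linarith)
  refine ⟨a1, a2, b2, ?_⟩
  rw [energy_system, a3, b3]
  rfl

lemma energy_system_eq (hg : P.IsGlobal c₂ h g) {i : Fin (m + 1)} {p : ℝ × ℝ} (hJ : p.2 ∈ P.J)
    (hp : P.energy i p ≤ c₂ i) : (P.system h g i).energy p = P.energy i p := by
  have hμ := P.μ_pos i
  have h0 : 0 ≤ P.H p.2 := (hg.extends_h i).integral_nonneg (hg.pos i).le hJ
  have h1 : 0 ≤ P.G p.1 :=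
    (hg.extends_g i).integral_nonneg (div_pos (hg.pos i) hμ).le (mem_univ _)
  have h2 : P.H p.2 + P.μ i * P.G p.1 ≤ c₂ i := hp
  have h3 := mul_nonneg hμ.le h1
  have e1 := ((hg.extends_h i).of_pot_le p.2
    ((hg.extends_h i).of_integral_le p.2 hJ (by change P.H p.2 ≤ c₂ i; linarith))).2.2
  have e2 := ((hg.extends_g i).of_pot_le p.1 ((hg.extends_g i).of_integral_le p.1 (mem_univ _)
    (by change P.G p.1 ≤ _; rw [le_div_iff₀' hμ]; linarith))).2.2
  rw [energy_system, e1, e2]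
  rfl

lemma mem_block_iff (hg : P.IsGlobal c₂ h g) {c₁ : Fin (m + 1) → ℝ} {i : Fin (m + 1)}
    {q : Quadrant} {p : ℝ × ℝ} : p ∈ P.block c₁ c₂ i q ↔
      c₁ i ≤ (P.system h g i).energy p ∧ (P.system h g i).energy p ≤ c₂ i ∧ p ∈ q.carrier := by
  constructor
  · rintro ⟨hJ, h1, h2, h3⟩
    rw [hg.energy_system_eq hJ h2]
    exact ⟨h1, h2, h3⟩
  · rintro ⟨h1, h2, h3⟩
    obtain ⟨hJ, -, -, he⟩ := hg.of_energy_system_le h2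
    exact ⟨hJ, he ▸ h1, he ▸ h2, h3⟩

lemma HposInv_eq (hg : P.IsGlobal c₂ h g) (i : Fin (m + 1)) {c : ℝ} (h0 : 0 ≤ c)
    (hc : c ≤ c₂ i) : P.HposInv c = h.inv c :=
  (hg.extends_h i).invFunOn_right h0 hc

lemma HnegInv_eq (hg : P.IsGlobal c₂ h g) (i : Fin (m + 1)) {c : ℝ} (h0 : 0 ≤ c)
    (hc : c ≤ c₂ i) : P.HnegInv c = -h.reflect.inv c :=
  (hg.extends_h i).invFunOn_left h0 hc

lemma GposInv_eq (hg : P.IsGlobal c₂ h g) (i : Fin (m + 1)) {c : ℝ} (h0 : 0 ≤ c)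
    (hc : c ≤ c₂ i) : P.GposInv (c / P.μ i) = g.inv (c / P.μ i) := by
  have hμ := P.μ_pos i
  have := (hg.extends_g i).invFunOn_right (c := c / P.μ i) (by positivity) (by gcongr)
  rwa [univ_inter] at this

lemma GnegInv_eq (hg : P.IsGlobal c₂ h g) (i : Fin (m + 1)) {c : ℝ} (h0 : 0 ≤ c)
    (hc : c ≤ c₂ i) : P.GnegInv (c / P.μ i) = -g.reflect.inv (c / P.μ i) := by
  have hμ := P.μ_pos i
  have := (hg.extends_g i).invFunOn_left (c := c / P.μ i) (by positivity) (by gcongr)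
  rwa [univ_inter] at this

lemma h_HposInv (hg : P.IsGlobal c₂ h g) (i : Fin (m + 1)) {c : ℝ} (h0 : 0 ≤ c)
    (hc : c ≤ c₂ i) : P.h (P.HposInv c) = h (h.inv c) := by
  rw [hg.HposInv_eq i h0 hc]
  exact ((hg.extends_h i).of_pot_le _ (by rwa [h.pot_inv h0])).2.1.symm

lemma h_HnegInv (hg : P.IsGlobal c₂ h g) (i : Fin (m + 1)) {c : ℝ} (h0 : 0 ≤ c)
    (hc : c ≤ c₂ i) : -P.h (P.HnegInv c) = h.reflect (h.reflect.inv c) := by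
  rw [hg.HnegInv_eq i h0 hc, Force.reflect_apply]
  exact congrArg _ ((hg.extends_h i).of_pot_le _
    (by rwa [← Force.pot_reflect, h.reflect.pot_inv h0])).2.1.symm

lemma F_eq (hg : P.IsGlobal c₂ h g) {i : Fin (m + 1)} {x : ℝ} (hx : P.μ i * g.pot x ≤ c₂ i) :
    P.F i x = P.μ i * g.pot x := by
  rw [((hg.extends_g i).of_pot_le x (by rwa [le_div_iff₀' (P.μ_pos i)])).2.2]
  rfl

/-- The crossing times of the four quadrants are the quarter times of the turned systems. -/
lemma crossTime_eq (hg : P.IsGlobal c₂ h g) {i : Fin (m + 1)} {c : ℝ} (h0 : 0 < c)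
    (hc : c ≤ c₂ i) :
    P.crossTime i c .I = (P.system h g i).quarterTime c ∧
    P.crossTime i c .IV = (P.system h g i).rot.quarterTime c ∧
    P.crossTime i c .III = (P.system h g i).rot.rot.quarterTime c ∧
    P.crossTime i c .II = (P.system h g i).rot.rot.rot.quarterTime c := by
  have hμ := P.μ_pos i
  have hc' : 0 ≤ c / P.μ i := by positivity
  have hxp : P.xpos i c = g.inv (c / P.μ i) := hg.GposInv_eq i h0.le hc
  have hxn : P.xneg i c = -g.reflect.inv (c / P.μ i) := hg.GnegInv_eq i h0.le hc
  have hF : ∀ k : Force, ∀ x ∈ uIcc 0 (k.inv (c / P.μ i)), 0 ≤ P.μ i * k.pot x ∧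
      P.μ i * k.pot x ≤ c := by
    intro k x hx
    rw [uIcc_of_le (k.inv_nonneg hc')] at hx
    have := k.pot_le_of_nonneg hx.1 hx.2
    rw [k.pot_inv hc', le_div_iff₀' hμ] at this
    exact ⟨mul_nonneg hμ.le (k.pot_nonneg x), this⟩
  have right : ∀ (T : Force) (φ : ℝ → ℝ), (∀ e, 0 ≤ e → e ≤ c₂ i → φ e = T (T.inv e)) →
      ∫ x in (0 : ℝ)..P.xpos i c, 1 / φ (c - P.F i x) =
        PlanarSystem.quarterTime ⟨T, g.smul (P.μ i) hμ⟩ c := by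
    intro T φ hφ
    rw [← PlanarSystem.integral_eq_quarterTime _ h0, hxp, g.inv_smul hμ h0.le]
    refine intervalIntegral.integral_congr fun x hx => ?_
    obtain ⟨f1, f2⟩ := hF g x hx
    simp only
    rw [hg.F_eq (f2.trans hc), hφ _ (by linarith) (by linarith), Force.pot_smul, one_div]
  have left : ∀ (T : Force) (φ : ℝ → ℝ), (∀ e, 0 ≤ e → e ≤ c₂ i → φ e = T (T.inv e)) →
      ∫ x in P.xneg i c..(0 : ℝ), 1 / φ (c - P.F i x) =
        PlanarSystem.quarterTime ⟨T, g.reflect.smul (P.μ i) hμ⟩ c := by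
    intro T φ hφ
    rw [← PlanarSystem.integral_eq_quarterTime _ h0, hxn, g.reflect.inv_smul hμ h0.le,
      ← neg_zero, ← intervalIntegral.integral_comp_neg, neg_zero]
    refine intervalIntegral.integral_congr fun x hx => ?_
    obtain ⟨f1, f2⟩ := hF g.reflect x hx
    simp only
    rw [Force.pot_reflect] at f1 f2
    rw [hg.F_eq (f2.trans hc), hφ _ (by linarith) (by linarith), Force.pot_smul, one_div,
      Force.pot_reflect]
  have hsm : g.reflect.smul (P.μ i) hμ = (g.smul (P.μ i) hμ).reflect := by
    simp [Force.smul, Force.reflect]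
  refine ⟨right h (fun e => P.h (P.HposInv e)) fun e e0 e1 => hg.h_HposInv i e0 e1, ?_, ?_, ?_⟩
  · rw [← PlanarSystem.quarterTime_swap]
    exact right h.reflect (fun e => -P.h (P.HnegInv e)) fun e e0 e1 => hg.h_HnegInv i e0 e1
  · refine (left h.reflect (fun e => -P.h (P.HnegInv e))
      fun e e0 e1 => hg.h_HnegInv i e0 e1).trans ?_
    rw [hsm]
    rfl
  · rw [← PlanarSystem.quarterTime_swap]
    refine (left h (fun e => P.h (P.HposInv e)) fun e e0 e1 => hg.h_HposInv i e0 e1).trans ?_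
    rw [hsm]
    simp [system, PlanarSystem.rot, PlanarSystem.swap]

end IsGlobal

end StepProblem

/-! ### Solutions on the intervals where the weight is positive -/

/-- A continuous function with a bounded derivative outside a finite set is Lipschitz. -/
lemma exists_lipschitzOnWith_of_hasDerivAt {w w' : ℝ → ℝ} (hw : Continuous w)
    (hw' : Continuous w') {A B : ℝ} {E : Set ℝ} (hE : E.Finite)
    (hd : ∀ σ ∈ Ioo A B, σ ∉ E → HasDerivAt w (w' σ) σ) :
    ∃ K, LipschitzOnWith K w (Icc A B) := by
  obtain ⟨M, hM⟩ := (isCompact_Icc (a := A) (b := B)).exists_bound_of_continuousOn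
    hw'.continuousOn
  refine ⟨M.toNNReal, LipschitzOnWith.of_dist_le_mul fun x hx y hy => ?_⟩
  have key : ∀ a ∈ Icc A B, ∀ b ∈ Icc A B, a ≤ b → dist (w a) (w b) ≤ M * dist a b := by
    intro a ha b hb hab
    have hFTC := integral_eq_of_hasDerivAt_off_countable_of_le w w' hab hE.countable
      hw.continuousOn (fun x hx => hd x ⟨ha.1.trans_lt hx.1.1, hx.1.2.trans_le hb.2⟩ hx.2)
      (hw'.intervalIntegrable a b)
    rw [dist_comm, dist_eq_norm, ← hFTC, dist_comm a b, Real.dist_eq]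
    apply intervalIntegral.norm_integral_le_of_norm_le_const
    intro x hx
    rw [uIoc_of_le hab] at hx
    exact hM x ⟨ha.1.trans hx.1.le, hx.2.trans hb.2⟩
  have hle : M * dist x y ≤ M.toNNReal * dist x y :=
    mul_le_mul_of_nonneg_right (Real.le_coe_toNNReal M) dist_nonneg
  refine le_trans ?_ hle
  rcases le_total x y with h | h
  · exact key x hx y hy h
  · rw [dist_comm (w x), dist_comm x]
    exact key y hy x hx h

/-- Two Lipschitz functions that agree at the common end of their intervals. -/
lemma LipschitzOnWith.exists_ite {X : Type*} [PseudoMetricSpace X] {u v : ℝ → X} {A B C : ℝ}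
    {K K' : NNReal} (hu : LipschitzOnWith K u (Icc A B)) (hv : LipschitzOnWith K' v (Icc B C))
    (huv : u B = v B) (hAB : A ≤ B) (hBC : B ≤ C) :
    ∃ K'', LipschitzOnWith K'' (fun t => if t ≤ B then u t else v t) (Icc A C) := by
  refine ⟨K + K', LipschitzOnWith.of_dist_le_mul ?_⟩
  have key : ∀ x ∈ Icc A C, ∀ y ∈ Icc A C, x ≤ y →
      dist (if x ≤ B then u x else v x) (if y ≤ B then u y else v y) ≤
        ((K + K' : NNReal) : ℝ) * dist x y := by
    intro x hx y hy hxy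
    push_cast
    rw [dist_comm x y, Real.dist_eq, abs_of_nonneg (sub_nonneg.2 hxy)]
    have hK := K.coe_nonneg
    have hK' := K'.coe_nonneg
    split_ifs with h1 h2 h2
    · have := hu.dist_le_mul x ⟨hx.1, h1⟩ y ⟨hy.1, h2⟩
      rw [dist_comm x y, Real.dist_eq, abs_of_nonneg (sub_nonneg.2 hxy)] at this
      nlinarith
    · have d1 := hu.dist_le_mul x ⟨hx.1, h1⟩ B ⟨hAB, le_rfl⟩
      have d2 := hv.dist_le_mul B ⟨le_rfl, hBC⟩ y ⟨(not_le.1 h2).le, hy.2⟩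
      rw [dist_comm x B, Real.dist_eq, abs_of_nonneg (by linarith)] at d1
      rw [dist_comm B y, Real.dist_eq, abs_of_nonneg (by linarith)] at d2
      have d3 := dist_triangle (u x) (u B) (v y)
      rw [huv] at d1 d3
      have e1 : (K : ℝ) * (B - x) ≤ K * (y - x) :=
        mul_le_mul_of_nonneg_left (by linarith) hK
      have e2 : (K' : ℝ) * (y - B) ≤ K' * (y - x) :=
        mul_le_mul_of_nonneg_left (by linarith) hK'
      linarith
    · exact absurd (hxy.trans h2) h1
    · have := hv.dist_le_mul x ⟨(not_le.1 h1).le, hx.2⟩ y ⟨(not_le.1 h2).le, hy.2⟩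
      rw [dist_comm x y, Real.dist_eq, abs_of_nonneg (sub_nonneg.2 hxy)] at this
      nlinarith
  intro x hx y hy
  rcases le_total x y with h | h
  · exact key x hx y hy h
  · rw [dist_comm, dist_comm x y]
    exact key y hy x hx h

lemma LipschitzOnWith.exists_prodMk {z : ℝ → ℝ × ℝ} {s : Set ℝ}
    (h1 : ∃ K, LipschitzOnWith K (fun t => (z t).1) s)
    (h2 : ∃ K, LipschitzOnWith K (fun t => (z t).2) s) : ∃ K, LipschitzOnWith K z s := by
  obtain ⟨K, h1⟩ := h1
  obtain ⟨K', h2⟩ := h2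
  refine ⟨max K K', LipschitzOnWith.of_dist_le_mul fun x hx y hy => ?_⟩
  rw [Prod.dist_eq]
  refine max_le ((h1.dist_le_mul x hx y hy).trans ?_) ((h2.dist_le_mul x hx y hy).trans ?_)
  · exact mul_le_mul_of_nonneg_right (by exact_mod_cast le_max_left K K') dist_nonneg
  · exact mul_le_mul_of_nonneg_right (by exact_mod_cast le_max_right K K') dist_nonneg

namespace StepProblem

variable {m : ℕ} (P : StepProblem m)

/-- `z` solves `x' = h y`, `y' = -a(t) g x` on `[A, B]`: it is Lipschitz, stays in `ℝ × J₂`, and the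
equations hold outside a finite set. -/
structure SolutionOn (A B : ℝ) (z : ℝ → ℝ × ℝ) : Prop where
  lipschitz : ∃ K, LipschitzOnWith K z (Icc A B)
  mem_J : ∀ t ∈ Icc A B, (z t).2 ∈ P.J
  hasDerivAt : ∃ E : Set ℝ, E.Finite ∧ ∀ t ∈ Ioo A B, t ∉ E →
    HasDerivAt (fun t => (z t).1) (P.h (z t).2) t ∧
      HasDerivAt (fun t => (z t).2) (-(P.a t * P.g (z t).1)) t

variable {P}

lemma SolutionOn.ite {A B C : ℝ} {u v : ℝ → ℝ × ℝ} (hu : P.SolutionOn A B u)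
    (hv : P.SolutionOn B C v) (huv : u B = v B) (hAB : A ≤ B) (hBC : B ≤ C) :
    P.SolutionOn A C (fun t => if t ≤ B then u t else v t) where
  lipschitz := by
    obtain ⟨K, hK⟩ := hu.lipschitz
    obtain ⟨K', hK'⟩ := hv.lipschitz
    exact hK.exists_ite hK' huv hAB hBC
  mem_J t ht := by
    split_ifs with h
    · exact hu.mem_J t ⟨ht.1, h⟩
    · exact hv.mem_J t ⟨(not_le.1 h).le, ht.2⟩
  hasDerivAt := by
    obtain ⟨E, hE, hd⟩ := hu.hasDerivAt
    obtain ⟨E', hE', hd'⟩ := hv.hasDerivAt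
    refine ⟨E ∪ E' ∪ {B}, (hE.union hE').union (finite_singleton B), fun t ht hne => ?_⟩
    simp only [mem_union, mem_singleton_iff, not_or] at hne
    obtain ⟨⟨n1, n2⟩, n3⟩ := hne
    rcases Ne.lt_or_gt n3 with h | h
    · have hev : ∀ᶠ x in nhds t, (if x ≤ B then u x else v x) = u x := by
        filter_upwards [gt_mem_nhds h] with x hx using if_pos hx.le
      obtain ⟨d1, d2⟩ := hd t ⟨ht.1, h⟩ n1
      rw [hev.self_of_nhds]
      exact ⟨d1.congr_of_eventuallyEq (hev.mono fun τ hτ => congrArg Prod.fst hτ),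
        d2.congr_of_eventuallyEq (hev.mono fun τ hτ => congrArg Prod.snd hτ)⟩
    · have hev : ∀ᶠ x in nhds t, (if x ≤ B then u x else v x) = v x := by
        filter_upwards [lt_mem_nhds h] with x hx using if_neg hx.not_ge
      obtain ⟨d1, d2⟩ := hd' t ⟨h, ht.2⟩ n2
      rw [hev.self_of_nhds]
      exact ⟨d1.congr_of_eventuallyEq (hev.mono fun τ hτ => congrArg Prod.fst hτ),
        d2.congr_of_eventuallyEq (hev.mono fun τ hτ => congrArg Prod.snd hτ)⟩

variable {c₂ : Fin (m + 1) → ℝ} {h g : Force}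

/-- A solution of the autonomous system of the `i`-th interval, shifted to that interval. -/
lemma IsGlobal.solutionOn (hg : P.IsGlobal c₂ h g) {i : Fin (m + 1)} {z : ℝ → ℝ × ℝ}
    (hz : Continuous z)
    (hE : ∀ σ ∈ Icc 0 (P.s i - P.t i), (P.system h g i).energy (z σ) ≤ c₂ i)
    (hd : ∃ E : Set ℝ, E.Finite ∧ ∀ σ ∈ Ioo 0 (P.s i - P.t i), σ ∉ E →
      HasDerivAt (fun σ => (z σ).1) ((P.system h g i).h (z σ).2) σ ∧
        HasDerivAt (fun σ => (z σ).2) (-(P.system h g i).f (z σ).1) σ) :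
    P.SolutionOn (P.t i) (P.s i) (fun t => z (t - P.t i)) := by
  obtain ⟨E, hEf, hd⟩ := hd
  have hshift : Continuous fun t : ℝ => t - P.t i := continuous_id.sub continuous_const
  have hzs := hz.comp hshift
  have hd' : ∀ t ∈ Ioo (P.t i) (P.s i), t ∉ (fun σ => σ + P.t i) '' E →
      HasDerivAt (fun t => (z (t - P.t i)).1) ((P.system h g i).h (z (t - P.t i)).2) t ∧
        HasDerivAt (fun t => (z (t - P.t i)).2) (-(P.system h g i).f (z (t - P.t i)).1) t := by
    intro t ht hne
    obtain ⟨d1, d2⟩ := hd (t - P.t i) ⟨by linarith [ht.1], by linarith [ht.2]⟩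
      fun hm => hne ⟨_, hm, by ring⟩
    exact ⟨d1.comp_sub_const t (P.t i), d2.comp_sub_const t (P.t i)⟩
  refine ⟨LipschitzOnWith.exists_prodMk ?_ ?_, ?_,
    (fun σ => σ + P.t i) '' E, hEf.image _, fun t ht hne => ?_⟩
  · exact exists_lipschitzOnWith_of_hasDerivAt (continuous_fst.comp hzs)
      ((P.system h g i).h.continuous.comp (continuous_snd.comp hzs)) (hEf.image _)
      fun t ht hne => (hd' t ht hne).1
  · exact exists_lipschitzOnWith_of_hasDerivAt (continuous_snd.comp hzs)
      ((P.system h g i).f.continuous.comp (continuous_fst.comp hzs)).neg (hEf.image _)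
      fun t ht hne => (hd' t ht hne).2
  · intro t ht
    exact (hg.of_energy_system_le (hE (t - P.t i) ⟨by linarith [ht.1], by linarith [ht.2]⟩)).1
  · obtain ⟨d1, d2⟩ := hd' t ht hne
    obtain ⟨-, e1, e2, -⟩ :=
      hg.of_energy_system_le (hE (t - P.t i) ⟨by linarith [ht.1], by linarith [ht.2]⟩)
    rw [P.a_eq_μ i t ⟨ht.1.le, ht.2.le⟩, ← e1, ← e2]
    exact ⟨d1, d2⟩

/-- The twist condition in terms of the turning times of the system turned so that the quadrant
`κ` becomes the first one. -/
lemma IsGlobal.twist_turnTime (hg : P.IsGlobal c₂ h g) {i : Fin (m + 1)} {κ : Quadrant}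
    (S : PlanarSystem) (hS : κ = .I ∧ S = P.system h g i ∨ κ = .III ∧ S = (P.system h g i).rot.rot)
    {d e : ℝ} {α β : ℕ} (hd : 0 < d) (hd' : d ≤ c₂ i) (he : 0 < e) (he' : e ≤ c₂ i)
    (htw : P.Twist i κ d e α β) :
    S.turnTime d 1 + (P.s i - P.t i) ≤ S.turnTime d (3 + 4 * α) ∧
      S.turnTime e (2 + 4 * β) ≤ P.s i - P.t i := by
  obtain ⟨d1, d2, d3, d4⟩ := hg.crossTime_eq hd hd'
  obtain ⟨e1, e2, e3, e4⟩ := hg.crossTime_eq he he'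
  have t2 : ∀ c, S.turnTime c 2 = S.quarterTime c + S.rot.quarterTime c := fun c => by
    simp [PlanarSystem.turnTime, Finset.sum_range_succ]
  have t3 : ∀ c, S.turnTime c 3 =
      S.quarterTime c + S.rot.quarterTime c + S.rot.rot.quarterTime c := fun c => by
    simp [PlanarSystem.turnTime, Finset.sum_range_succ]
  have t4 : ∀ c, S.turnTime c 4 = S.quarterTime c + S.rot.quarterTime c +
      S.rot.rot.quarterTime c + S.rot.rot.rot.quarterTime c := fun c => by
    simp [PlanarSystem.turnTime, Finset.sum_range_succ]
  obtain ⟨h1, h2⟩ := htw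
  rw [S.turnTime_add_four_mul, S.turnTime_add_four_mul, S.turnTime_one, t2, t3, t4, t4]
  rcases hS with ⟨rfl, rfl⟩ | ⟨rfl, rfl⟩
  · simp only [Quadrant.next, period, d1, d2, d3, d4] at h1
    simp only [Quadrant.next, period, e1, e2, e3, e4] at h2
    exact ⟨by linarith, by linarith⟩
  · simp only [Quadrant.next, period, d1, d2, d3, d4] at h1
    simp only [Quadrant.next, period, e1, e2, e3, e4] at h2
    rw [PlanarSystem.rot_four]
    refine ⟨?_, ?_⟩ <;> nlinarith

variable (P) in
/-- The number of zeros of the two components of `z` on the `i`-th interval, when `z` goes from the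
quadrant `κ` to the quadrant `q` with the counter `n`. -/
def ZeroCount (i : Fin (m + 1)) (κ q : Quadrant) (n : ℕ) (z : ℝ → ℝ × ℝ) : Prop :=
  (q = κ.prev →
    {τ ∈ Ioo (P.t i) (P.s i) | (z τ).1 = 0}.encard = (2 * n - 1 : ℕ) ∧
    {τ ∈ Icc (P.t i) (P.s i) | (z τ).2 = 0}.encard = (2 * n : ℕ)) ∧
  (q = κ.next →
    {τ ∈ Ioo (P.t i) (P.s i) | (z τ).1 = 0}.encard = (2 * n : ℕ) ∧
    {τ ∈ Icc (P.t i) (P.s i) | (z τ).2 = 0}.encard = (2 * n + 1 : ℕ))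

lemma encard_shift (p : ℝ → Prop) (I I' : Set ℝ) (t : ℝ) (hI : ∀ σ, σ + t ∈ I ↔ σ ∈ I') :
    {τ ∈ I | p (τ - t)}.encard = {σ ∈ I' | p σ}.encard := by
  have : {τ ∈ I | p (τ - t)} = (fun σ => σ + t) '' {σ ∈ I' | p σ} := by
    ext τ
    simp only [mem_ofPred_eq, mem_image]
    constructor
    · rintro ⟨h1, h2⟩
      exact ⟨τ - t, ⟨(hI _).1 (by simpa using h1), h2⟩, by ring⟩
    · rintro ⟨σ, ⟨h1, h2⟩, rfl⟩
      exact ⟨(hI σ).2 h1, by simpa using h2⟩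
  rw [this, (add_left_injective t).injOn.encard_image]

lemma iterate_turn_four_mul (k n : ℕ) (p : ℝ × ℝ) :
    PlanarSystem.turn^[4 * k + n] p = PlanarSystem.turn^[n] p := by
  induction k with
  | zero => simp
  | succ k ih =>
    rw [show 4 * (k + 1) + n = 4 * k + n + 4 by ring, PlanarSystem.iterate_turn_add_four, ih]

/-- The stretching property on an interval where the weight is positive: a path that crosses the
block of the quadrant `κ` from one boundary of the annulus to the other has a subpath that is mapped
to a path crossing the block of the quadrant `q` from the `x`-axis to the `y`-axis, and whose points
move along solutions with the prescribed numbers of zeros. -/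
theorem IsGlobal.exists_nonlinear_subpath (hg : P.IsGlobal c₂ h g) {c₁ : Fin (m + 1) → ℝ}
    {i : Fin (m + 1)} (hc₁ : 0 < c₁ i) {κ q : Quadrant} (hκ : κ = .I ∨ κ = .III)
    (hq : q = κ.prev ∨ q = κ.next) {d e : ℝ} {α β j : ℕ} (htw : P.Twist i κ d e α β)
    (hj : 1 ≤ j) (hjβ : α + j ≤ β) {δ : ℝ → ℝ × ℝ} (hδ : Continuous δ) {a b : ℝ}
    (hab : a ≤ b) (hblock : ∀ s ∈ Icc a b, δ s ∈ P.block c₁ c₂ i κ)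
    (ha : P.energy i (δ a) = d) (hb : P.energy i (δ b) = e) :
    ∃ a' b' : ℝ, ∃ η : ℝ → ℝ × ℝ, a ≤ a' ∧ a' ≤ b' ∧ b' ≤ b ∧ Continuous η ∧
      (η a').2 = 0 ∧ (η b').1 = 0 ∧ ∀ s ∈ Icc a' b', η s ∈ P.block c₁ c₂ i q ∧
        ∃ z, P.SolutionOn (P.t i) (P.s i) z ∧ z (P.t i) = δ s ∧ z (P.s i) = η s ∧
          P.ZeroCount i κ q (α + j) z ∧ (∃ τ ∈ Icc (P.t i) (P.s i), 0 < (z τ).1) ∧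
          ∃ τ ∈ Icc (P.t i) (P.s i), (z τ).1 < 0 := by
  obtain ⟨r, hr1, hr⟩ : ∃ r, 1 ≤ r ∧ (q = κ.prev ∧ r = 2 * (α + j) - 1 ∨
      q = κ.next ∧ r = 2 * (α + j)) := by
    rcases hq with hq | hq
    · exact ⟨2 * (α + j) - 1, by omega, Or.inl ⟨hq, rfl⟩⟩
    · exact ⟨2 * (α + j), by omega, Or.inr ⟨hq, rfl⟩⟩
  have hts : P.t i ≤ P.s i := (P.t_lt_s i).le
  set S := P.system h g i with hS
  -- The path is frozen outside `[a, b]`, so that all its points are in the block.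
  set δ' : ℝ → ℝ × ℝ := fun s => δ (projIcc a b hab s) with hδ'
  have hδc : Continuous δ' := hδ.comp (continuous_subtype_val.comp continuous_projIcc)
  have hδe : ∀ s ∈ Icc a b, δ' s = δ s := fun s hs => by simp [hδ', projIcc_of_mem hab hs]
  have hδb : ∀ s, c₁ i ≤ S.energy (δ' s) ∧ S.energy (δ' s) ≤ c₂ i ∧ δ' s ∈ κ.carrier :=
    fun s => hg.mem_block_iff.1 (hblock _ (projIcc a b hab s).2)
  have haI := left_mem_Icc.2 hab
  have hbI := right_mem_Icc.2 hab
  have hSa : S.energy (δ' a) = d := by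
    rw [hδe a haI, ← ha]
    exact hg.energy_system_eq (hblock a haI).1 (hblock a haI).2.2.1
  have hSb : S.energy (δ' b) = e := by
    rw [hδe b hbI, ← hb]
    exact hg.energy_system_eq (hblock b hbI).1 (hblock b hbI).2.2.1
  have tw := fun (T : PlanarSystem) hT => hg.twist_turnTime (κ := κ) T hT
    (hc₁.trans_le (hSa ▸ (hδb a).1)) (hSa ▸ (hδb a).2.1)
    (hc₁.trans_le (hSb ▸ (hδb b).1)) (hSb ▸ (hδb b).2.1) htw
  have hmono : ∀ T : PlanarSystem,
      T.turnTime d 1 + (P.s i - P.t i) ≤ T.turnTime d (3 + 4 * α) ∧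
        T.turnTime e (2 + 4 * β) ≤ P.s i - P.t i →
      T.turnTime d 1 + (P.s i - P.t i) ≤ T.turnTime d (2 * r + 1) ∧
        T.turnTime e (2 * r + 2) ≤ P.s i - P.t i := fun T hT =>
    ⟨hT.1.trans ((T.strictMono_turnTime (hc₁.trans_le (hSa ▸ (hδb a).1))).monotone (by omega)),
      ((T.strictMono_turnTime (hc₁.trans_le (hSb ▸ (hδb b).1))).monotone (by omega)).trans hT.2⟩
  have hcount : ∀ z : ℝ → ℝ × ℝ,
      {σ ∈ Ioo 0 (P.s i - P.t i) | (z σ).1 = 0}.encard = r →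
      {σ ∈ Icc 0 (P.s i - P.t i) | (z σ).2 = 0}.encard = (r + 1 : ℕ) →
      P.ZeroCount i κ q (α + j) fun t => z (t - P.t i) := by
    intro z z1 z2
    rw [ZeroCount,
      encard_shift (fun σ => (z σ).1 = 0) _ (Ioo 0 (P.s i - P.t i)) (P.t i) (fun σ => by
        simp only [mem_Ioo]; constructor <;> rintro ⟨h1, h2⟩ <;> constructor <;> linarith),
      encard_shift (fun σ => (z σ).2 = 0) _ (Icc 0 (P.s i - P.t i)) (P.t i) (fun σ => by
        simp only [mem_Icc]; constructor <;> rintro ⟨h1, h2⟩ <;> constructor <;> linarith), z1, z2]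
    have hne : κ.prev ≠ κ.next := by cases κ <;> simp [Quadrant.prev, Quadrant.next]
    rcases hr with ⟨rfl, rfl⟩ | ⟨rfl, rfl⟩
    · refine ⟨fun _ => ⟨rfl, ?_⟩, fun h' => absurd h' hne⟩
      rw [show 2 * (α + j) - 1 + 1 = 2 * (α + j) by omega]
    · exact ⟨fun h' => absurd h'.symm hne, fun _ => ⟨rfl, rfl⟩⟩
  rcases hκ with rfl | rfl
  · obtain ⟨T1, T2⟩ := hmono S (tw S (Or.inl ⟨rfl, hS⟩))
    obtain ⟨a', b', η, l1, l2, l3, hη, hηa, hηb, hz⟩ := S.exists_stretched_subpath hr1 hδc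
      (fun s => (hδb s).2.2.1) (fun s => (hδb s).2.2.2) (fun s => hc₁.trans_le (hδb s).1) hab
      (by rw [hSa]; exact T1) (by rw [hSb]; exact T2)
    refine ⟨a', b', η, l1, l2, l3, hη, hηa, hηb, fun s hs => ?_⟩
    obtain ⟨z, hz⟩ := hz s hs
    have hen : ∀ σ ∈ Icc 0 (P.s i - P.t i), S.energy (z σ) ≤ c₂ i := fun σ hσ => by
      rw [hz.energy_eq σ hσ]
      exact (hδb s).2.1
    have hend : S.energy (η s) = S.energy (δ' s) := by
      rw [← hz.finish]
      exact hz.energy_eq _ ⟨by linarith, le_rfl⟩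
    refine ⟨hg.mem_block_iff.2 ⟨hend ▸ (hδb s).1, hend ▸ (hδb s).2.1, ?_⟩,
      fun t => z (t - P.t i), hg.solutionOn hz.continuous hen hz.hasDerivAt, ?_, hz.finish,
      hcount z hz.zeros_fst hz.zeros_snd, ?_, ?_⟩
    · obtain ⟨w, w1, w2, hw⟩ := hz.quadrant
      rcases hr with ⟨rfl, hr⟩ | ⟨rfl, hr⟩
      · rw [hw, show 2 * r + 1 = 4 * (α + j - 1) + 3 by omega, iterate_turn_four_mul]
        exact ⟨neg_nonpos.2 w2, by simpa [PlanarSystem.turn] using w1⟩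
      · rw [hw, show 2 * r + 1 = 4 * (α + j) + 1 by omega, iterate_turn_four_mul]
        exact ⟨w2, neg_nonpos.2 w1⟩
    · simp only [sub_self]
      rw [hz.start, hδe s ⟨l1.trans hs.1, hs.2.trans l3⟩]
    · obtain ⟨σ, hσ, h⟩ := hz.exists_pos
      exact ⟨σ + P.t i, ⟨by linarith [hσ.1], by linarith [hσ.2]⟩, by simpa using h⟩
    · obtain ⟨σ, hσ, h⟩ := hz.exists_neg
      exact ⟨σ + P.t i, ⟨by linarith [hσ.1], by linarith [hσ.2]⟩, by simpa using h⟩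
  -- A path in the third quadrant is reflected at the origin.
  · have hneg : ∀ p, S.energy (-p) = S.rot.rot.energy p := fun p => by
      rw [← PlanarSystem.energy_turn, ← PlanarSystem.energy_turn, PlanarSystem.turn_turn]
    have hneg' : ∀ p, S.rot.rot.energy (-p) = S.energy p := fun p => by
      rw [← hneg, neg_neg]
    obtain ⟨T1, T2⟩ := hmono S.rot.rot (tw S.rot.rot (Or.inr ⟨rfl, rfl⟩))
    obtain ⟨a', b', η, l1, l2, l3, hη, hηa, hηb, hz⟩ :=
      S.rot.rot.exists_stretched_subpath hr1 hδc.neg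
      (fun s => neg_nonneg.2 (hδb s).2.2.1) (fun s => neg_nonneg.2 (hδb s).2.2.2)
      (fun s => by rw [Pi.neg_apply, hneg']; exact hc₁.trans_le (hδb s).1) hab
      (by rw [Pi.neg_apply, hneg', hSa]; exact T1) (by rw [Pi.neg_apply, hneg', hSb]; exact T2)
    refine ⟨a', b', -η, l1, l2, l3, hη.neg, by simpa using hηa, by simpa using hηb,
      fun s hs => ?_⟩
    obtain ⟨z, hz⟩ := hz s hs
    have hen : ∀ σ ∈ Icc 0 (P.s i - P.t i), S.energy ((-z) σ) ≤ c₂ i := fun σ hσ => by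
      rw [Pi.neg_apply, hneg, hz.energy_eq σ hσ, Pi.neg_apply, hneg']
      exact (hδb s).2.1
    have hend : S.energy ((-η) s) = S.energy (δ' s) := by
      rw [Pi.neg_apply, hneg, ← hz.finish, hz.energy_eq _ ⟨by linarith, le_rfl⟩, Pi.neg_apply,
        hneg']
    obtain ⟨E, hE, hd⟩ := hz.hasDerivAt
    refine ⟨hg.mem_block_iff.2 ⟨hend ▸ (hδb s).1, hend ▸ (hδb s).2.1, ?_⟩,
      fun t => (-z) (t - P.t i),
      hg.solutionOn hz.continuous.neg hen ⟨E, hE, fun σ hσ hne => ?_⟩, ?_, ?_,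
      hcount (-z) (by simpa using hz.zeros_fst) (by simpa using hz.zeros_snd), ?_, ?_⟩
    · obtain ⟨w, w1, w2, hw⟩ := hz.quadrant
      rw [Pi.neg_apply]
      rcases hr with ⟨rfl, hr⟩ | ⟨rfl, hr⟩
      · rw [hw, show 2 * r + 1 = 4 * (α + j - 1) + 3 by omega, iterate_turn_four_mul]
        exact ⟨by simpa [PlanarSystem.turn] using w2, by simpa [PlanarSystem.turn] using w1⟩
      · rw [hw, show 2 * r + 1 = 4 * (α + j) + 1 by omega, iterate_turn_four_mul]
        exact ⟨neg_nonpos.2 w2, by simpa [PlanarSystem.turn] using w1⟩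
    · obtain ⟨d1, d2⟩ := hd σ hσ hne
      have e1 : -S.rot.rot.h (z σ).2 = S.h (-(z σ).2) := by
        simp [PlanarSystem.rot, Force.reflect_apply]
      have e2 : -(-S.rot.rot.f (z σ).1) = -S.f (-(z σ).1) := by
        simp [PlanarSystem.rot, Force.reflect_apply]
      exact ⟨e1 ▸ d1.fun_neg, e2 ▸ d2.fun_neg⟩
    · simp only [sub_self, Pi.neg_apply]
      rw [hz.start, Pi.neg_apply, neg_neg, hδe s ⟨l1.trans hs.1, hs.2.trans l3⟩]
    · simp only [Pi.neg_apply]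
      rw [hz.finish]
    · obtain ⟨σ, hσ, h⟩ := hz.exists_neg
      exact ⟨σ + P.t i, ⟨by linarith [hσ.1], by linarith [hσ.2]⟩, by simpa using h⟩
    · obtain ⟨σ, hσ, h⟩ := hz.exists_pos
      exact ⟨σ + P.t i, ⟨by linarith [hσ.1], by linarith [hσ.2]⟩, by simpa using h⟩

end StepProblem

/-! ### Solutions on the intervals where the weight vanishes -/

namespace Force

variable {h f₁ f₂ : Force}

/-- Above the height `h.inv e` the energy bound `c` confines the abscissa on the left. -/
lemma neg_inv_reflect_le {e c x y : ℝ} (he : 0 ≤ e) (hx : x ≤ 0)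
    (hy : h.inv e ≤ y) (hE : h.pot y + f₁.pot x ≤ c) : -f₁.reflect.inv (c - e) ≤ x := by
  have h1 := h.pot_le_of_nonneg (h.inv_nonneg he) hy
  rw [h.pot_inv he] at h1
  have h2 : f₁.reflect.inv (f₁.reflect.pot (-x)) ≤ f₁.reflect.inv (c - e) :=
    f₁.reflect.strictMono_inv.monotone (by rw [pot_reflect, neg_neg]; linarith)
  rw [inv_pot _ (neg_nonneg.2 hx)] at h2
  linarith

/-- Above the height `h.inv e` the energy bound `c` confines the abscissa on the right. -/
lemma le_inv {e c x y : ℝ} (he : 0 ≤ e) (hx : 0 ≤ x)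
    (hy : h.inv e ≤ y) (hE : h.pot y + f₁.pot x ≤ c) : x ≤ f₁.inv (c - e) := by
  have h1 := h.pot_le_of_nonneg (h.inv_nonneg he) hy
  rw [h.pot_inv he] at h1
  rw [← f₁.inv_pot hx]
  exact f₁.strictMono_inv.monotone (by linarith)

lemma inv_le_of_le_pot {e y : ℝ} (hy : 0 ≤ y) (h1 : e ≤ h.pot y) : h.inv e ≤ y := by
  rw [← h.inv_pot hy]
  exact h.strictMono_inv.monotone h1

variable {c₁ c₂ c₁' c₂' ς : ℝ}

/-- A horizontal drift during a sufficiently long time takes the second quadrant of one annulus to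
the first quadrant of the next one only if it starts strictly on the left of the `y`-axis, away from
the `x`-axis, and ends strictly on the right. -/
lemma drift_strict (hmono : Monotone h) (hc₁ : 0 < c₁) (hc : c₁ < c₂) (hc₁' : 0 < c₁')
    (hc' : c₁' < c₂') (hς : 0 ≤ ς)
    (htime : f₂.inv (c₂' - min c₁ c₁') + f₁.reflect.inv (c₂ - min c₁ c₁') ≤
      ς * h (h.inv (min c₁ c₁'))) {x y : ℝ} (hx : x ≤ 0) (hy : 0 ≤ y)
    (hE : c₁ ≤ h.pot y + f₁.pot x) (hE' : h.pot y + f₁.pot x ≤ c₂)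
    (hu : 0 ≤ x + ς * h y) (hD : c₁' ≤ h.pot y + f₂.pot (x + ς * h y))
    (hD' : h.pot y + f₂.pot (x + ς * h y) ≤ c₂') : x < 0 ∧ 0 < y ∧ 0 < x + ς * h y := by
  set e := min c₁ c₁' with he
  have he0 : 0 < e := lt_min hc₁ hc₁'
  have hec : e < c₂ := (min_le_left _ _).trans_lt hc
  have hec' : e < c₂' := (min_le_right _ _).trans_lt hc'
  have hxr : 0 < f₂.inv (c₂' - e) := f₂.inv_pos (sub_pos.2 hec')
  have hxl : 0 < f₁.reflect.inv (c₂ - e) := f₁.reflect.inv_pos (sub_pos.2 hec)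
  have hh : h.inv e ≤ y → ς * h (h.inv e) ≤ ς * h y := fun hle =>
    mul_le_mul_of_nonneg_left (hmono hle) hς
  refine ⟨hx.lt_of_ne ?_, hy.lt_of_ne ?_, hu.lt_of_ne ?_⟩
  · rintro rfl
    rw [pot_zero, add_zero] at hE
    have hle := inv_le_of_le_pot hy ((min_le_left c₁ c₁').trans hE)
    have h1 := le_inv (c := c₂') he0.le hu hle hD'
    linarith [hh hle]
  · rintro rfl
    rw [apply_zero, mul_zero, add_zero] at hu
    obtain rfl : x = 0 := le_antisymm hx hu
    rw [pot_zero, pot_zero, add_zero] at hE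
    exact hE.not_gt hc₁
  · intro hu0
    rw [← hu0, pot_zero, add_zero] at hD
    have hle := inv_le_of_le_pot hy ((min_le_right c₁ c₁').trans hD)
    have h1 := neg_inv_reflect_le (c := c₂) he0.le hx hle hE'
    linarith [hh hle]

/-- A path crossing the second quadrant of an annulus from the `x`-axis to the `y`-axis has a subpath
that is taken, by a horizontal drift during a sufficiently long time, to a path crossing the first
quadrant of the next annulus from the inner to the outer boundary. -/
lemma exists_drift_subpath (hmono : Monotone h) (hc₁ : 0 < c₁) (hc : c₁ < c₂) (hc₁' : 0 < c₁')
    (hc' : c₁' < c₂') (hς : 0 ≤ ς)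
    (htime : f₂.inv (c₂' - min c₁ c₁') + f₁.reflect.inv (c₂ - min c₁ c₁') ≤
      ς * h (h.inv (min c₁ c₁'))) {x y : ℝ → ℝ} (hxc : Continuous x) (hyc : Continuous y)
    {a b : ℝ} (hab : a ≤ b)
    (hxy : ∀ s ∈ Icc a b, x s ≤ 0 ∧ 0 ≤ y s ∧ c₁ ≤ h.pot (y s) + f₁.pot (x s) ∧
      h.pot (y s) + f₁.pot (x s) ≤ c₂) (hya : y a = 0) (hxb : x b = 0) :
    ∃ a' b', a ≤ a' ∧ a' ≤ b' ∧ b' ≤ b ∧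
      h.pot (y a') + f₂.pot (x a' + ς * h (y a')) = c₁' ∧
      h.pot (y b') + f₂.pot (x b' + ς * h (y b')) = c₂' ∧
      ∀ s ∈ Icc a' b', 0 ≤ x s + ς * h (y s) ∧
        c₁' ≤ h.pot (y s) + f₂.pot (x s + ς * h (y s)) ∧
        h.pot (y s) + f₂.pot (x s + ς * h (y s)) ≤ c₂' := by
  set e := min c₁ c₁' with he
  have he0 : 0 < e := lt_min hc₁ hc₁'
  have hec : e < c₂ := (min_le_left _ _).trans_lt hc
  have hec' : e < c₂' := (min_le_right _ _).trans_lt hc'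
  have hxr : 0 < f₂.inv (c₂' - e) := f₂.inv_pos (sub_pos.2 hec')
  have hxl : 0 < f₁.reflect.inv (c₂ - e) := f₁.reflect.inv_pos (sub_pos.2 hec)
  have hh : ∀ y, h.inv e ≤ y → ς * h (h.inv e) ≤ ς * h y := fun y hle =>
    mul_le_mul_of_nonneg_left (hmono hle) hς
  have hu : Continuous fun s => x s + ς * h (y s) :=
    hxc.add (continuous_const.mul (h.continuous.comp hyc))
  have hE : Continuous fun s => h.pot (y s) + f₂.pot (x s + ς * h (y s)) :=
    (h.continuous_pot.comp hyc).add (f₂.continuous_pot.comp hu)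
  obtain ⟨-, ybn, hEb, -⟩ := hxy b (right_mem_Icc.2 hab)
  rw [hxb, pot_zero, add_zero] at hEb
  have hleb : h.inv e ≤ y b := inv_le_of_le_pot ybn ((min_le_left _ _).trans hEb)
  have hub : f₂.inv (c₂' - e) ≤ x b + ς * h (y b) := by
    rw [hxb]
    linarith [hh _ hleb]
  -- `s₀` is the last time at which the drifted path meets the `y`-axis.
  obtain ⟨s₀, hs₀, hu0, hunn⟩ := exists_last_zero hu hab
    (by
      rw [hya, apply_zero, mul_zero, add_zero]
      exact (hxy a (left_mem_Icc.2 hab)).1) (hxr.le.trans hub)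
  have hstart : h.pot (y s₀) ≤ c₁' := by
    by_contra! hlt
    obtain ⟨xs, ys, -, hE2⟩ := hxy s₀ hs₀
    have hle := inv_le_of_le_pot ys ((min_le_right c₁ c₁').trans hlt.le)
    have h1 := neg_inv_reflect_le (c := c₂) he0.le xs hle hE2
    linarith [hh _ hle]
  have hend : c₂' ≤ h.pot (y b) + f₂.pot (x b + ς * h (y b)) := by
    have h1 := f₂.pot_le_of_nonneg hxr.le hub
    have h2 := h.pot_le_of_nonneg (h.inv_nonneg he0.le) hleb
    rw [f₂.pot_inv (sub_pos.2 hec').le] at h1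
    rw [h.pot_inv he0.le] at h2
    linarith
  obtain ⟨a', b', l1, l2, l3, ha', hb', hab'⟩ := exists_crossing_subpath
    (f := fun s => h.pot (y s) + f₂.pot (x s + ς * h (y s)) - c₁')
    (g := fun s => h.pot (y s) + f₂.pot (x s + ς * h (y s)) - c₂')
    (hE.sub continuous_const) (hE.sub continuous_const) hs₀.2
    (fun t _ => by linarith)
    (by
      simp only [hu0, pot_zero, add_zero]
      linarith) (by linarith)
  refine ⟨a', b', hs₀.1.trans l1, l2, l3, by linarith, by linarith, fun s hs => ?_⟩
  obtain ⟨k1, k2⟩ := hab' s hs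
  exact ⟨hunn s ⟨l1.trans hs.1, hs.2.trans l3⟩, by linarith, by linarith⟩

end Force

namespace StepProblem

variable {m : ℕ} (P : StepProblem m)

/-- The behaviour of the zeros of `z` on the `i`-th interval where the weight vanishes. -/
def DriftCount (i : Fin m) (z : ℝ → ℝ × ℝ) : Prop :=
  {τ ∈ Ioo (P.s i.castSucc) (P.t i.succ) | (z τ).1 = 0}.encard = 1 ∧
    {τ ∈ Icc (P.s i.castSucc) (P.t i.succ) | (z τ).1 = 0}.encard = 1 ∧
    ∀ τ ∈ Icc (P.s i.castSucc) (P.t i.succ), (z τ).2 ≠ 0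

/-- The solution through `p` on an interval where the weight vanishes. -/
noncomputable def drift (i : Fin m) (p : ℝ × ℝ) (t : ℝ) : ℝ × ℝ :=
  (p.1 + (t - P.s i.castSucc) * P.h p.2, p.2)

lemma solutionOn_drift (i : Fin m) {p : ℝ × ℝ} (hp : p.2 ∈ P.J) :
    P.SolutionOn (P.s i.castSucc) (P.t i.succ) (P.drift i p) where
  lipschitz := by
    refine LipschitzOnWith.exists_prodMk ⟨(|P.h p.2|).toNNReal,
      LipschitzOnWith.of_dist_le_mul fun x _ y _ => ?_⟩ ⟨0, ?_⟩
    · simp only [drift, Real.dist_eq, Real.coe_toNNReal _ (abs_nonneg _)]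
      rw [← abs_mul]
      apply le_of_eq
      congr 1
      ring
    · exact (LipschitzWith.const p.2).lipschitzOnWith
  mem_J _ _ := hp
  hasDerivAt := by
    refine ⟨∅, finite_empty, fun t ht _ => ⟨?_, ?_⟩⟩
    · have := (((hasDerivAt_id t).sub_const (P.s i.castSucc)).mul_const (P.h p.2)).const_add p.1
      rw [one_mul] at this
      exact this
    · rw [P.a_eq_zero i t ht, zero_mul, neg_zero]
      exact hasDerivAt_const t p.2

lemma driftCount_drift (i : Fin m) {p : ℝ × ℝ} (hy : p.2 ≠ 0)
    (hx : p.1 * (p.1 + (P.t i.succ - P.s i.castSucc) * P.h p.2) < 0) :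
    P.DriftCount i (P.drift i p) := by
  set k := P.h p.2
  set σ := P.s i.castSucc
  have hk : k ≠ 0 := by
    intro hk
    rw [hk, mul_zero, add_zero] at hx
    exact (mul_self_nonneg p.1).not_gt hx
  have hς := sub_pos.2 (P.s_lt_t i)
  have hmul : -p.1 / k * k = -p.1 := div_mul_cancel₀ _ hk
  have hk2 : 0 < k ^ 2 := by positivity
  set w := -p.1 / k
  have hp : p.1 = -(w * k) := by linarith
  have hw : 0 < w * ((P.t i.succ - σ) - w) := by
    rw [hp] at hx
    by_contra! hle
    nlinarith [mul_nonneg_of_nonpos_of_nonpos hle (neg_nonpos.2 hk2.le)]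
  have hw0 : 0 < w := by
    by_contra! hle
    nlinarith
  have hw1 : w < P.t i.succ - σ := by
    by_contra! hle
    nlinarith
  have hz : ∀ τ, (P.drift i p τ).1 = 0 ↔ τ = σ + w := fun τ => by
    have : (P.drift i p τ).1 = (τ - σ - w) * k := by
      change p.1 + (τ - σ) * k = _
      rw [hp]
      ring
    rw [this, mul_eq_zero, or_iff_left hk]
    constructor <;> intro h' <;> linarith
  refine ⟨?_, ?_, fun τ _ => hy⟩
  · rw [encard_eq_one]
    refine ⟨σ + w, ?_⟩
    ext τ
    simp only [mem_ofPred_eq, hz, mem_singleton_iff, and_iff_right_iff_imp]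
    rintro rfl
    exact ⟨by linarith, by linarith⟩
  · rw [encard_eq_one]
    refine ⟨σ + w, ?_⟩
    ext τ
    simp only [mem_ofPred_eq, hz, mem_singleton_iff, and_iff_right_iff_imp]
    rintro rfl
    exact ⟨by linarith, by linarith⟩

variable {P} {c₁ c₂ : Fin (m + 1) → ℝ} {h g : Force}

/-- The force on the `i`-th interval where the weight is positive. -/
def force (P : StepProblem m) (g : Force) (i : Fin (m + 1)) : Force := g.smul (P.μ i) (P.μ_pos i)

lemma IsGlobal.mem_block_iff' (hg : P.IsGlobal c₂ h g) {i : Fin (m + 1)} {q : Quadrant}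
    {p : ℝ × ℝ} : p ∈ P.block c₁ c₂ i q ↔ c₁ i ≤ h.pot p.2 + (P.force g i).pot p.1 ∧
      h.pot p.2 + (P.force g i).pot p.1 ≤ c₂ i ∧ p ∈ q.carrier :=
  hg.mem_block_iff

lemma IsGlobal.GposInv_eq_force (hg : P.IsGlobal c₂ h g) (i : Fin (m + 1)) {c : ℝ} (h0 : 0 ≤ c)
    (hc : c ≤ c₂ i) : P.GposInv ((P.μ i)⁻¹ * c) = (P.force g i).inv c := by
  rw [inv_mul_eq_div, hg.GposInv_eq i h0 hc, force, g.inv_smul _ h0]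

lemma force_reflect (P : StepProblem m) (g : Force) (i : Fin (m + 1)) :
    P.force g.reflect i = (P.force g i).reflect := by
  simp [force, Force.smul, Force.reflect]

lemma IsGlobal.GnegInv_eq_force (hg : P.IsGlobal c₂ h g) (i : Fin (m + 1)) {c : ℝ} (h0 : 0 ≤ c)
    (hc : c ≤ c₂ i) : P.GnegInv ((P.μ i)⁻¹ * c) = -(P.force g i).reflect.inv c := by
  rw [inv_mul_eq_div, hg.GnegInv_eq i h0 hc, ← force_reflect, force, g.reflect.inv_smul _ h0]

lemma IsGlobal.upper_time (hg : P.IsGlobal c₂ h g) (hc : ∀ i, 0 < c₁ i ∧ c₁ i < c₂ i) {i : Fin m}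
    {ς : ℝ} (hς : P.transUpper c₁ c₂ i ≤ ς) :
    (P.force g i.succ).inv (c₂ i.succ - min (c₁ i.castSucc) (c₁ i.succ)) +
      (P.force g i.castSucc).reflect.inv (c₂ i.castSucc - min (c₁ i.castSucc) (c₁ i.succ)) ≤
      ς * h (h.inv (min (c₁ i.castSucc) (c₁ i.succ))) := by
  have hy : P.yplus c₁ i = h.inv (min (c₁ i.castSucc) (c₁ i.succ)) := by
    rw [yplus, hg.HposInv_eq i.castSucc (hc _).1.le (hc _).2.le,
      hg.HposInv_eq i.succ (hc _).1.le (hc _).2.le, h.strictMono_inv.monotone.map_min]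
  have he : 0 < min (c₁ i.castSucc) (c₁ i.succ) := lt_min (hc _).1 (hc _).1
  have l1 := (min_le_left (c₁ i.castSucc) (c₁ i.succ)).trans (hc _).2.le
  have l2 := (min_le_right (c₁ i.castSucc) (c₁ i.succ)).trans (hc _).2.le
  obtain ⟨-, e1, e2⟩ := (hg.extends_h i.castSucc).of_pot_le
    (h.inv (min (c₁ i.castSucc) (c₁ i.succ))) (by rwa [h.pot_inv he.le])
  have hH : P.H (P.yplus c₁ i) = min (c₁ i.castSucc) (c₁ i.succ) := by
    rw [hy]
    exact e2.symm.trans (h.pot_inv he.le)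
  rw [transUpper, hH, hg.GposInv_eq_force _ (by linarith) (by linarith),
    hg.GnegInv_eq_force _ (by linarith) (by linarith), hy, ← e1, sub_neg_eq_add,
    div_le_iff₀ (h.pos _ (h.inv_pos he))] at hς
  exact hς

lemma IsGlobal.lower_time (hg : P.IsGlobal c₂ h g) (hc : ∀ i, 0 < c₁ i ∧ c₁ i < c₂ i) {i : Fin m}
    {ς : ℝ} (hς : P.transLower c₁ c₂ i ≤ ς) :
    (P.force g i.succ).reflect.inv (c₂ i.succ - min (c₁ i.castSucc) (c₁ i.succ)) +
      (P.force g i.castSucc).reflect.reflect.inv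
        (c₂ i.castSucc - min (c₁ i.castSucc) (c₁ i.succ)) ≤
      ς * h.reflect (h.reflect.inv (min (c₁ i.castSucc) (c₁ i.succ))) := by
  have hy : P.yminus c₁ i = -h.reflect.inv (min (c₁ i.castSucc) (c₁ i.succ)) := by
    rw [yminus, hg.HnegInv_eq i.castSucc (hc _).1.le (hc _).2.le,
      hg.HnegInv_eq i.succ (hc _).1.le (hc _).2.le, h.reflect.strictMono_inv.monotone.map_min,
      max_neg_neg]
  have he : 0 < min (c₁ i.castSucc) (c₁ i.succ) := lt_min (hc _).1 (hc _).1
  have l1 := (min_le_left (c₁ i.castSucc) (c₁ i.succ)).trans (hc _).2.le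
  have l2 := (min_le_right (c₁ i.castSucc) (c₁ i.succ)).trans (hc _).2.le
  have hp := h.reflect.pot_inv he.le
  rw [Force.pot_reflect] at hp
  obtain ⟨-, e1, e2⟩ := (hg.extends_h i.castSucc).of_pot_le
    (-h.reflect.inv (min (c₁ i.castSucc) (c₁ i.succ))) (by rwa [hp])
  have hH : P.H (P.yminus c₁ i) = min (c₁ i.castSucc) (c₁ i.succ) := by
    rw [hy]
    exact e2.symm.trans hp
  rw [transLower, hH, hg.GposInv_eq_force _ (by linarith) (by linarith),
    hg.GnegInv_eq_force _ (by linarith) (by linarith), hy, ← e1, sub_neg_eq_add,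
    ← Force.reflect_apply, div_le_iff₀ (h.reflect.pos _ (h.reflect.inv_pos he)), add_comm] at hς
  rwa [Force.reflect_reflect]

/-- The stretching property on an interval where the weight vanishes: a path that crosses the block
of the quadrant `q` from the `x`-axis to the `y`-axis has a subpath that is mapped to a path joining
the two boundaries of the next annulus inside the block of the quadrant `κ`. -/
theorem IsGlobal.exists_degenerate_subpath (hg : P.IsGlobal c₂ h g)
    (hc : ∀ i, 0 < c₁ i ∧ c₁ i < c₂ i) {i : Fin m}
    (hupper : P.transUpper c₁ c₂ i ≤ P.t i.succ - P.s i.castSucc)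
    (hlower : P.transLower c₁ c₂ i ≤ P.t i.succ - P.s i.castSucc) {q κ : Quadrant}
    (hqκ : (q = .II ∧ κ = .I) ∨ (q = .IV ∧ κ = .III)) {η : ℝ → ℝ × ℝ} (hη : Continuous η)
    {a b : ℝ} (hab : a ≤ b) (hblock : ∀ s ∈ Icc a b, η s ∈ P.block c₁ c₂ i.castSucc q)
    (ha : (η a).2 = 0) (hb : (η b).1 = 0) :
    ∃ a' b' : ℝ, ∃ δ : ℝ → ℝ × ℝ, a ≤ a' ∧ a' ≤ b' ∧ b' ≤ b ∧ Continuous δ ∧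
      P.energy i.succ (δ a') = c₁ i.succ ∧ P.energy i.succ (δ b') = c₂ i.succ ∧
      ∀ s ∈ Icc a' b', δ s ∈ P.block c₁ c₂ i.succ κ ∧
        ∃ z, P.SolutionOn (P.s i.castSucc) (P.t i.succ) z ∧ z (P.s i.castSucc) = η s ∧
          z (P.t i.succ) = δ s ∧ P.DriftCount i z := by
  set ς := P.t i.succ - P.s i.castSucc with hς
  have hς0 : 0 < ς := sub_pos.2 (P.s_lt_t i)
  have hx := continuous_fst.comp hη
  have hy := continuous_snd.comp hη
  set δ : ℝ → ℝ × ℝ := fun s => ((η s).1 + ς * h (η s).2, (η s).2) with hδ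
  have hδc : Continuous δ :=
    (hx.add (continuous_const.mul (h.continuous.comp hy))).prodMk hy
  have hmem := fun s hs => hg.mem_block_iff'.1 (hblock s hs)
  have hh : ∀ s ∈ Icc a b, (η s).2 ∈ P.J ∧ h (η s).2 = P.h (η s).2 := fun s hs =>
    ⟨(hblock s hs).1, (hg.of_energy_system_le (hg.mem_block_iff.1 (hblock s hs)).2.1).2.1⟩
  have hfin : ∀ s ∈ Icc a b, P.drift i (η s) (P.s i.castSucc) = η s ∧
      P.drift i (η s) (P.t i.succ) = δ s := fun s hs => by
    simp only [drift, hδ, (hh s hs).2, sub_self, zero_mul, add_zero, ← hς, and_self]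
  have hbl : ∀ s, δ s ∈ P.block c₁ c₂ i.succ κ →
      h.pot (δ s).2 + (P.force g i.succ).pot (δ s).1 = P.energy i.succ (δ s) := fun s hs =>
    hg.energy_system_eq hs.1 hs.2.2.1
  rcases hqκ with ⟨rfl, rfl⟩ | ⟨rfl, rfl⟩
  · have htime := hg.upper_time hc hupper
    obtain ⟨a', b', l1, l2, l3, ea, eb, hs'⟩ := Force.exists_drift_subpath hg.monotone
      (hc _).1 (hc _).2 (hc _).1 (hc _).2 hς0.le htime hx hy hab
      (fun s hs => ⟨(hmem s hs).2.2.1, (hmem s hs).2.2.2, (hmem s hs).1, (hmem s hs).2.1⟩) ha hb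
    have hδb : ∀ s ∈ Icc a' b', δ s ∈ P.block c₁ c₂ i.succ .I := fun s hs =>
      hg.mem_block_iff'.2 ⟨(hs' s hs).2.1, (hs' s hs).2.2, (hs' s hs).1,
        (hmem s ⟨l1.trans hs.1, hs.2.trans l3⟩).2.2.2⟩
    refine ⟨a', b', δ, l1, l2, l3, hδc, (hbl a' (hδb a' ⟨le_rfl, l2⟩)).symm.trans ea,
      (hbl b' (hδb b' ⟨l2, le_rfl⟩)).symm.trans eb, fun s hs => ⟨hδb s hs, P.drift i (η s), ?_⟩⟩
    have hsI : s ∈ Icc a b := ⟨l1.trans hs.1, hs.2.trans l3⟩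
    obtain ⟨n1, n2, n3⟩ := Force.drift_strict hg.monotone (hc _).1 (hc _).2 (hc _).1 (hc _).2
      hς0.le htime (hmem s hsI).2.2.1 (hmem s hsI).2.2.2 (hmem s hsI).1 (hmem s hsI).2.1
      (hs' s hs).1 (hs' s hs).2.1 (hs' s hs).2.2
    refine ⟨P.solutionOn_drift i (hh s hsI).1, (hfin s hsI).1, (hfin s hsI).2,
      P.driftCount_drift i n2.ne' ?_⟩
    rw [← (hh s hsI).2]
    exact mul_neg_of_neg_of_pos n1 n3
  -- The passage from the fourth to the third quadrant is reflected at the origin.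
  · have htime := hg.lower_time hc hlower
    have hmono : Monotone h.reflect := fun u v huv =>
      neg_le_neg (hg.monotone (neg_le_neg huv))
    have hE : ∀ (k : Fin (m + 1)) (p : ℝ × ℝ), h.reflect.pot (-p.2) +
        (P.force g k).reflect.pot (-p.1) = h.pot p.2 + (P.force g k).pot p.1 := fun k p => by
      simp only [Force.pot_reflect, neg_neg]
    have hD : ∀ s, -(η s).1 + ς * h.reflect (-(η s).2) = -(δ s).1 := fun s => by
      simp only [hδ, Force.reflect_apply, neg_neg]
      ring
    obtain ⟨a', b', l1, l2, l3, ea, eb, hs'⟩ := Force.exists_drift_subpath hmono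
      (hc _).1 (hc _).2 (hc _).1 (hc _).2 hς0.le htime hx.neg hy.neg hab
      (fun s hs => ⟨neg_nonpos.2 (hmem s hs).2.2.1, neg_nonneg.2 (hmem s hs).2.2.2,
        (hmem s hs).1.trans_eq (hE _ _).symm, (hE _ _).trans_le (hmem s hs).2.1⟩)
      (neg_eq_zero.2 ha) (neg_eq_zero.2 hb)
    simp only [Pi.neg_apply, Function.comp_apply, hD] at ea eb hs'
    have hδ2 : ∀ s, (η s).2 = (δ s).2 := fun s => rfl
    simp only [hδ2, hE] at ea eb hs'
    have hδb : ∀ s ∈ Icc a' b', δ s ∈ P.block c₁ c₂ i.succ .III := fun s hs =>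
      hg.mem_block_iff'.2 ⟨(hs' s hs).2.1, (hs' s hs).2.2, neg_nonneg.1 (hs' s hs).1,
        (hmem s ⟨l1.trans hs.1, hs.2.trans l3⟩).2.2.2⟩
    refine ⟨a', b', δ, l1, l2, l3, hδc, (hbl a' (hδb a' ⟨le_rfl, l2⟩)).symm.trans ea,
      (hbl b' (hδb b' ⟨l2, le_rfl⟩)).symm.trans eb, fun s hs => ⟨hδb s hs, P.drift i (η s), ?_⟩⟩
    have hsI : s ∈ Icc a b := ⟨l1.trans hs.1, hs.2.trans l3⟩
    obtain ⟨n1, n2, n3⟩ := Force.drift_strict hmono (hc _).1 (hc _).2 (hc _).1 (hc _).2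
      hς0.le htime (neg_nonpos.2 (hmem s hsI).2.2.1) (neg_nonneg.2 (hmem s hsI).2.2.2)
      ((hmem s hsI).1.trans_eq (hE _ _).symm) ((hE _ _).trans_le (hmem s hsI).2.1)
      (by rw [hD]; exact (hs' s hs).1)
      (by rw [hD, hδ2, hE]; exact (hs' s hs).2.1) (by rw [hD, hδ2, hE]; exact (hs' s hs).2.2)
    rw [hD] at n3
    refine ⟨P.solutionOn_drift i (hh s hsI).1, (hfin s hsI).1, (hfin s hsI).2,
      P.driftCount_drift i (neg_pos.1 n2).ne ?_⟩
    rw [← (hh s hsI).2]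
    exact mul_neg_of_pos_of_neg (neg_neg_iff_pos.1 n1) (neg_pos.1 n3)

end StepProblem

/-! ### Following an itinerary -/

lemma Force.eq_of_pot_eq (f : Force) {x y : ℝ} (hxy : (0 ≤ x ∧ 0 ≤ y) ∨ (x ≤ 0 ∧ y ≤ 0))
    (h : f.pot x = f.pot y) : x = y := by
  rcases hxy with ⟨hx, hy⟩ | ⟨hx, hy⟩
  · exact f.strictMonoOn_pot.injOn hx hy h
  · exact f.strictAntiOn_pot.injOn hx hy h

namespace StepProblem

variable {m : ℕ} {P : StepProblem m} {c₁ c₂ : Fin (m + 1) → ℝ} {h g : Force}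

lemma strictMono_t (P : StepProblem m) : StrictMono P.t :=
  Fin.strictMono_iff_lt_succ.2 fun i => (P.t_lt_s _).trans (P.s_lt_t i)

lemma s_le_t (P : StepProblem m) {k i : Fin (m + 1)} (hki : k < i) : P.s k ≤ P.t i := by
  obtain ⟨k', rfl⟩ := Fin.exists_castSucc_eq.2 (ne_of_lt (hki.trans_le (Fin.le_last i)))
  exact (P.s_lt_t k').le.trans (P.strictMono_t.monotone (Fin.castSucc_lt_iff_succ_le.1 hki))

lemma t_nonneg (P : StepProblem m) (i : Fin (m + 1)) : 0 ≤ P.t i :=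
  P.t_zero ▸ P.strictMono_t.monotone (Fin.zero_le i)

/-- Inside a block, a path from the `x`-axis to the `y`-axis meets every arc that joins the two
boundaries of the annulus. -/
lemma IsGlobal.exists_mem_arc (hg : P.IsGlobal c₂ h g) {i : Fin (m + 1)} (hc : 0 < c₁ i)
    {q : Quadrant} {r : Set (ℝ × ℝ)} (hr : P.IsBoundaryArc c₁ c₂ i q r) {η : ℝ → ℝ × ℝ}
    (hη : Continuous η) {a b : ℝ} (hab : a ≤ b)
    (hblock : ∀ s ∈ Icc a b, η s ∈ P.block c₁ c₂ i q) (ha : (η a).2 = 0) (hb : (η b).1 = 0) :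
    ∃ s ∈ Icc a b, η s ∈ r := by
  obtain ⟨hrb, γ, -, rfl, h0, h1⟩ := hr
  set Γ : ℝ → ℝ × ℝ := fun t => γ (projIcc 0 1 zero_le_one t) with hΓ
  have hΓc : Continuous Γ := γ.continuous.comp continuous_projIcc
  have hΓb := fun t => hg.mem_block_iff'.1 (hrb (mem_range_self (projIcc 0 1 zero_le_one t)))
  have hηb := fun s hs => hg.mem_block_iff'.1 (hblock s hs)
  set f := P.force g i
  have hE : ∀ p ∈ P.block c₁ c₂ i q, h.pot p.2 + f.pot p.1 = P.energy i p := fun p hp =>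
    hg.energy_system_eq hp.1 hp.2.2.1
  have e0 : h.pot (Γ 0).2 + f.pot (Γ 0).1 = c₁ i := by
    rw [hE _ (hrb (mem_range_self _))]
    simpa using h0
  have e1 : h.pot (Γ 1).2 + f.pot (Γ 1).1 = c₂ i := by
    rw [hE _ (hrb (mem_range_self _))]
    simpa using h1
  have cη : Continuous fun p : ℝ × ℝ => η p.1 := hη.comp continuous_fst
  have cΓ : Continuous fun p : ℝ × ℝ => Γ p.2 := hΓc.comp continuous_snd
  have hHc : ∀ {ζ : ℝ × ℝ → ℝ × ℝ}, Continuous ζ → Continuous fun p => h.pot (ζ p).2 :=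
    fun hζ => h.continuous_pot.comp (continuous_snd.comp hζ)
  have hFc : ∀ {ζ : ℝ × ℝ → ℝ × ℝ}, Continuous ζ → Continuous fun p => f.pot (ζ p).1 :=
    fun hζ => f.continuous_pot.comp (continuous_fst.comp hζ)
  -- The first function compares the shares of kinetic energy, the second one the total energies.
  obtain ⟨s, hs, t, ht, hu, hv⟩ := exists_common_zero
    (u := fun p => h.pot (η p.1).2 * f.pot (Γ p.2).1 - h.pot (Γ p.2).2 * f.pot (η p.1).1)
    (v := fun p => h.pot (Γ p.2).2 + f.pot (Γ p.2).1 - (h.pot (η p.1).2 + f.pot (η p.1).1))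
    (((hHc cη).mul (hFc cΓ)).sub ((hHc cΓ).mul (hFc cη)))
    (((hHc cΓ).add (hFc cΓ)).sub ((hHc cη).add (hFc cη))) hab (zero_le_one (α := ℝ))
    (fun t _ => by
      simp only [ha, Force.pot_zero, zero_mul, zero_sub]
      exact neg_nonpos.2 (mul_nonneg (h.pot_nonneg _) (f.pot_nonneg _)))
    (fun t _ => by
      simp only [hb, Force.pot_zero, mul_zero, sub_zero]
      exact mul_nonneg (h.pot_nonneg _) (f.pot_nonneg _))
    (fun s hs => by
      simp only [e0]
      linarith [(hηb s hs).1])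
    (fun s hs => by
      simp only [e1]
      linarith [(hηb s hs).2.1])
  refine ⟨s, hs, projIcc 0 1 zero_le_one t, ?_⟩
  change Γ t = η s
  have hpos := hc.trans_le (hηb s hs).1
  have hF : f.pot (Γ t).1 = f.pot (η s).1 := by
    have hcalc : (h.pot (η s).2 + f.pot (η s).1) * (f.pot (Γ t).1 - f.pot (η s).1) = 0 := by
      linear_combination hu + f.pot (η s).1 * hv
    rcases mul_eq_zero.1 hcalc with h' | h'
    · exact absurd h' hpos.ne'
    · linarith
  have hH : h.pot (Γ t).2 = h.pot (η s).2 := by linarith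
  have q1 := (hΓb t).2.2
  have q2 := (hηb s hs).2.2
  have hsign : ((0 ≤ (Γ t).1 ∧ 0 ≤ (η s).1) ∨ ((Γ t).1 ≤ 0 ∧ (η s).1 ≤ 0)) ∧
      ((0 ≤ (Γ t).2 ∧ 0 ≤ (η s).2) ∨ ((Γ t).2 ≤ 0 ∧ (η s).2 ≤ 0)) := by
    cases q
    · exact ⟨Or.inl ⟨q1.1, q2.1⟩, Or.inl ⟨q1.2, q2.2⟩⟩
    · exact ⟨Or.inr ⟨q1.1, q2.1⟩, Or.inl ⟨q1.2, q2.2⟩⟩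
    · exact ⟨Or.inr ⟨q1.1, q2.1⟩, Or.inr ⟨q1.2, q2.2⟩⟩
    · exact ⟨Or.inl ⟨q1.1, q2.1⟩, Or.inr ⟨q1.2, q2.2⟩⟩
  exact Prod.ext (f.eq_of_pot_eq hsign.1 hF) (h.eq_of_pot_eq hsign.2 hH)

/-- What is required from a solution on the `i`-th interval where the weight is positive. -/
structure StageOK (P : StepProblem m) (c₁ c₂ : Fin (m + 1) → ℝ) (κ q : Fin (m + 1) → Quadrant)
    (n : Fin (m + 1) → ℕ) (i : Fin (m + 1)) (z : ℝ → ℝ × ℝ) : Prop where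
  at_t : z (P.t i) ∈ P.block c₁ c₂ i (κ i)
  at_s : z (P.s i) ∈ P.block c₁ c₂ i (q i)
  zeroCount : P.ZeroCount i (κ i) (q i) (n i) z
  exists_pos : ∃ τ ∈ Icc (P.t i) (P.s i), 0 < (z τ).1
  exists_neg : ∃ τ ∈ Icc (P.t i) (P.s i), (z τ).1 < 0

lemma sep_congr_of_eqOn {z z' : ℝ → ℝ × ℝ} {I : Set ℝ} (hz : EqOn z z' I) (φ : ℝ × ℝ → Prop) :
    {τ ∈ I | φ (z τ)} = {τ ∈ I | φ (z' τ)} := by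
  ext τ
  simp only [mem_ofPred_eq]
  exact and_congr_right fun hτ => by rw [hz hτ]

lemma ZeroCount.congr {i : Fin (m + 1)} {κ q : Quadrant} {n : ℕ} {z z' : ℝ → ℝ × ℝ}
    (hz : P.ZeroCount i κ q n z) (h : EqOn z z' (Icc (P.t i) (P.s i))) :
    P.ZeroCount i κ q n z' := by
  rw [ZeroCount, ← sep_congr_of_eqOn (h.mono Ioo_subset_Icc_self) fun p => p.1 = 0,
    ← sep_congr_of_eqOn h fun p => p.2 = 0]
  exact hz

lemma StageOK.congr {κ q : Fin (m + 1) → Quadrant} {n : Fin (m + 1) → ℕ} {i : Fin (m + 1)}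
    {z z' : ℝ → ℝ × ℝ} (hz : P.StageOK c₁ c₂ κ q n i z)
    (h : EqOn z z' (Icc (P.t i) (P.s i))) : P.StageOK c₁ c₂ κ q n i z' where
  at_t := h (left_mem_Icc.2 (P.t_lt_s i).le) ▸ hz.at_t
  at_s := h (right_mem_Icc.2 (P.t_lt_s i).le) ▸ hz.at_s
  zeroCount := hz.zeroCount.congr h
  exists_pos := by
    obtain ⟨τ, hτ, h'⟩ := hz.exists_pos
    exact ⟨τ, hτ, h hτ ▸ h'⟩
  exists_neg := by
    obtain ⟨τ, hτ, h'⟩ := hz.exists_neg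
    exact ⟨τ, hτ, h hτ ▸ h'⟩

lemma DriftCount.congr {i : Fin m} {z z' : ℝ → ℝ × ℝ} (hz : P.DriftCount i z)
    (h : EqOn z z' (Icc (P.s i.castSucc) (P.t i.succ))) : P.DriftCount i z' := by
  refine ⟨?_, ?_, fun τ hτ => h hτ ▸ hz.2.2 τ hτ⟩
  · rw [← sep_congr_of_eqOn (h.mono Ioo_subset_Icc_self) fun p => p.1 = 0]
    exact hz.1
  · rw [← sep_congr_of_eqOn h fun p => p.1 = 0]
    exact hz.2.1

/-- `z` is a solution on `[0, T]` from a point of `r₀` to `p` that obeys the requirements on the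
intervals of positive weight with an index in `A` and on the intervals of vanishing weight with an
index in `B`. -/
structure PartialSolution (P : StepProblem m) (c₁ c₂ : Fin (m + 1) → ℝ)
    (κ q : Fin (m + 1) → Quadrant) (n : Fin (m + 1) → ℕ) (r₀ : Set (ℝ × ℝ)) (T : ℝ)
    (A : Set (Fin (m + 1))) (B : Set (Fin m)) (p : ℝ × ℝ) (z : ℝ → ℝ × ℝ) : Prop where
  solutionOn : P.SolutionOn 0 T z
  init : z 0 ∈ r₀
  term : z T = p
  stage : ∀ k ∈ A, P.StageOK c₁ c₂ κ q n k z
  drift : ∀ k ∈ B, P.DriftCount k z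

lemma PartialSolution.extend {κ q : Fin (m + 1) → Quadrant} {n : Fin (m + 1) → ℕ}
    {r₀ : Set (ℝ × ℝ)} {T T' : ℝ} {A : Set (Fin (m + 1))} {B : Set (Fin m)} {p p' : ℝ × ℝ}
    {z w : ℝ → ℝ × ℝ} (hz : P.PartialSolution c₁ c₂ κ q n r₀ T A B p z)
    (hw : P.SolutionOn T T' w) (hwp : w T = p) (hwp' : w T' = p') (h0 : 0 ≤ T) (hT : T ≤ T')
    (hA : ∀ k ∈ A, P.s k ≤ T) (hB : ∀ k ∈ B, P.t k.succ ≤ T) :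
    ∃ z', P.PartialSolution c₁ c₂ κ q n r₀ T' A B p' z' ∧ EqOn w z' (Icc T T') := by
  have hl : EqOn z (fun t => if t ≤ T then z t else w t) (Iic T) := fun t ht => (if_pos ht).symm
  have hr : EqOn w (fun t => if t ≤ T then z t else w t) (Icc T T') := fun t ht => by
    rcases ht.1.eq_or_lt with rfl | hlt
    · simp only [le_refl, if_true]
      rw [hwp, hz.term]
    · exact (if_neg hlt.not_ge).symm
  refine ⟨_, ⟨hz.solutionOn.ite hw (hz.term.trans hwp.symm) h0 hT, ?_, ?_, fun k hk => ?_,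
    fun k hk => ?_⟩, hr⟩
  · rw [if_pos h0]
    exact hz.init
  · exact (hr (right_mem_Icc.2 hT)).symm.trans hwp'
  · exact (hz.stage k hk).congr (hl.mono fun t ht => ht.2.trans (hA k hk))
  · exact (hz.drift k hk).congr (hl.mono fun t ht => ht.2.trans (hB k hk))

/-- Every admissible itinerary and every admissible counter is realized by a solution. The path of
initial values is cut down step by step, so that all the remaining points follow the itinerary, and
its last image has to meet the target arc. -/
theorem IsGlobal.exists_solution (hg : P.IsGlobal c₂ h g) (hc : ∀ i, 0 < c₁ i ∧ c₁ i < c₂ i)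
    {r₀ rL : Set (ℝ × ℝ)} {κ q : Fin (m + 1) → Quadrant}
    (hr₀ : P.IsBoundaryArc c₁ c₂ 0 (κ 0) r₀)
    (hrL : P.IsBoundaryArc c₁ c₂ (Fin.last m) (q (Fin.last m)) rL)
    {α β : Fin (m + 1) → ℕ} {d e : Fin (m + 1) → ℝ}
    (hde : ∀ i, (d i = c₁ i ∧ e i = c₂ i) ∨ (d i = c₂ i ∧ e i = c₁ i))
    (htwist : ∀ i, P.Twist i (κ i) (d i) (e i) (α i) (β i))
    (hupper : ∀ i : Fin m, P.transUpper c₁ c₂ i ≤ P.t i.succ - P.s i.castSucc)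
    (hlower : ∀ i : Fin m, P.transLower c₁ c₂ i ≤ P.t i.succ - P.s i.castSucc)
    (hκq : AdmissibleItinerary κ q) {j : Fin (m + 1) → ℕ}
    (hj : ∀ i, 1 ≤ j i ∧ α i + j i ≤ β i) :
    ∃ p ∈ rL, ∃ z, P.PartialSolution c₁ c₂ κ q (fun i => α i + j i) r₀ P.L univ univ p z := by
  obtain ⟨hκ, hq, hstep⟩ := hκq
  set PS := P.PartialSolution c₁ c₂ κ q (fun i => α i + j i) r₀ with hPS
  -- One interval of positive weight.
  have nonlinear : ∀ i : Fin (m + 1),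
      (∃ a b : ℝ, ∃ δ : ℝ → ℝ × ℝ, a ≤ b ∧ Continuous δ ∧ P.energy i (δ a) = c₁ i ∧
        P.energy i (δ b) = c₂ i ∧ ∀ s ∈ Icc a b, δ s ∈ P.block c₁ c₂ i (κ i) ∧
          ∃ z, PS (P.t i) {k | k < i} {k | k.succ ≤ i} (δ s) z) →
      ∃ a b : ℝ, ∃ η : ℝ → ℝ × ℝ, a ≤ b ∧ Continuous η ∧ (η a).2 = 0 ∧ (η b).1 = 0 ∧
        ∀ s ∈ Icc a b, η s ∈ P.block c₁ c₂ i (q i) ∧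
          ∃ z, PS (P.s i) {k | k ≤ i} {k | k.succ ≤ i} (η s) z := by
    rintro i ⟨a, b, δ, hab, hδ, ha, hb, hs⟩
    -- The path is oriented so that it starts on the slow boundary of the annulus.
    obtain ⟨a, b, δ, hab, hδ, ha, hb, hs⟩ : ∃ a b : ℝ, ∃ δ : ℝ → ℝ × ℝ, a ≤ b ∧ Continuous δ ∧
        P.energy i (δ a) = d i ∧ P.energy i (δ b) = e i ∧
        ∀ s ∈ Icc a b, δ s ∈ P.block c₁ c₂ i (κ i) ∧
          ∃ z, PS (P.t i) {k | k < i} {k | k.succ ≤ i} (δ s) z := by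
      rcases hde i with ⟨h1, h2⟩ | ⟨h1, h2⟩
      · exact ⟨a, b, δ, hab, hδ, h1 ▸ ha, h2 ▸ hb, hs⟩
      · refine ⟨-b, -a, fun s => δ (-s), by linarith, hδ.comp continuous_neg, ?_, ?_,
          fun s hs' => hs (-s) ⟨by linarith [hs'.2], by linarith [hs'.1]⟩⟩
        · simp only [neg_neg, hb, h1]
        · simp only [neg_neg, ha, h2]
    have hqκ : q i = (κ i).prev ∨ q i = (κ i).next := by
      rcases hκ i with h1 | h1 <;> rcases hq i with h2 | h2 <;>
        simp [h1, h2, Quadrant.prev, Quadrant.next]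
    obtain ⟨a', b', η, l1, l2, l3, hη, hηa, hηb, hs'⟩ := hg.exists_nonlinear_subpath (hc i).1
      (hκ i) hqκ (htwist i) (hj i).1 (hj i).2 hδ hab (fun s hs' => (hs s hs').1) ha hb
    refine ⟨a', b', η, l2, hη, hηa, hηb, fun s hsI => ?_⟩
    obtain ⟨hblock, w, w1, w2, w3, w4, w5, w6⟩ := hs' s hsI
    obtain ⟨hstart, z, hz⟩ := hs s ⟨l1.trans hsI.1, hsI.2.trans l3⟩
    obtain ⟨z', hz', hEq⟩ := hz.extend w1 w2 w3 (P.t_nonneg i) (P.t_lt_s i).le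
      (fun k hk => P.s_le_t hk) (fun k hk => P.strictMono_t.monotone hk)
    refine ⟨hblock, z', hz'.solutionOn, hz'.init, hz'.term, fun k hk => ?_, hz'.drift⟩
    rcases (show k ≤ i from hk).eq_or_lt with rfl | hlt
    · exact StageOK.congr ⟨w2 ▸ hstart, w3 ▸ hblock, w4, w5, w6⟩ hEq
    · exact hz'.stage k hlt
  have reach : ∀ i : Fin (m + 1),
      ∃ a b : ℝ, ∃ δ : ℝ → ℝ × ℝ, a ≤ b ∧ Continuous δ ∧ P.energy i (δ a) = c₁ i ∧
        P.energy i (δ b) = c₂ i ∧ ∀ s ∈ Icc a b, δ s ∈ P.block c₁ c₂ i (κ i) ∧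
          ∃ z, PS (P.t i) {k | k < i} {k | k.succ ≤ i} (δ s) z := by
    intro i
    induction i using Fin.induction with
    | zero =>
      obtain ⟨hrb, γ, -, hγ, h0, h1⟩ := hr₀
      refine ⟨0, 1, fun t => γ (projIcc 0 1 zero_le_one t), zero_le_one,
        γ.continuous.comp continuous_projIcc, by simpa using h0, by simpa using h1,
        fun s hs => ?_⟩
      have hmem : γ (projIcc 0 1 zero_le_one s) ∈ r₀ := hγ ▸ mem_range_self _
      refine ⟨hrb hmem, fun _ => γ (projIcc 0 1 zero_le_one s), ⟨⟨0, ?_⟩, fun t _ => (hrb hmem).1,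
        ∅, finite_empty, fun t ht => ?_⟩, hmem, rfl, fun k hk => ?_, fun k hk => ?_⟩
      · exact (LipschitzWith.const _).lipschitzOnWith
      · rw [P.t_zero] at ht
        exact absurd (ht.1.trans ht.2) (lt_irrefl _)
      · exact absurd hk (Fin.not_lt_zero k)
      · exact absurd hk (Fin.succ_pos k).not_ge
    | succ i ih =>
      obtain ⟨a, b, η, hab, hη, hηa, hηb, hs⟩ := nonlinear i.castSucc ih
      obtain ⟨a', b', δ, l1, l2, l3, hδ, ha, hb, hs'⟩ := hg.exists_degenerate_subpath hc
        (hupper i) (hlower i) (hstep i) hη hab (fun s hs' => (hs s hs').1) hηa hηb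
      refine ⟨a', b', δ, l2, hδ, ha, hb, fun s hsI => ?_⟩
      obtain ⟨hblock, w, w1, w2, w3, w4⟩ := hs' s hsI
      obtain ⟨-, z, hz⟩ := hs s ⟨l1.trans hsI.1, hsI.2.trans l3⟩
      have hts := (P.t_lt_s i.castSucc).le
      obtain ⟨z', hz', hEq⟩ := hz.extend w1 w2 w3 ((P.t_nonneg _).trans hts) (P.s_lt_t i).le
        (fun k hk => by
          rcases (show k ≤ i.castSucc from hk).eq_or_lt with rfl | hlt
          · exact le_rfl
          · exact (P.s_le_t hlt).trans hts)
        (fun k hk => (P.strictMono_t.monotone hk).trans hts)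
      refine ⟨hblock, z', hz'.solutionOn, hz'.init, hz'.term, fun k hk => hz'.stage k ?_,
        fun k hk => ?_⟩
      · exact Fin.le_castSucc_iff.2 hk
      · rcases (Fin.succ_le_succ_iff.1 hk).eq_or_lt with rfl | hlt
        · exact w4.congr hEq
        · exact hz'.drift k (Fin.succ_le_castSucc_iff.2 hlt)
  obtain ⟨a, b, η, hab, hη, hηa, hηb, hs⟩ := nonlinear _ (reach (Fin.last m))
  obtain ⟨s, hsI, hsr⟩ := hg.exists_mem_arc (hc _).1 hrL hη hab (fun s hs' => (hs s hs').1) hηa hηb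
  obtain ⟨-, z, hz⟩ := hs s hsI
  exact ⟨η s, hsr, z, hz.solutionOn, hz.init, hz.term, fun k _ => hz.stage k (Fin.le_last k),
    fun k _ => hz.drift k (Fin.le_last k.succ)⟩

lemma PartialSolution.isNodalSolution {κ q : Fin (m + 1) → Quadrant} {n : Fin (m + 1) → ℕ}
    {r₀ rL : Set (ℝ × ℝ)} {p : ℝ × ℝ} {z : ℝ → ℝ × ℝ}
    (hz : P.PartialSolution c₁ c₂ κ q n r₀ P.L univ univ p z) (hp : p ∈ rL) :
    P.IsNodalSolution 0 r₀ rL (fun t => (z t).1) (fun t => (z t).2) := by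
  have hL : 0 ≤ P.L := (P.t_nonneg _).trans (P.t_lt_s (Fin.last m)).le
  obtain ⟨K, hK⟩ := hz.solutionOn.lipschitz
  rw [← uIcc_of_le hL] at hK
  have hsub : Icc (P.t (Fin.last m)) (P.s (Fin.last m)) ⊆ Icc 0 P.L :=
    Icc_subset_Icc_left (P.t_nonneg _)
  refine ⟨⟨(LipschitzWith.prod_fst.comp_lipschitzOnWith hK).absolutelyContinuousOnInterval,
    (LipschitzWith.prod_snd.comp_lipschitzOnWith hK).absolutelyContinuousOnInterval,
    hz.solutionOn.mem_J, ?_, hz.init, hz.term ▸ hp⟩, ?_, ?_⟩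
  · obtain ⟨E, hE, hd⟩ := hz.solutionOn.hasDerivAt
    filter_upwards [(hE.union (toFinite {0, P.L})).countable.ae_notMem volume] with t hne ht
    simp only [mem_union, mem_insert_iff, mem_singleton_iff, not_or] at hne
    obtain ⟨d1, d2⟩ := hd t ⟨lt_of_le_of_ne ht.1 (Ne.symm hne.2.1), lt_of_le_of_ne ht.2 hne.2.2⟩
      hne.1
    refine ⟨d1, ?_⟩
    rwa [neg_zero, zero_mul, zero_sub]
  · obtain ⟨τ, hτ, h'⟩ := (hz.stage (Fin.last m) (mem_univ _)).exists_pos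
    exact ⟨τ, hsub hτ, h'⟩
  · obtain ⟨τ, hτ, h'⟩ := (hz.stage (Fin.last m) (mem_univ _)).exists_neg
    exact ⟨τ, hsub hτ, h'⟩

lemma PartialSolution.follows {κ q : Fin (m + 1) → Quadrant} {α j : Fin (m + 1) → ℕ}
    {r₀ : Set (ℝ × ℝ)} {p : ℝ × ℝ} {z : ℝ → ℝ × ℝ}
    (hz : P.PartialSolution c₁ c₂ κ q (fun i => α i + j i) r₀ P.L univ univ p z) :
    P.Follows c₁ c₂ α κ q j (fun t => (z t).1) (fun t => (z t).2) where
  at_t i := (hz.stage i (mem_univ i)).at_t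
  at_s i := (hz.stage i (mem_univ i)).at_s
  count_prev i := (hz.stage i (mem_univ i)).zeroCount.1
  count_next i := (hz.stage i (mem_univ i)).zeroCount.2
  count_degenerate i := hz.drift i (mem_univ i)

/-! ### Counting the solutions -/

lemma Icc_subset_domain (P : StepProblem m) (i : Fin (m + 1)) :
    Icc (P.t i) (P.s i) ⊆ Icc 0 P.L := by
  refine Icc_subset_Icc (P.t_nonneg i) ?_
  rcases (Fin.le_last i).eq_or_lt with rfl | hlt
  · exact le_rfl
  · exact (P.s_le_t hlt).trans (P.t_lt_s _).le

/-- The blocks of opposite quadrants are disjoint, because the origin is not in the annulus. -/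
lemma quadrant_eq_of_mem_block (hc : ∀ i, 0 < c₁ i) {i : Fin (m + 1)} {q q' : Quadrant}
    (hq : (q = .II ∨ q = .IV) ∧ (q' = .II ∨ q' = .IV)) {p : ℝ × ℝ}
    (hp : p ∈ P.block c₁ c₂ i q) (hp' : p ∈ P.block c₁ c₂ i q') : q = q' := by
  have key : ∀ x y : ℝ, x ≤ 0 → 0 ≤ y → 0 ≤ x → y ≤ 0 → c₁ i ≤ P.energy i (x, y) → False := by
    intro x y h1 h2 h3 h4 h5
    obtain rfl := le_antisymm h1 h3
    obtain rfl := le_antisymm h4 h2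
    have : P.energy i (0, 0) = 0 := by simp [energy, H, F, G]
    linarith [hc i]
  obtain ⟨rfl | rfl, rfl | rfl⟩ := hq
  · rfl
  · exact (key p.1 p.2 hp.2.2.2.1 hp.2.2.2.2 hp'.2.2.2.1 hp'.2.2.2.2 hp.2.1).elim
  · exact (key p.1 p.2 hp'.2.2.2.1 hp'.2.2.2.2 hp.2.2.2.1 hp.2.2.2.2 hp.2.1).elim
  · rfl

/-- The solution determines the itinerary, from its second quadrant on, and the counter. -/
lemma Follows.unique (hc : ∀ i, 0 < c₁ i) {α j j' : Fin (m + 1) → ℕ}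
    {κ q κ' q' : Fin (m + 1) → Quadrant} (hκq : AdmissibleItinerary κ q)
    (hκq' : AdmissibleItinerary κ' q') {x y x' y' : ℝ → ℝ}
    (hf : P.Follows c₁ c₂ α κ q j x y) (hf' : P.Follows c₁ c₂ α κ' q' j' x' y')
    (h0 : κ 0 = κ' 0) (hx : EqOn x x' (Icc 0 P.L)) (hy : EqOn y y' (Icc 0 P.L)) :
    q = q' ∧ j = j' := by
  have hqq : q = q' := by
    funext i
    refine quadrant_eq_of_mem_block hc ⟨hκq.2.1 i, hκq'.2.1 i⟩ (hf.at_s i) ?_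
    have hm := P.Icc_subset_domain i (right_mem_Icc.2 (P.t_lt_s i).le)
    rw [hx hm, hy hm]
    exact hf'.at_s i
  have hκκ : κ = κ' := by
    funext i
    refine Fin.cases h0 (fun i => ?_) i
    have h1 := hκq.2.2 i
    have h2 := hκq'.2.2 i
    rw [← hqq] at h2
    rcases h1 with ⟨a1, a2⟩ | ⟨a1, a2⟩ <;> rcases h2 with ⟨b1, b2⟩ | ⟨b1, b2⟩ <;>
      simp_all
  refine ⟨hqq, ?_⟩
  funext i
  have hset : {τ ∈ Icc (P.t i) (P.s i) | y τ = 0} = {τ ∈ Icc (P.t i) (P.s i) | y' τ = 0} := by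
    ext τ
    simp only [mem_ofPred_eq]
    exact and_congr_right fun hτ => by rw [hy (P.Icc_subset_domain i hτ)]
  have hqκ : q i = (κ i).prev ∨ q i = (κ i).next := by
    rcases hκq.1 i with h1 | h1 <;> rcases hκq.2.1 i with h2 | h2 <;>
      simp [h1, h2, Quadrant.prev, Quadrant.next]
  rcases hqκ with h1 | h1
  · have e1 := (hf.count_prev i h1).2
    have e2 := (hf'.count_prev i (hqq ▸ hκκ ▸ h1)).2
    rw [hset, e2] at e1
    have := Nat.cast_injective (R := ℕ∞) e1
    omega
  · have e1 := (hf.count_next i h1).2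
    have e2 := (hf'.count_next i (hqq ▸ hκκ ▸ h1)).2
    rw [hset, e2] at e1
    have := Nat.cast_injective (R := ℕ∞) e1
    omega

/-- The quadrants at the times `s_i` of the itinerary encoded by a sequence of booleans, which decide
between the second and the fourth quadrant for `i < m`. -/
def quadrantsAtS (qL : Quadrant) (b : Fin m → Bool) : Fin (m + 1) → Quadrant :=
  Fin.snoc (α := fun _ => Quadrant) (fun i => if b i then .II else .IV) qL

/-- The quadrants at the times `t_i` of the itinerary encoded by a sequence of booleans: each is
determined by the quadrant at the time `s_{i-1}`. -/
def quadrantsAtT (κ₀ : Quadrant) (b : Fin m → Bool) : Fin (m + 1) → Quadrant :=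
  Fin.cons (α := fun _ => Quadrant) κ₀ fun i => if b i then .I else .III

lemma admissibleItinerary_quadrants {κ₀ qL : Quadrant} (hκ₀ : κ₀ = .I ∨ κ₀ = .III)
    (hqL : qL = .II ∨ qL = .IV) (b : Fin m → Bool) :
    AdmissibleItinerary (quadrantsAtT κ₀ b) (quadrantsAtS qL b) := by
  refine ⟨fun i => ?_, fun i => ?_, fun i => ?_⟩
  · refine Fin.cases (by simpa [quadrantsAtT] using hκ₀) (fun i => ?_) i
    cases hb : b i <;> simp [quadrantsAtT, hb]
  · refine Fin.lastCases (by simpa [quadrantsAtS] using hqL) (fun i => ?_) i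
    cases hb : b i <;> simp [quadrantsAtS, hb]
  · cases hb : b i <;> simp [quadrantsAtT, quadrantsAtS, hb]

lemma quadrantsAtS_injective (qL : Quadrant) :
    Function.Injective (quadrantsAtS (m := m) qL) := by
  intro b b' hbb
  funext i
  have := congrFun hbb i.castSucc
  simp only [quadrantsAtS, Fin.snoc_castSucc] at this
  cases hb : b i <;> cases hb' : b' i <;> simp_all

end StepProblem

theorem theorem6p1 {m : ℕ} (P : StepProblem m)
    (c₁ c₂ : Fin (m + 1) → ℝ) (hc : ∀ i, P.AnnulusLevels i (c₁ i) (c₂ i))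
    (κ₀ qL : Quadrant) (hκ₀ : κ₀ = .I ∨ κ₀ = .III) (hqL : qL = .II ∨ qL = .IV)
    (r₀ rL : Set (ℝ × ℝ))
    (hr₀ : P.IsBoundaryArc c₁ c₂ 0 κ₀ r₀)
    (hrL : P.IsBoundaryArc c₁ c₂ (Fin.last m) qL rL)
    (α β : Fin (m + 1) → ℕ) (hαβ : ∀ i, α i < β i)
    (d e : Fin (m + 1) → ℝ)
    (hde : ∀ i, (d i = c₁ i ∧ e i = c₂ i) ∨ (d i = c₂ i ∧ e i = c₁ i))
    (htwist : ∀ i, ∀ κ : Quadrant, κ = .I ∨ κ = .III → P.Twist i κ (d i) (e i) (α i) (β i))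
    (hupper : ∀ i : Fin m, P.transUpper c₁ c₂ i ≤ P.t i.succ - P.s i.castSucc)
    (hlower : ∀ i : Fin m, P.transLower c₁ c₂ i ≤ P.t i.succ - P.s i.castSucc) :
    -- there are at least `2^m ∏ (β_i - α_i)` different nodal solutions on `[0, L]`,
    -- each of them with the nodal counter of some admissible itinerary
    ((2 ^ m * ∏ i, (β i - α i) : ℕ) : ℕ∞) ≤
      {w : Icc 0 P.L → ℝ × ℝ | ∃ x y : ℝ → ℝ, P.IsNodalSolution 0 r₀ rL x y ∧
        (∃ κ q : Fin (m + 1) → Quadrant, ∃ j : Fin (m + 1) → ℕ,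
          StepProblem.AdmissibleItinerary κ q ∧ κ 0 = κ₀ ∧ q (Fin.last m) = qL ∧
          (∀ i, 1 ≤ j i ∧ j i ≤ β i - α i) ∧ P.Follows c₁ c₂ α κ q j x y) ∧
        ∀ τ : Icc 0 P.L, w τ = (x τ, y τ)}.encard ∧
    -- and every admissible itinerary and every counter is realized
    ∀ κ q : Fin (m + 1) → Quadrant, ∀ j : Fin (m + 1) → ℕ,
      StepProblem.AdmissibleItinerary κ q → κ 0 = κ₀ → q (Fin.last m) = qL →
      (∀ i, 1 ≤ j i ∧ j i ≤ β i - α i) →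
      ∃ x y : ℝ → ℝ, P.IsNodalSolution 0 r₀ rL x y ∧ P.Follows c₁ c₂ α κ q j x y := by
  have hcc : ∀ i, 0 < c₁ i ∧ c₁ i < c₂ i := fun i => ⟨(hc i).1, (hc i).2.1⟩
  obtain ⟨h, g, hg⟩ := P.exists_isGlobal hc
  have main : ∀ κ q : Fin (m + 1) → Quadrant, ∀ j : Fin (m + 1) → ℕ,
      StepProblem.AdmissibleItinerary κ q → κ 0 = κ₀ → q (Fin.last m) = qL →
      (∀ i, 1 ≤ j i ∧ j i ≤ β i - α i) →
      ∃ x y : ℝ → ℝ, P.IsNodalSolution 0 r₀ rL x y ∧ P.Follows c₁ c₂ α κ q j x y := by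
    intro κ q j hκq hκ hq hj
    obtain ⟨p, hp, z, hz⟩ := hg.exists_solution hcc (hκ ▸ hr₀) (hq ▸ hrL) hde
      (fun i => htwist i (κ i) (hκq.1 i)) hupper hlower hκq
      (fun i => ⟨(hj i).1, by have := hαβ i; have := (hj i).2; omega⟩)
    exact ⟨_, _, hz.isNodalSolution hp, hz.follows⟩
  refine ⟨?_, main⟩
  let κ : (Fin m → Bool) → Fin (m + 1) → Quadrant := StepProblem.quadrantsAtT κ₀
  let q : (Fin m → Bool) → Fin (m + 1) → Quadrant := StepProblem.quadrantsAtS qL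
  have hκq : ∀ b, StepProblem.AdmissibleItinerary (κ b) (q b) := fun b =>
    StepProblem.admissibleItinerary_quadrants hκ₀ hqL b
  have hκ0 : ∀ b, κ b 0 = κ₀ := fun b => rfl
  have hqm : ∀ b, q b (Fin.last m) = qL := fun b => by simp [q, StepProblem.quadrantsAtS]
  let j : (∀ i, Fin (β i - α i)) → Fin (m + 1) → ℕ := fun n i => n i + 1
  have hj : ∀ n i, 1 ≤ j n i ∧ j n i ≤ β i - α i := fun n i => ⟨Nat.succ_pos _, (n i).2⟩
  choose x y hxy hf using fun v : (Fin m → Bool) × (∀ i, Fin (β i - α i)) =>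
    main (κ v.1) (q v.1) (j v.2) (hκq v.1) (hκ0 v.1) (hqm v.1) (hj v.2)
  let w : (Fin m → Bool) × (∀ i, Fin (β i - α i)) → Icc 0 P.L → ℝ × ℝ :=
    fun v τ => (x v τ, y v τ)
  have hw : Function.Injective w := by
    intro v v' hv
    have hx : EqOn (x v) (x v') (Icc 0 P.L) := fun τ hτ =>
      congrArg Prod.fst (congrFun hv ⟨τ, hτ⟩)
    have hy : EqOn (y v) (y v') (Icc 0 P.L) := fun τ hτ =>
      congrArg Prod.snd (congrFun hv ⟨τ, hτ⟩)
    obtain ⟨e1, e2⟩ := (hf v).unique (fun i => (hcc i).1) (hκq v.1) (hκq v'.1) (hf v') rfl hx hy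
    refine Prod.ext (StepProblem.quadrantsAtS_injective qL e1) ?_
    funext i
    exact Fin.ext (Nat.succ_injective (congrFun e2 i))
  have hcard : ((2 ^ m * ∏ i, (β i - α i) : ℕ) : ℕ∞) = (range w).encard := by
    rw [← image_univ, hw.encard_image, encard_univ, ENat.card_eq_coe_fintype_card]
    simp
  rw [hcard]
  apply encard_le_encard
  rintro _ ⟨v, rfl⟩
  exact ⟨x v, y v, hxy v, ⟨κ v.1, q v.1, j v.2, hκq v.1, hκ0 v.1, hqm v.1, hj v.2, hf v⟩,
    fun τ => rfl⟩
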